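/- Let $d\ge 2$ be an integer, $\mathbf T^d=(\mathbf R/2\pi\mathbf Z)^d$, and let $n>d/2+1$ be real. For real $m$, let $\mathbb H^m_{\Sigma 0}$ be the Sobolev space of real vector fields $v=\sum_{k\in\mathbf Z^d}v_k e_k$ on $\mathbf T^d$, $e_k(x)=(2\pi)^{-d/2}e^{ik\cdot x}$, with zero mean ($v_0=0$), zero divergence ($k\cdot v_k=0$) and $\sum_{k\neq 0}|k|^{2m}|v_k|^2<\infty$, with inner product $\langle v|w\rangle_m=\sum_{k\ne0}|k|^{2m}\overline{v_k}\cdot w_k$ and norm $\|\cdot\|_m$. Let $\mathscr P(v,w)=-\mathfrak L(v\cdot\partial w)$, where $\mathfrak L$ is the Leray projection, and let $K_n,G_n\in(0,\infty)$ be any constants such that $\|\mathscr P(v,w)\|_n\le K_n\|v\|_n\|w\|_{n+1}$ and $|\langle\mathscr P(v,w)|w\rangle_n|\le G_n\|v\|_n\|w\|_n^2$ for all $v\in\mathbb H^n_{\Sigma0}$, $w\in\mathbb H^{n+1}_{\Sigma0}$. Let $\nu\ge0$, $f\in C([0,\infty),\mathbb H^n_{\Sigma0})$ and $u_0\in\mathbb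 H^{n+2}_{\Sigma0}$. A solution of the Euler/NS Cauchy problem on $[0,T)$, $T\in(0,\infty]$, is a map $u\in C([0,T),\mathbb H^{n+2}_{\Sigma0})\cap C^1([0,T),\mathbb H^n_{\Sigma0})$ with $du/dt=\nu\Delta u+\mathscr P(u,u)+f$ and $u(0)=u_0$; it is maximal if it does not extend to a solution on a longer interval $[0,T')$, $T'>T$. Let $T_a\in(0,\infty]$ and let $u_a\in C([0,T_a),\mathbb H^{n+2}_{\Sigma0})\cap C^1([0,T_a),\mathbb H^n_{\Sigma0})$ be an approximate solution. Let $\epsilon_n,\mathcal D_n,\mathcal D_{n+1}\in C([0,T_a),[0,\infty))$ and $\delta_n\in[0,\infty)$ be such that $\|(du_a/dt-\nu\Delta u_a-\mathscr P(u_a,u_a)-f)(t)\|_n\le\epsilon_n(t)$, $\|u_a(t)\|_n\le\mathcal D_n(t)$ and $\|u_a(t)\|_{n+1}\le\mathcal D_{n+1}(t)$ for $t\in[0,T_a)$, and $\|u_a(0)-u_0\|_n\le\delta_n$. Let $T_c\in(0,T_a]$, and let $\mathscr R_n\in C([0,T_c),[0,\infty))$ fulfill the control inequalities $$\frac{d^+\mathscr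 R_n}{dt}\ge-\nu\mathscr R_n+(G_n\mathcal D_n+K_n\mathcal D_{n+1})\mathscr R_n+G_n\mathscr R_n^2+\epsilon_n\ \text{ everywhere on }[0,T_c),\qquad \mathscr R_n(0)\ge\delta_n,$$ where $d^+/dt$ is the right upper Dini derivative, with values in $[-\infty,+\infty]$. Then: (a) every maximal solution $u$ of the Cauchy problem, with domain $[0,T)$, satisfies $\|u(t)-u_a(t)\|_n\le\mathscr R_n(t)$ for all $t\in[0,\min(T_c,T))$; (b) if moreover $f\in L^1_{\rm loc}([0,\infty),\mathbb H^{n+2}_{\Sigma0})$ (for instance, if $f=0$ or $f\in C([0,\infty),\mathbb H^{n+2}_{\Sigma0})$), then a maximal solution exists, and every maximal solution $u$, with domain $[0,T)$, satisfies $T\ge T_c$ and $\|u(t)-u_a(t)\|_n\le\mathscr R_n(t)$ for all $t\in[0,T_c)$. -/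

import Mathlib

open Filter Topology MeasureTheory

noncomputable section

namespace EulerNS

/-- Right upper Dini derivative, with values in `[-∞, +∞]`. -/
def upperRightDini (g : ℝ → ℝ) (t : ℝ) : EReal :=
  limsup (fun h : ℝ => (((g (t + h) - g t) / h : ℝ) : EReal)) (𝓝[>] (0 : ℝ))

/-- The interval `[0, T)`, with `T` possibly infinite. -/
def timeDomain (T : EReal) : Set ℝ := {t | 0 ≤ t ∧ (t : EReal) < T}

/-- Vector fields on the torus `(ℝ / 2πℤ)^d`, given by their Fourier coefficients
`v_k ∈ ℂ^d`, `k ∈ ℤ^d`, with respect to the functions `fourierMode k`. -/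
abbrev VField (d : ℕ) : Type := (Fin d → ℤ) → EuclideanSpace ℂ (Fin d)

/-- `|k|`, the Euclidean norm of a wave vector. -/
def freqNorm {d : ℕ} (k : Fin d → ℤ) : ℝ := √(∑ s, (k s : ℝ) ^ 2)

/-- `k • c = ∑ k_s c_s` (no conjugation). -/
def freqDot {d : ℕ} (k : Fin d → ℤ) (c : EuclideanSpace ℂ (Fin d)) : ℂ := ∑ s, (k s : ℂ) * c s

/-- `e_k(x) = (2π)^{-d/2} e^{i k • x}`. -/
def fourierMode {d : ℕ} (k : Fin d → ℤ) (x : Fin d → ℝ) : ℂ :=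
  (((2 * Real.pi) ^ (-(d : ℝ) / 2) : ℝ) : ℂ) *
    Complex.exp (Complex.I * ((∑ s, (k s : ℝ) * x s : ℝ) : ℂ))

/-- The Sobolev space `H^m_{Σ0}` of real, zero mean, divergence free vector fields. -/
def HSigma (d : ℕ) (m : ℝ) : Set (VField d) :=
  {v | (∀ k r, v (-k) r = (starRingEnd ℂ) (v k r)) ∧ v 0 = 0 ∧ (∀ k, freqDot k (v k) = 0) ∧
    Summable fun k => freqNorm k ^ (2 * m) * ‖v k‖ ^ 2}

/-- The inner product `⟨v | w⟩_m = ∑_{k ≠ 0} |k|^{2m} conj(v_k) • w_k`. It is used on fields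
with `v_0 = w_0 = 0`, so the term `k = 0` vanishes; on real fields the imaginary parts of the
terms `k` and `-k` cancel. -/
def sobolevInner {d : ℕ} (m : ℝ) (v w : VField d) : ℝ :=
  ∑' k, freqNorm k ^ (2 * m) * (inner ℂ (v k) (w k)).re

/-- The norm `‖v‖_m = √⟨v | v⟩_m`. -/
def sobolevNorm {d : ℕ} (m : ℝ) (v : VField d) : ℝ := √(sobolevInner m v v)

/-- The Laplacian, `(Δ v)_k = -|k|² v_k`. -/
def laplacian {d : ℕ} (v : VField d) : VField d := fun k => -(freqNorm k ^ 2) • v k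

/-- The `r`-th component of the vector field as a (`2π`-periodic) function of the point `x`. -/
def fieldValue {d : ℕ} (v : VField d) (r : Fin d) (x : Fin d → ℝ) : ℂ :=
  ∑' k, v k r * fourierMode k x

/-- The pointwise product `(v • ∂ w)_r (x) = ∑_s v_s(x) ∂_s w_r(x)`. -/
def advection {d : ℕ} (v w : VField d) (r : Fin d) (x : Fin d → ℝ) : ℂ :=
  ∑ s, fieldValue v s x * lineDeriv ℝ (fieldValue w r) x (Pi.single s 1)

/-- Fourier coefficient `∫_{T^d} g(x) e_{-k}(x) dx` of a periodic function. -/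
def fourierCoefficient {d : ℕ} (g : (Fin d → ℝ) → ℂ) (k : Fin d → ℤ) : ℂ :=
  ∫ x in Set.Icc (0 : Fin d → ℝ) (fun _ => 2 * Real.pi), g x * fourierMode (-k) x

/-- Orthogonal projection of `ℂ^d` onto `k^⊥`; it is the identity for `k = 0`. -/
def lerayAt {d : ℕ} (k : Fin d → ℤ) (c : EuclideanSpace ℂ (Fin d)) : EuclideanSpace ℂ (Fin d) :=
  WithLp.toLp 2 fun r => c r - freqDot k c * (k r : ℂ) / ((freqNorm k ^ 2 : ℝ) : ℂ)

/-- The bilinear map `P(v, w) = - L (v • ∂ w)`, with `L` the Leray projection. -/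
def eulerBilinear {d : ℕ} (v w : VField d) : VField d := fun k =>
  -lerayAt k (WithLp.toLp 2 fun r => fourierCoefficient (advection v w r) k)

/-- `K` is a positive constant with `‖P(v,w)‖_n ≤ K ‖v‖_n ‖w‖_{n+1}`. -/
def IsBasicConstant (d : ℕ) (n K : ℝ) : Prop :=
  0 < K ∧ ∀ v ∈ HSigma d n, ∀ w ∈ HSigma d (n + 1),
    sobolevNorm n (eulerBilinear v w) ≤ K * sobolevNorm n v * sobolevNorm (n + 1) w

/-- `G` is a positive constant with `|⟨P(v,w) | w⟩_n| ≤ G ‖v‖_n ‖w‖_n²`. -/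
def IsKatoConstant (d : ℕ) (n G : ℝ) : Prop :=
  0 < G ∧ ∀ v ∈ HSigma d n, ∀ w ∈ HSigma d (n + 1),
    |sobolevInner n (eulerBilinear v w) w| ≤ G * sobolevNorm n v * sobolevNorm n w ^ 2

/-- `u ∈ C([0,T), H^m_{Σ0})`. -/
def IsContinuousInto {d : ℕ} (m : ℝ) (T : EReal) (u : ℝ → VField d) : Prop :=
  (∀ t ∈ timeDomain T, u t ∈ HSigma d m) ∧
    ∀ t ∈ timeDomain T,
      Tendsto (fun s => sobolevNorm m (u s - u t)) (𝓝[timeDomain T] t) (𝓝 0)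

/-- `u ∈ C^1([0,T), H^m_{Σ0})` with derivative `u'` (one-sided at `t = 0`). -/
def IsC1Into {d : ℕ} (m : ℝ) (T : EReal) (u u' : ℝ → VField d) : Prop :=
  IsContinuousInto m T u ∧ IsContinuousInto m T u' ∧
    ∀ t ∈ timeDomain T,
      Tendsto (fun s => sobolevNorm m ((s - t)⁻¹ • (u s - u t) - u' t))
        (𝓝[timeDomain T \ {t}] t) (𝓝 0)

/-- `u` on `[0,T)` solves `du/dt = ν Δ u + P(u,u) + f`, `u(0) = u₀`, with
`u ∈ C([0,T), H^{n+2}_{Σ0}) ∩ C^1([0,T), H^n_{Σ0})`. -/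
def IsSolution {d : ℕ} (n ν : ℝ) (f : ℝ → VField d) (u₀ : VField d) (T : EReal)
    (u : ℝ → VField d) : Prop :=
  0 < T ∧ IsContinuousInto (n + 2) T u ∧
    (∃ u' : ℝ → VField d, IsC1Into n T u u' ∧
      ∀ t ∈ timeDomain T, u' t = ν • laplacian (u t) + eulerBilinear (u t) (u t) + f t) ∧
    u 0 = u₀

/-- A maximal, i.e. nonextendable, solution. -/
def IsMaximalSolution {d : ℕ} (n ν : ℝ) (f : ℝ → VField d) (u₀ : VField d) (T : EReal)
    (u : ℝ → VField d) : Prop :=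
  IsSolution n ν f u₀ T u ∧
    ∀ (T' : EReal) (v : ℝ → VField d), T < T' → IsSolution n ν f u₀ T' v →
      ¬ ∀ t ∈ timeDomain T, v t = u t

/-- `f ∈ L^1_loc([0,+∞), H^m_{Σ0})`, for an `f` which is continuous into some Sobolev space. -/
def IsLocallyIntegrableInto {d : ℕ} (m : ℝ) (f : ℝ → VField d) : Prop :=
  (∀ᵐ t ∂(volume.restrict (Set.Ici (0 : ℝ))), f t ∈ HSigma d m) ∧
    LocallyIntegrableOn (fun t => sobolevNorm m (f t)) (Set.Ici (0 : ℝ))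

/-- An approximate solution `uₐ ∈ C([0,Tₐ), H^{n+2}_{Σ0}) ∩ C^1([0,Tₐ), H^n_{Σ0})`, with time
derivative `uₐ'`. -/
def IsApproxSolution {d : ℕ} (n : ℝ) (Ta : EReal) (ua ua' : ℝ → VField d) : Prop :=
  0 < Ta ∧ IsContinuousInto (n + 2) Ta ua ∧ IsC1Into n Ta ua ua'

/-- The differential error `e(uₐ) = duₐ/dt - ν Δ uₐ - P(uₐ,uₐ) - f`. -/
def differentialError {d : ℕ} (ν : ℝ) (f ua ua' : ℝ → VField d) (t : ℝ) : VField d :=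
  ua' t - ν • laplacian (ua t) - eulerBilinear (ua t) (ua t) - f t

/-- `b ∈ C([0,T), [0,+∞))`, and `b` bounds the norm of order `m` of the curve `z`. -/
def IsEstimator {d : ℕ} (m : ℝ) (T : EReal) (z : ℝ → VField d) (b : ℝ → ℝ) : Prop :=
  ContinuousOn b (timeDomain T) ∧ ∀ t ∈ timeDomain T, 0 ≤ b t ∧ sobolevNorm m (z t) ≤ b t

/-- `R ∈ C([0,T_c), [0,+∞))` fulfills the control inequalities. Here `ε`, `δ`, `D`, `D₁` stand
for the estimators `ε_n`, `δ_n`, `𝒟_n`, `𝒟_{n+1}`. -/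
def ControlInequalities (ν K G : ℝ) (ε : ℝ → ℝ) (δ : ℝ) (D D₁ : ℝ → ℝ) (Tc : EReal)
    (R : ℝ → ℝ) : Prop :=
  ContinuousOn R (timeDomain Tc) ∧ (∀ t ∈ timeDomain Tc, 0 ≤ R t) ∧
    (∀ t ∈ timeDomain Tc,
      ((-ν * R t + (G * D t + K * D₁ t) * R t + G * R t ^ 2 + ε t : ℝ) : EReal)
        ≤ upperRightDini R t) ∧
    δ ≤ R 0

end EulerNS

end

noncomputable section

namespace EulerNS

variable {d : ℕ}

/-! ### Wave vectors -/

/-! The bound is an energy estimate followed by a scalar comparison. With `w = u - uₐ` and `e` the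
differential error, `dw/dt = ν Δw + P(u,w) + P(w,uₐ) - e`. In `⟨dw/dt | w⟩_n` the viscous term is at
most `-ν ‖w‖²`, since there is no zero mode; Kato's inequality controls `P(u,w)` without loss of
derivatives, the basic inequality controls `P(w,uₐ)`, and `‖u‖_n ≤ ‖w‖_n + 𝒟_n`. Hence `‖w‖_n` is a
subsolution of the scalar equation of which `R` is a supersolution (`sobolevInner_difference_le`),
and `le_of_upperRightDini` gives `‖w‖_n ≤ R`. With `uₐ` an exact solution and `R = 0`, the same
argument is uniqueness (`IsSolution.eq_of_isSolution`).

For the existence time, the bound keeps `‖u‖_n ≤ R + 𝒟_n` finite up to any `T < T_c`. If the length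
of the local existence interval depends on the data only through norms of order `n`, a restart
shortly before `T` extends the solution past `T`. The real work is therefore local existence in
order `n + 2` for a time governed by order `n` (`exists_isSolution_of_le`).

Local existence uses Galerkin approximations. Kato's inequality bounds them in order `n` on an
interval independent of the cutoff. Weighted energies with weights `min(|k|^{n+2}, |k|^{n+3}/L)`
obey a commutator estimate whose constant does not depend on `L` or on the cutoff, and which
involves only the bound of order `n` (`IsGalerkin.tail_le`). For `L = 1` this is boundedness in
order `n + 2`; for `L → ∞` it is uniform smallness of the high frequencies, which makes the limit
strongly continuous in order `n + 2` although `f` is only integrable in time there. The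
approximations are Cauchy in order `n` at rate `1/N`, hence by interpolation in order `n + 1`, which
suffices to pass to the limit in the equation. -/

theorem freqNorm_eq_norm (k : Fin d → ℤ) :
    freqNorm k = ‖(WithLp.toLp 2 (fun s => (k s : ℝ)) : EuclideanSpace ℝ (Fin d))‖ := by
  simp [freqNorm, EuclideanSpace.norm_eq]

theorem freqNorm_nonneg (k : Fin d → ℤ) : 0 ≤ freqNorm k := Real.sqrt_nonneg _

@[simp] theorem freqNorm_zero : freqNorm (0 : Fin d → ℤ) = 0 := by simp [freqNorm]

@[simp] theorem freqNorm_neg (k : Fin d → ℤ) : freqNorm (-k) = freqNorm k := by simp [freqNorm]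

theorem freqNorm_add_le (k l : Fin d → ℤ) : freqNorm (k + l) ≤ freqNorm k + freqNorm l := by
  simp only [freqNorm_eq_norm]
  refine le_trans (le_of_eq ?_) (norm_add_le _ _)
  congr 1
  ext s
  simp

theorem freqNorm_le_sub_add (k l : Fin d → ℤ) : freqNorm k ≤ freqNorm (k - l) + freqNorm l := by
  simpa using freqNorm_add_le (k - l) l

theorem freqNorm_sub_comm (k l : Fin d → ℤ) : freqNorm (k - l) = freqNorm (l - k) := by
  rw [← freqNorm_neg, neg_sub]

theorem freqNorm_sq (k : Fin d → ℤ) : freqNorm k ^ 2 = ∑ s, (k s : ℝ) ^ 2 :=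
  Real.sq_sqrt (Finset.sum_nonneg fun _ _ => sq_nonneg _)

theorem abs_le_freqNorm (k : Fin d → ℤ) (s : Fin d) : |(k s : ℝ)| ≤ freqNorm k := by
  apply Real.abs_le_sqrt
  exact Finset.single_le_sum (f := fun s => (k s : ℝ) ^ 2) (fun _ _ => sq_nonneg _)
    (Finset.mem_univ s)

theorem one_le_freqNorm {k : Fin d → ℤ} (hk : k ≠ 0) : 1 ≤ freqNorm k := by
  obtain ⟨s, hs⟩ := Function.ne_iff.mp hk
  refine le_trans ?_ (abs_le_freqNorm k s)
  have : 1 ≤ |k s| := Int.one_le_abs hs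
  exact_mod_cast this

theorem freqNorm_pos {k : Fin d → ℤ} (hk : k ≠ 0) : 0 < freqNorm k :=
  lt_of_lt_of_le one_pos (one_le_freqNorm hk)

theorem freqNorm_eq_zero_or_one_le (k : Fin d → ℤ) : freqNorm k = 0 ∨ 1 ≤ freqNorm k := by
  by_cases hk : k = 0
  · simp [hk]
  · exact Or.inr (one_le_freqNorm hk)

/-- Nonzero wave vectors have length at least 1. Positivity of `a` matters only for `k = 0`, where
`0 ^ 0 = 1` would break the inequality. -/
theorem freqNorm_rpow_mono {a b : ℝ} (ha : 0 < a) (hab : a ≤ b) (k : Fin d → ℤ) :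
    freqNorm k ^ a ≤ freqNorm k ^ b := by
  rcases freqNorm_eq_zero_or_one_le k with h | h
  · rw [h, Real.zero_rpow ha.ne', Real.zero_rpow (ha.trans_le hab).ne']
  · exact Real.rpow_le_rpow_of_exponent_le h hab

theorem freqNorm_rpow_two_mul (m : ℝ) (k : Fin d → ℤ) :
    freqNorm k ^ (2 * m) = (freqNorm k ^ m) ^ 2 := by
  rw [mul_comm, Real.rpow_mul (freqNorm_nonneg k)]
  norm_num

theorem finite_setOf_freqNorm_le (N : ℝ) : {k : Fin d → ℤ | freqNorm k ≤ N}.Finite := by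
  refine (Set.finite_Icc (fun _ => -⌈N⌉ : Fin d → ℤ) (fun _ => ⌈N⌉)).subset fun k hk => ?_
  have h : ∀ s, |(k s : ℝ)| ≤ N := fun s => (abs_le_freqNorm k s).trans hk
  refine ⟨fun s => ?_, fun s => ?_⟩ <;>
    have h1 := abs_le.mp ((h s).trans (Int.le_ceil N)) <;> simp only
  · exact_mod_cast h1.1
  · exact_mod_cast h1.2

theorem norm_freqDot_le (k : Fin d → ℤ) (c : EuclideanSpace ℂ (Fin d)) :
    ‖freqDot k c‖ ≤ freqNorm k * ‖c‖ := by
  have h := norm_inner_le_norm (𝕜 := ℂ)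
    (WithLp.toLp 2 (fun s => (k s : ℂ)) : EuclideanSpace ℂ (Fin d)) c
  have h1 : ‖(WithLp.toLp 2 (fun s => (k s : ℂ)) : EuclideanSpace ℂ (Fin d))‖ = freqNorm k := by
    simp [freqNorm, EuclideanSpace.norm_eq]
  rw [h1] at h
  refine le_trans (le_of_eq ?_) h
  simp [freqDot, PiLp.inner_apply, mul_comm]

theorem freqDot_add (k : Fin d → ℤ) (b c : EuclideanSpace ℂ (Fin d)) :
    freqDot k (b + c) = freqDot k b + freqDot k c := by
  simp [freqDot, mul_add, Finset.sum_add_distrib]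

theorem freqDot_smul (k : Fin d → ℤ) (a : ℝ) (c : EuclideanSpace ℂ (Fin d)) :
    freqDot k (a • c) = a * freqDot k c := by
  simp [freqDot, Finset.mul_sum, mul_left_comm]

theorem freqDot_neg (k : Fin d → ℤ) (c : EuclideanSpace ℂ (Fin d)) :
    freqDot k (-c) = - freqDot k c := by
  simp [freqDot]

theorem freqDot_zero_right (k : Fin d → ℤ) : freqDot k (0 : EuclideanSpace ℂ (Fin d)) = 0 := by
  simp [freqDot]

theorem continuous_freqDot (k : Fin d → ℤ) :
    Continuous (freqDot k : EuclideanSpace ℂ (Fin d) → ℂ) := by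
  unfold freqDot; fun_prop

theorem freqDot_sub_left (k l : Fin d → ℤ) (c : EuclideanSpace ℂ (Fin d)) :
    freqDot (k - l) c = freqDot k c - freqDot l c := by
  simp [freqDot, sub_mul, Finset.sum_sub_distrib]

/-- `∑ |k|^{-2s}` converges over the nonzero wave vectors as soon as `2 s > d`. -/
theorem summable_freqNorm_rpow {a : ℝ} (ha : a < -(d : ℝ)) :
    Summable fun k : Fin d → ℤ => freqNorm k ^ a := by
  -- Wave vectors are identified with the lattice spanned by the standard basis, whose rank is `d`,
  -- and lattice summability is pulled back along this injection.
  let b : Module.Basis (Fin d) ℝ (EuclideanSpace ℝ (Fin d)) :=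
    (EuclideanSpace.basisFun (Fin d) ℝ).toBasis
  let Λ := Submodule.span ℤ (Set.range b)
  have hrank : Module.finrank ℤ Λ = d := by
    rw [ZLattice.rank ℝ Λ]; simp
  have h := ZLattice.summable_norm_rpow (L := Λ) a (by rw [hrank]; exact ha)
  let φ : (Fin d → ℤ) → Λ := fun k => ⟨WithLp.toLp 2 (fun s => (k s : ℝ)), by
    have : (WithLp.toLp 2 (fun s => (k s : ℝ)) : EuclideanSpace ℝ (Fin d)) = ∑ s, k s • b s := by
      ext r
      simp [b, Pi.single_apply]
    rw [this]
    exact Submodule.sum_mem _ fun s _ =>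
      Submodule.smul_mem _ _ (Submodule.subset_span ⟨s, rfl⟩)⟩
  have hφ : Function.Injective φ := by
    intro k l hkl
    have h1 := congrArg (fun x : Λ => (x : EuclideanSpace ℝ (Fin d))) hkl
    funext s
    have h2 := congrArg (fun x : EuclideanSpace ℝ (Fin d) => x s) h1
    simpa [φ] using h2
  refine (h.comp_injective hφ).congr fun k => ?_
  simp [freqNorm_eq_norm, φ]

/-! ### Sobolev norms as norms of a Hilbert space of sequences -/

theorem real_inner_eq_re (a b : EuclideanSpace ℂ (Fin d)) :
    inner ℝ a b = (inner ℂ a b).re := by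
  simp only [PiLp.inner_apply, Complex.re_sum]
  rfl

/-- Square summable families of Fourier coefficients. -/
abbrev CoeffSpace (d : ℕ) : Type :=
  lp (fun _ : Fin d → ℤ => EuclideanSpace ℂ (Fin d)) 2

/-- The finiteness condition in the definition of the Sobolev space of order `m`. -/
def SobolevSummable (m : ℝ) (v : VField d) : Prop :=
  Summable fun k => freqNorm k ^ (2 * m) * ‖v k‖ ^ 2

theorem norm_rpow_smul_sq (m : ℝ) (v : VField d) (k : Fin d → ℤ) :
    ‖(freqNorm k ^ m) • v k‖ ^ 2 = freqNorm k ^ (2 * m) * ‖v k‖ ^ 2 := by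
  rw [norm_smul, mul_pow, Real.norm_eq_abs, sq_abs, freqNorm_rpow_two_mul]

theorem memℓp_iff_sobolevSummable (m : ℝ) (v : VField d) :
    Memℓp (fun k => (freqNorm k ^ m) • v k) 2 ↔ SobolevSummable m v := by
  rw [memℓp_gen_iff (by norm_num)]
  refine summable_congr fun k => ?_
  rw [← norm_rpow_smul_sq]
  norm_num

open Classical in
/-- The family `|k|^m v_k` as an element of the sequence space (`0` if it is not square
summable). -/
def toCoeff (m : ℝ) (v : VField d) : CoeffSpace d :=
  if h : Memℓp (fun k => (freqNorm k ^ m) • v k) 2 then ⟨_, h⟩ else 0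

theorem toCoeff_apply {m : ℝ} {v : VField d} (h : SobolevSummable m v) (k : Fin d → ℤ) :
    toCoeff m v k = (freqNorm k ^ m) • v k := by
  rw [toCoeff, dif_pos ((memℓp_iff_sobolevSummable m v).2 h)]

theorem sobolevInner_self (m : ℝ) (v : VField d) :
    sobolevInner m v v = ∑' k, freqNorm k ^ (2 * m) * ‖v k‖ ^ 2 := by
  refine tsum_congr fun k => ?_
  rw [inner_self_eq_norm_sq_to_K]
  norm_cast

/-- No summability is required: otherwise the `tsum` has the default value 0, and so does `toCoeff`.
-/
theorem norm_toCoeff (m : ℝ) (v : VField d) : ‖toCoeff m v‖ = sobolevNorm m v := by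
  rw [sobolevNorm, sobolevInner_self]
  by_cases h : SobolevSummable m v
  · rw [lp.norm_eq_tsum_rpow (by norm_num), Real.sqrt_eq_rpow]
    norm_num
    congr 1
    refine tsum_congr fun k => ?_
    rw [toCoeff_apply h, norm_rpow_smul_sq]
  · rw [tsum_eq_zero_of_not_summable h, toCoeff,
      dif_neg (mt (memℓp_iff_sobolevSummable m v).1 h)]
    simp

theorem sobolevNorm_nonneg (m : ℝ) (v : VField d) : 0 ≤ sobolevNorm m v := Real.sqrt_nonneg _

theorem sobolevNorm_sq (m : ℝ) (v : VField d) :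
    sobolevNorm m v ^ 2 = ∑' k, freqNorm k ^ (2 * m) * ‖v k‖ ^ 2 := by
  rw [sobolevNorm, Real.sq_sqrt, sobolevInner_self]
  rw [sobolevInner_self]
  exact tsum_nonneg fun k => mul_nonneg (Real.rpow_nonneg (freqNorm_nonneg k) _) (sq_nonneg _)

namespace SobolevSummable

variable {m : ℝ} {v w : VField d}

theorem add (hv : SobolevSummable m v) (hw : SobolevSummable m w) :
    SobolevSummable m (v + w) := by
  rw [← memℓp_iff_sobolevSummable] at *
  simpa [smul_add] using! hv.add hw

theorem neg (hv : SobolevSummable m v) : SobolevSummable m (-v) := by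
  simpa [SobolevSummable] using hv

theorem sub (hv : SobolevSummable m v) (hw : SobolevSummable m w) :
    SobolevSummable m (v - w) := by
  simpa [sub_eq_add_neg] using hv.add hw.neg

theorem smul (c : ℝ) (hv : SobolevSummable m v) : SobolevSummable m (c • v) := by
  refine (hv.mul_left (c ^ 2)).congr fun k => ?_
  rw [Pi.smul_apply, norm_smul, mul_pow, Real.norm_eq_abs, sq_abs]
  ring

theorem mono {m' : ℝ} (hm : 0 < m) (hmm : m ≤ m') (hv : SobolevSummable m' v) :
    SobolevSummable m v := by
  refine Summable.of_nonneg_of_le (fun k => ?_) (fun k => ?_) hv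
  · exact mul_nonneg (Real.rpow_nonneg (freqNorm_nonneg k) _) (sq_nonneg _)
  · exact mul_le_mul_of_nonneg_right (freqNorm_rpow_mono (by linarith) (by linarith) k)
      (sq_nonneg _)

theorem of_support {S : Finset (Fin d → ℤ)} (h : ∀ k ∉ S, v k = 0) (m : ℝ) :
    SobolevSummable m v :=
  summable_of_ne_finset_zero (s := S) fun k hk => by simp [h k hk]

theorem toCoeff_add (hv : SobolevSummable m v) (hw : SobolevSummable m w) :
    toCoeff m (v + w) = toCoeff m v + toCoeff m w := by
  ext1; funext k
  rw [lp.coeFn_add, Pi.add_apply, toCoeff_apply hv, toCoeff_apply hw, toCoeff_apply (hv.add hw),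
    Pi.add_apply, smul_add]

theorem toCoeff_sub (hv : SobolevSummable m v) (hw : SobolevSummable m w) :
    toCoeff m (v - w) = toCoeff m v - toCoeff m w := by
  ext1; funext k
  rw [lp.coeFn_sub, Pi.sub_apply, toCoeff_apply hv, toCoeff_apply hw, toCoeff_apply (hv.sub hw),
    Pi.sub_apply, smul_sub]

theorem toCoeff_smul (hv : SobolevSummable m v) (c : ℝ) :
    toCoeff m (c • v) = c • toCoeff m v := by
  ext1; funext k
  rw [lp.coeFn_smul, Pi.smul_apply, toCoeff_apply hv, toCoeff_apply (hv.smul c),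
    Pi.smul_apply, smul_comm]

/-- Through this identity bilinearity, symmetry and Cauchy–Schwarz for `sobolevInner` are inherited
from the Hilbert space of sequences. -/
theorem re_inner_toCoeff (hv : SobolevSummable m v) (hw : SobolevSummable m w) :
    inner ℝ (toCoeff m v) (toCoeff m w) = sobolevInner m v w := by
  have h := (lp.hasSum_inner (𝕜 := ℝ) (toCoeff m v) (toCoeff m w)).tsum_eq
  refine h.symm.trans (tsum_congr fun k => ?_)
  rw [toCoeff_apply hv, toCoeff_apply hw, freqNorm_rpow_two_mul]
  refine (real_inner_smul_left _ _ _).trans ?_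
  rw [real_inner_smul_right, real_inner_eq_re]
  ring

theorem abs_sobolevInner_le (hv : SobolevSummable m v) (hw : SobolevSummable m w) :
    |sobolevInner m v w| ≤ sobolevNorm m v * sobolevNorm m w := by
  rw [← hv.re_inner_toCoeff hw, ← norm_toCoeff, ← norm_toCoeff]
  exact abs_real_inner_le_norm _ _

theorem sobolevInner_add_left {z : VField d} (hv : SobolevSummable m v)
    (hw : SobolevSummable m w) (hz : SobolevSummable m z) :
    sobolevInner m (v + w) z = sobolevInner m v z + sobolevInner m w z := by
  rw [← hv.re_inner_toCoeff hz, ← hw.re_inner_toCoeff hz, ← (hv.add hw).re_inner_toCoeff hz,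
    hv.toCoeff_add hw, inner_add_left]

theorem sobolevInner_sub_left {z : VField d} (hv : SobolevSummable m v)
    (hw : SobolevSummable m w) (hz : SobolevSummable m z) :
    sobolevInner m (v - w) z = sobolevInner m v z - sobolevInner m w z := by
  rw [← hv.re_inner_toCoeff hz, ← hw.re_inner_toCoeff hz, ← (hv.sub hw).re_inner_toCoeff hz,
    hv.toCoeff_sub hw, inner_sub_left]

theorem norm_add_le (hv : SobolevSummable m v) (hw : SobolevSummable m w) :
    sobolevNorm m (v + w) ≤ sobolevNorm m v + sobolevNorm m w := by
  simp only [← norm_toCoeff, hv.toCoeff_add hw]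
  exact _root_.norm_add_le _ _

theorem norm_sub_le (hv : SobolevSummable m v) (hw : SobolevSummable m w) :
    sobolevNorm m (v - w) ≤ sobolevNorm m v + sobolevNorm m w := by
  simp only [← norm_toCoeff, hv.toCoeff_sub hw]
  exact _root_.norm_sub_le _ _

theorem sum_le (hv : SobolevSummable m v) (S : Finset (Fin d → ℤ)) :
    ∑ k ∈ S, freqNorm k ^ (2 * m) * ‖v k‖ ^ 2 ≤ sobolevNorm m v ^ 2 := by
  rw [sobolevNorm_sq]
  exact hv.sum_le_tsum S fun k _ =>
    mul_nonneg (Real.rpow_nonneg (freqNorm_nonneg k) _) (sq_nonneg _)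

theorem rpow_mul_norm_le (hv : SobolevSummable m v) (k : Fin d → ℤ) :
    freqNorm k ^ m * ‖v k‖ ≤ sobolevNorm m v := by
  refine le_of_sq_le_sq ?_ (sobolevNorm_nonneg _ _)
  simpa [mul_pow, freqNorm_rpow_two_mul] using hv.sum_le {k}

theorem norm_mono {m' : ℝ} (hm : 0 < m) (hmm : m ≤ m') (hv : SobolevSummable m' v) :
    sobolevNorm m v ≤ sobolevNorm m' v := by
  refine le_of_sq_le_sq ?_ (sobolevNorm_nonneg _ _)
  rw [sobolevNorm_sq, sobolevNorm_sq]
  exact (hv.mono hm hmm).tsum_le_tsum (fun k => mul_le_mul_of_nonneg_right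
    (freqNorm_rpow_mono (by linarith) (by linarith) k) (sq_nonneg _)) hv

end SobolevSummable

theorem sobolevNorm_neg (m : ℝ) (v : VField d) : sobolevNorm m (-v) = sobolevNorm m v := by
  simp [sobolevNorm, sobolevInner]

theorem sobolevNorm_sub_comm (m : ℝ) (v w : VField d) :
    sobolevNorm m (v - w) = sobolevNorm m (w - v) := by
  rw [← sobolevNorm_neg, neg_sub]

theorem sobolevNorm_zero (m : ℝ) : sobolevNorm m (0 : VField d) = 0 := by
  simp [sobolevNorm, sobolevInner]

theorem sobolevNorm_smul (m c : ℝ) (v : VField d) :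
    sobolevNorm m (c • v) = |c| * sobolevNorm m v := by
  rw [← sq_eq_sq₀ (sobolevNorm_nonneg _ _) (mul_nonneg (abs_nonneg c) (sobolevNorm_nonneg _ _)),
    mul_pow, sq_abs, sobolevNorm_sq, sobolevNorm_sq, ← tsum_mul_left]
  refine tsum_congr fun k => ?_
  rw [Pi.smul_apply, norm_smul, mul_pow, Real.norm_eq_abs, sq_abs]
  ring

theorem sobolevSummable_of_sum_le {m B : ℝ} {v : VField d}
    (h : ∀ S : Finset (Fin d → ℤ), ∑ k ∈ S, freqNorm k ^ (2 * m) * ‖v k‖ ^ 2 ≤ B) :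
    SobolevSummable m v :=
  summable_of_sum_le (fun k => mul_nonneg (Real.rpow_nonneg (freqNorm_nonneg k) _) (sq_nonneg _)) h

/-! ### The spaces of divergence free fields -/

section HSigma

variable {m : ℝ} {v w : VField d}

theorem HSigma.summable (hv : v ∈ HSigma d m) : SobolevSummable m v := hv.2.2.2

/-- Real, zero mean, divergence free fields, without regularity. -/
def solenoidal (d : ℕ) : Submodule ℝ (VField d) where
  carrier := {v | (∀ k r, v (-k) r = (starRingEnd ℂ) (v k r)) ∧ v 0 = 0 ∧
    ∀ k, freqDot k (v k) = 0}
  add_mem' := by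
    rintro v w ⟨h1, h2, h3⟩ ⟨h1', h2', h3'⟩
    refine ⟨fun k r => ?_, by simp [h2, h2'], fun k => ?_⟩
    · simp [h1, h1']
    · rw [Pi.add_apply, freqDot_add, h3, h3', add_zero]
  zero_mem' := ⟨by simp, rfl, fun k => freqDot_zero_right k⟩
  smul_mem' := by
    rintro c v ⟨h1, h2, h3⟩
    refine ⟨fun k r => ?_, by simp [h2], fun k => ?_⟩
    · simp [h1]
    · rw [Pi.smul_apply, freqDot_smul, h3, mul_zero]

theorem mem_HSigma_iff : v ∈ HSigma d m ↔ v ∈ solenoidal d ∧ SobolevSummable m v :=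
  ⟨fun h => ⟨⟨h.1, h.2.1, h.2.2.1⟩, h.2.2.2⟩, fun h => ⟨h.1.1, h.1.2.1, h.1.2.2, h.2⟩⟩

theorem HSigma.add (hv : v ∈ HSigma d m) (hw : w ∈ HSigma d m) : v + w ∈ HSigma d m := by
  rw [mem_HSigma_iff] at *
  exact ⟨add_mem hv.1 hw.1, hv.2.add hw.2⟩

theorem HSigma.sub (hv : v ∈ HSigma d m) (hw : w ∈ HSigma d m) : v - w ∈ HSigma d m := by
  rw [mem_HSigma_iff] at *
  exact ⟨sub_mem hv.1 hw.1, hv.2.sub hw.2⟩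

theorem HSigma.smul (c : ℝ) (hv : v ∈ HSigma d m) : c • v ∈ HSigma d m := by
  rw [mem_HSigma_iff] at *
  exact ⟨Submodule.smul_mem _ c hv.1, hv.2.smul c⟩

theorem HSigma.zero : (0 : VField d) ∈ HSigma d m :=
  mem_HSigma_iff.2 ⟨zero_mem _, by simp [SobolevSummable]⟩

theorem HSigma.mono {m' : ℝ} (hm : 0 < m) (hmm : m ≤ m') (hv : v ∈ HSigma d m') :
    v ∈ HSigma d m := by
  rw [mem_HSigma_iff] at *
  exact ⟨hv.1, hv.2.mono hm hmm⟩

/-- The zero mode vanishes and the other weights are at least 1. This turns norm convergence into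
convergence of each coefficient. -/
theorem HSigma.norm_apply_le (hm : 0 < m) (hv : v ∈ HSigma d m) (k : Fin d → ℤ) :
    ‖v k‖ ≤ sobolevNorm m v := by
  by_cases hk : k = 0
  · rw [hk, hv.2.1, norm_zero]; exact sobolevNorm_nonneg _ _
  · refine le_trans ?_ (HSigma.summable hv |>.rpow_mul_norm_le k)
    exact le_mul_of_one_le_left (norm_nonneg _) (Real.one_le_rpow (one_le_freqNorm hk) hm.le)

theorem HSigma.eq_of_norm_sub_eq_zero (hm : 0 < m) (hv : v ∈ HSigma d m) (hw : w ∈ HSigma d m)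
    (h : sobolevNorm m (v - w) ≤ 0) : v = w := by
  funext k
  have h1 := (HSigma.norm_apply_le hm (HSigma.sub hv hw) k).trans h
  rwa [Pi.sub_apply, norm_le_zero_iff, sub_eq_zero] at h1

theorem freqNorm_laplacian_rpow (v : VField d) (k : Fin d → ℤ) (hm : 0 < m) :
    freqNorm k ^ (2 * m) * ‖laplacian v k‖ ^ 2 = freqNorm k ^ (2 * (m + 2)) * ‖v k‖ ^ 2 := by
  rw [laplacian, norm_smul, norm_neg, norm_pow, Real.norm_eq_abs, abs_of_nonneg (freqNorm_nonneg k)]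
  rcases freqNorm_eq_zero_or_one_le k with h | h
  · simp [h, Real.zero_rpow (show 2 * m ≠ 0 by linarith),
      Real.zero_rpow (show 2 * (m + 2) ≠ 0 by linarith)]
  · rw [show 2 * (m + 2) = 2 * m + (4 : ℕ) by push_cast; ring,
      Real.rpow_add_natCast (by linarith)]
    ring

theorem HSigma.laplacian (hm : 0 < m) (hv : v ∈ HSigma d (m + 2)) :
    laplacian v ∈ HSigma d m := by
  refine mem_HSigma_iff.2 ⟨⟨fun k r => ?_, ?_, fun k => ?_⟩, ?_⟩
  · simp [EulerNS.laplacian, hv.1]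
  · simp [EulerNS.laplacian]
  · rw [EulerNS.laplacian, freqDot_smul, hv.2.2.1, mul_zero]
  · exact hv.2.2.2.congr fun k => (freqNorm_laplacian_rpow v k hm).symm

theorem sobolevNorm_laplacian (hm : 0 < m) (v : VField d) :
    sobolevNorm m (EulerNS.laplacian v) = sobolevNorm (m + 2) v := by
  rw [← sq_eq_sq₀ (sobolevNorm_nonneg _ _) (sobolevNorm_nonneg _ _), sobolevNorm_sq,
    sobolevNorm_sq]
  exact tsum_congr fun k => freqNorm_laplacian_rpow v k hm

theorem laplacian_sub (v w : VField d) :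
    EulerNS.laplacian (v - w) = EulerNS.laplacian v - EulerNS.laplacian w := by
  funext k; simp [EulerNS.laplacian, smul_sub]

theorem sobolevInner_laplacian (hm : 0 < m) (v : VField d) :
    sobolevInner m (EulerNS.laplacian v) v = - sobolevNorm (m + 1) v ^ 2 := by
  rw [sobolevNorm_sq, ← tsum_neg]
  refine tsum_congr fun k => ?_
  have h2 : (inner ℂ (EulerNS.laplacian v k) (v k)).re = -(freqNorm k ^ 2 * ‖v k‖ ^ 2) := by
    have h3 := real_inner_smul_left (v k) (v k) (-(freqNorm k ^ 2))
    rw [real_inner_self_eq_norm_sq, real_inner_eq_re, neg_mul] at h3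
    exact h3
  rw [h2]
  rcases freqNorm_eq_zero_or_one_le k with h | h
  · simp [h, Real.zero_rpow (show 2 * (m + 1) ≠ 0 by linarith)]
  · rw [show 2 * (m + 1) = 2 * m + (2 : ℕ) by push_cast; ring,
      Real.rpow_add_natCast (by linarith)]
    ring

/-- Poincaré's inequality for zero mean fields; it is the source of the term `-ν R` in the control
inequality. -/
theorem sobolevInner_laplacian_le (hm : 0 < m) (hv : v ∈ HSigma d (m + 2)) :
    sobolevInner m (EulerNS.laplacian v) v ≤ - sobolevNorm m v ^ 2 := by
  have hs1 : SobolevSummable (m + 1) v := (HSigma.summable hv).mono (by linarith) (by linarith)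
  rw [sobolevInner_laplacian hm, neg_le_neg_iff]
  gcongr
  · exact sobolevNorm_nonneg _ _
  · exact hs1.norm_mono hm (by linarith)

/-- Interpolation between the orders `m` and `m + 2`. -/
theorem HSigma.sobolevNorm_sq_le_mul (hm : 0 < m) (hv : v ∈ HSigma d (m + 2)) :
    sobolevNorm (m + 1) v ^ 2 ≤ sobolevNorm m v * sobolevNorm (m + 2) v := by
  -- Cauchy–Schwarz for `⟨Δv | v⟩_m = -‖v‖²_{m+1}`, where `‖Δv‖_m = ‖v‖_{m+2}`.
  have h1 := (HSigma.summable (HSigma.laplacian hm hv)).abs_sobolevInner_le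
    (HSigma.summable (HSigma.mono hm (by linarith) hv))
  rwa [sobolevInner_laplacian hm, abs_neg, abs_of_nonneg (sq_nonneg _), sobolevNorm_laplacian hm,
    mul_comm] at h1

end HSigma

/-! ### Fourier series of the bilinear map -/

/-- The normalization `(2π)^{-d/2}` of the Fourier basis. -/
def modeConst (d : ℕ) : ℝ := (2 * Real.pi) ^ (-(d : ℝ) / 2)

theorem modeConst_pos (d : ℕ) : 0 < modeConst d := Real.rpow_pos_of_pos (by positivity) _

/-- Three normalized modes integrated over a torus of volume `(2π)^d` leave a single normalization
factor. -/
theorem modeConst_cube (d : ℕ) : modeConst d ^ 3 * (2 * Real.pi) ^ d = modeConst d := by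
  have h : (0 : ℝ) < 2 * Real.pi := by positivity
  rw [modeConst, ← Real.rpow_natCast, ← Real.rpow_natCast, ← Real.rpow_mul h.le,
    ← Real.rpow_add h]
  congr 1
  push_cast
  ring

theorem fourierMode_eq (k : Fin d → ℤ) (x : Fin d → ℝ) :
    fourierMode k x =
      (modeConst d : ℂ) * Complex.exp (Complex.I * ((∑ s, (k s : ℝ) * x s : ℝ) : ℂ)) := rfl

theorem norm_fourierMode (k : Fin d → ℤ) (x : Fin d → ℝ) :
    ‖fourierMode k x‖ = modeConst d := by
  rw [fourierMode_eq, norm_mul, mul_comm Complex.I, Complex.norm_exp_ofReal_mul_I, mul_one,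
    Complex.norm_real, Real.norm_of_nonneg (modeConst_pos d).le]

theorem continuous_fourierMode (k : Fin d → ℤ) : Continuous (fourierMode k) := by
  unfold fourierMode; fun_prop

theorem norm_coord_le (c : EuclideanSpace ℂ (Fin d)) (r : Fin d) : ‖c r‖ ≤ ‖c‖ :=
  PiLp.norm_apply_le c r

theorem summable_norm_mul_fourierMode {v : VField d} (hv : Summable fun k => ‖v k‖) (r : Fin d)
    (x : Fin d → ℝ) : Summable fun k => ‖v k r * fourierMode k x‖ := by
  refine Summable.of_nonneg_of_le (fun _ => norm_nonneg _) (fun k => ?_)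
    (hv.mul_right (modeConst d))
  rw [norm_mul, norm_fourierMode]
  exact mul_le_mul_of_nonneg_right (norm_coord_le _ _) (modeConst_pos d).le

/-- The series may be differentiated term by term, because `∑ |l| ‖w_l‖` majorizes the
differentiated series uniformly along the line. -/
theorem lineDeriv_fieldValue {w : VField d} (hw : Summable fun k => ‖w k‖)
    (hw' : Summable fun k => freqNorm k * ‖w k‖) (r s : Fin d) (x : Fin d → ℝ) :
    lineDeriv ℝ (fieldValue w r) x (Pi.single s 1) =
      ∑' l, Complex.I * (l s : ℂ) * w l r * fourierMode l x := by
  have hshift : ∀ (l : Fin d → ℤ) (t : ℝ),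
      fourierMode l (x + t • (Pi.single s 1 : Fin d → ℝ)) =
        fourierMode l x * Complex.exp ((t : ℂ) * (Complex.I * (l s : ℂ))) := fun l t => by
    rw [fourierMode_eq, fourierMode_eq, mul_assoc, ← Complex.exp_add]
    congr 2
    have : ∑ q, (l q : ℝ) * (x + t • (Pi.single s 1 : Fin d → ℝ)) q =
        ∑ q, (l q : ℝ) * x q + l s * t := by
      simp [mul_add, Finset.sum_add_distrib, Pi.single_apply]
    rw [this]
    push_cast
    ring
  have hder : HasDerivAt (fun t : ℝ => ∑' l, w l r *
        fourierMode l (x + t • (Pi.single s 1 : Fin d → ℝ)))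
      (∑' l, w l r * (fourierMode l (x + (0 : ℝ) • (Pi.single s 1 : Fin d → ℝ)) *
        (Complex.I * (l s : ℂ)))) 0 := by
    refine hasDerivAt_tsum (u := fun l => freqNorm l * ‖w l‖ * modeConst d)
      (g' := fun l t => w l r * (fourierMode l (x + t • (Pi.single s 1 : Fin d → ℝ)) *
        (Complex.I * (l s : ℂ)))) (y₀ := 0) (hw'.mul_right _) (fun l t => ?_) (fun l t => ?_) ?_ 0
    · refine HasDerivAt.const_mul _ ?_
      simp only [hshift]
      have h1 : HasDerivAt (fun t : ℝ => (t : ℂ) * (Complex.I * (l s : ℂ)))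
          (1 * (Complex.I * (l s : ℂ))) t :=
        HasDerivAt.mul_const (Complex.ofRealCLM.hasDerivAt (x := t)) _
      have h2 := (h1.cexp).const_mul (fourierMode l x)
      rwa [one_mul, ← mul_assoc] at h2
    · rw [norm_mul, norm_mul, norm_fourierMode, norm_mul, Complex.norm_I, one_mul]
      have h1 : ‖(l s : ℂ)‖ ≤ freqNorm l := by
        have := abs_le_freqNorm l s
        rwa [← Complex.norm_intCast] at this
      calc ‖w l r‖ * (modeConst d * ‖(l s : ℂ)‖) ≤ ‖w l‖ * (modeConst d * freqNorm l) := by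
            have := (modeConst_pos d).le
            gcongr
            exact norm_coord_le _ _
        _ = _ := by ring
    · exact (summable_norm_mul_fourierMode hw r _).of_norm
  rw [lineDeriv]
  refine hder.deriv.trans (tsum_congr fun l => ?_)
  rw [zero_smul, add_zero]
  ring

theorem integral_exp_freq (q : ℤ) :
    ∫ t in Set.Icc (0 : ℝ) (2 * Real.pi), Complex.exp (Complex.I * ((q : ℝ) * t : ℝ)) =
      if q = 0 then ((2 * Real.pi : ℝ) : ℂ) else 0 := by
  have hpi : (0 : ℝ) ≤ 2 * Real.pi := by positivity
  split_ifs with hq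
  · subst hq
    simp [Measure.real, Real.pi_nonneg]
  · rw [integral_Icc_eq_integral_Ioc, ← intervalIntegral.integral_of_le hpi]
    have hc : Complex.I * (q : ℂ) ≠ 0 := mul_ne_zero Complex.I_ne_zero (by exact_mod_cast hq)
    have h := integral_exp_mul_complex (a := 0) (b := 2 * Real.pi) hc
    have h1 : Complex.exp (Complex.I * (q : ℂ) * ((2 * Real.pi : ℝ) : ℂ)) = 1 := by
      rw [← Complex.exp_int_mul_two_pi_mul_I q]
      congr 1
      push_cast
      ring
    rw [h1] at h
    simp only [Complex.ofReal_zero, mul_zero, Complex.exp_zero, sub_self, zero_div] at h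
    rw [← h]
    refine intervalIntegral.integral_congr fun t _ => ?_
    congr 1
    push_cast
    ring

theorem integral_exp_freq_pi (q : Fin d → ℤ) :
    ∫ x in Set.Icc (0 : Fin d → ℝ) (fun _ => 2 * Real.pi),
        Complex.exp (Complex.I * ((∑ s, (q s : ℝ) * x s : ℝ) : ℂ)) =
      if q = 0 then (((2 * Real.pi) ^ d : ℝ) : ℂ) else 0 := by
  have hset : Set.Icc (0 : Fin d → ℝ) (fun _ => 2 * Real.pi) =
      Set.univ.pi fun _ => Set.Icc (0 : ℝ) (2 * Real.pi) := by
    rw [Set.pi_univ_Icc]; rfl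
  have hprod : ∀ x : Fin d → ℝ, Complex.exp (Complex.I * ((∑ s, (q s : ℝ) * x s : ℝ) : ℂ)) =
      ∏ s, Complex.exp (Complex.I * (((q s : ℝ) * x s : ℝ) : ℂ)) := fun x => by
    rw [← Complex.exp_sum, Complex.ofReal_sum, Finset.mul_sum]
  simp only [hprod]
  rw [hset, volume_pi, Measure.restrict_pi_pi]
  rw [integral_fintype_prod_eq_prod (𝕜 := ℂ)
    (f := fun s (t : ℝ) => Complex.exp (Complex.I * (((q s : ℝ) * t : ℝ) : ℂ)))]
  simp only [integral_exp_freq]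
  split_ifs with hq
  · simp [hq]
  · obtain ⟨s, hs⟩ := Function.ne_iff.mp hq
    exact Finset.prod_eq_zero (Finset.mem_univ s) (if_neg hs)

theorem integral_fourierMode_mul (h l k : Fin d → ℤ) :
    ∫ x in Set.Icc (0 : Fin d → ℝ) (fun _ => 2 * Real.pi),
        fourierMode h x * fourierMode l x * fourierMode (-k) x =
      if h + l = k then (modeConst d : ℂ) else 0 := by
  have h1 : ∀ x : Fin d → ℝ, fourierMode h x * fourierMode l x * fourierMode (-k) x =
      (modeConst d : ℂ) ^ 3 *
        Complex.exp (Complex.I * ((∑ s, ((h + l - k) s : ℝ) * x s : ℝ) : ℂ)) := fun x => by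
    have h2 : ∑ s, ((h + l - k) s : ℝ) * x s = ∑ s, (h s : ℝ) * x s + ∑ s, (l s : ℝ) * x s
        + ∑ s, ((-k) s : ℝ) * x s := by
      rw [← Finset.sum_add_distrib, ← Finset.sum_add_distrib]
      refine Finset.sum_congr rfl fun s _ => ?_
      simp only [Pi.add_apply, Pi.sub_apply, Pi.neg_apply]
      push_cast
      ring
    rw [h2]
    simp only [fourierMode_eq, Complex.ofReal_add, mul_add, Complex.exp_add]
    ring
  simp only [h1]
  rw [integral_const_mul, integral_exp_freq_pi]
  simp only [sub_eq_zero]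
  split_ifs
  · exact_mod_cast congrArg Complex.ofReal (modeConst_cube d)
  · simp

/-- Fourier coefficients of `v • ∂ w`. -/
theorem fourierCoefficient_advection {v w : VField d} (hv : Summable fun k => ‖v k‖)
    (hw : Summable fun k => ‖w k‖) (hw' : Summable fun k => freqNorm k * ‖w k‖) (r : Fin d)
    (k : Fin d → ℤ) :
    fourierCoefficient (advection v w r) k =
      modeConst d * ∑' l, Complex.I * freqDot l (v (k - l)) * w l r := by
  have hsd : ∀ (s : Fin d) (x : Fin d → ℝ),
      Summable fun l => ‖Complex.I * (l s : ℂ) * w l r * fourierMode l x‖ := fun s x => by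
    refine Summable.of_nonneg_of_le (fun _ => norm_nonneg _) (fun l => ?_)
      (hw'.mul_right (modeConst d))
    rw [norm_mul, norm_fourierMode, norm_mul, norm_mul, Complex.norm_I, one_mul]
    have h1 : ‖(l s : ℂ)‖ ≤ freqNorm l := by
      have := abs_le_freqNorm l s
      rwa [← Complex.norm_intCast] at this
    gcongr
    · exact (modeConst_pos d).le
    · exact freqNorm_nonneg _
    · exact norm_coord_le _ _
  -- The product of two absolutely convergent series is written as one series over pairs of wave
  -- vectors.
  have hadv : ∀ x, advection v w r x = ∑' p : (Fin d → ℤ) × (Fin d → ℤ),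
      Complex.I * freqDot p.2 (v p.1) * w p.2 r * (fourierMode p.1 x * fourierMode p.2 x) := by
    intro x
    rw [advection]
    have h1 : ∀ s, fieldValue v s x * lineDeriv ℝ (fieldValue w r) x (Pi.single s 1) =
        ∑' p : (Fin d → ℤ) × (Fin d → ℤ), v p.1 s * fourierMode p.1 x *
          (Complex.I * (p.2 s : ℂ) * w p.2 r * fourierMode p.2 x) := fun s => by
      rw [lineDeriv_fieldValue hw hw', fieldValue]
      exact tsum_mul_tsum_of_summable_norm (summable_norm_mul_fourierMode hv s x) (hsd s x)
    simp only [h1]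
    rw [← Summable.tsum_finsetSum fun s _ => summable_mul_of_summable_norm
      (summable_norm_mul_fourierMode hv s x) (hsd s x)]
    refine tsum_congr fun p => ?_
    simp only [freqDot, Finset.mul_sum, Finset.sum_mul]
    exact Finset.sum_congr rfl fun s _ => by ring
  rw [fourierCoefficient]
  set μ := volume.restrict (Set.Icc (0 : Fin d → ℝ) (fun _ => 2 * Real.pi)) with hμ
  have : IsFiniteMeasure μ := ⟨by
    rw [hμ, Measure.restrict_apply_univ]; exact isCompact_Icc.measure_lt_top⟩
  set F : (Fin d → ℤ) × (Fin d → ℤ) → (Fin d → ℝ) → ℂ := fun p x =>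
    Complex.I * freqDot p.2 (v p.1) * w p.2 r *
      (fourierMode p.1 x * fourierMode p.2 x * fourierMode (-k) x) with hF
  have hFeq : ∀ x, advection v w r x * fourierMode (-k) x = ∑' p, F p x := fun x => by
    rw [hadv, ← tsum_mul_right]
    exact tsum_congr fun p => by simp only [hF]; ring
  have hFnorm : ∀ p x, ‖F p x‖ ≤ ‖v p.1‖ * (freqNorm p.2 * ‖w p.2‖) * modeConst d ^ 3 :=
    fun p x => by
      simp only [hF, norm_mul, Complex.norm_I, one_mul, norm_fourierMode]
      have h1 := norm_freqDot_le p.2 (v p.1)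
      have h2 := norm_coord_le (w p.2) r
      calc ‖freqDot p.2 (v p.1)‖ * ‖w p.2 r‖ * (modeConst d * modeConst d * modeConst d)
          ≤ (freqNorm p.2 * ‖v p.1‖) * ‖w p.2‖ * (modeConst d * modeConst d * modeConst d) := by
            have := (modeConst_pos d).le
            have := freqNorm_nonneg p.2
            gcongr
        _ = _ := by ring
  have hFcont : ∀ p, Continuous (F p) := fun p => by
    have h1 := continuous_fourierMode p.1
    have h2 := continuous_fourierMode p.2
    have h3 := continuous_fourierMode (-k)
    simp only [hF]
    fun_prop
  have hFint : ∀ p, Integrable (F p) μ := fun p =>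
    Integrable.of_bound (hFcont p).aestronglyMeasurable _ (ae_of_all _ (hFnorm p))
  have hFsum : Summable fun p => ∫ x, ‖F p x‖ ∂μ := by
    have hs : Summable fun p : (Fin d → ℤ) × (Fin d → ℤ) =>
        ‖v p.1‖ * (freqNorm p.2 * ‖w p.2‖) :=
      hv.mul_of_nonneg hw' (fun _ => norm_nonneg _)
        (fun l => mul_nonneg (freqNorm_nonneg l) (norm_nonneg _))
    refine Summable.of_nonneg_of_le (fun p => integral_nonneg fun _ => norm_nonneg _)
      (fun p => ?_) ((hs.mul_right (modeConst d ^ 3)).mul_left (μ.real Set.univ))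
    refine (integral_mono (hFint p).norm (integrable_const _) (hFnorm p)).trans ?_
    rw [integral_const, smul_eq_mul]
  simp only [hFeq]
  -- Absolute summability allows integration term by term; orthogonality then leaves only the pairs
  -- with sum `k`.
  rw [← integral_tsum_of_summable_integral_norm hFint hFsum]
  have hterm : ∀ p, ∫ x, F p x ∂μ = Complex.I * freqDot p.2 (v p.1) * w p.2 r *
      (if p.1 + p.2 = k then (modeConst d : ℂ) else 0) := fun p => by
    simp only [hF]
    rw [integral_const_mul, integral_fourierMode_mul]
  simp only [hterm]
  -- The surviving pairs are parametrized by their second entry, which turns the double series into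
  -- a convolution.
  have hinj : Function.Injective fun l : Fin d → ℤ => (k - l, l) := fun a b h => (Prod.ext_iff.1 h).2
  rw [← hinj.tsum_eq]
  · simp only [sub_add_cancel, if_true]
    rw [tsum_mul_right, mul_comm]
  · intro p hp
    refine ⟨p.2, ?_⟩
    by_contra hne
    refine hp (show _ * (if p.1 + p.2 = k then (modeConst d : ℂ) else 0) = 0 from ?_)
    rw [if_neg, mul_zero]
    rintro rfl
    exact hne (by simp)

/-! ### The Leray projection -/

theorem lerayAt_eq (k : Fin d → ℤ) (c : EuclideanSpace ℂ (Fin d)) :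
    lerayAt k c = c - (freqDot k c / ((freqNorm k ^ 2 : ℝ) : ℂ)) •
      (WithLp.toLp 2 (fun s => (k s : ℂ)) : EuclideanSpace ℂ (Fin d)) := by
  ext r
  simp [lerayAt]
  ring

theorem norm_toLp_freq (k : Fin d → ℤ) :
    ‖(WithLp.toLp 2 (fun s => (k s : ℂ)) : EuclideanSpace ℂ (Fin d))‖ = freqNorm k := by
  simp [freqNorm, EuclideanSpace.norm_eq]

/-- The factor 2 is the triangle inequality, not the sharp constant 1. It enters only auxiliary
constants, never `K` or `G`. -/
theorem norm_lerayAt_le (k : Fin d → ℤ) (c : EuclideanSpace ℂ (Fin d)) :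
    ‖lerayAt k c‖ ≤ 2 * ‖c‖ := by
  rw [lerayAt_eq, two_mul]
  refine (norm_sub_le _ _).trans (add_le_add_right ?_ _)
  rw [norm_smul, norm_div, norm_toLp_freq, Complex.norm_real, norm_pow, Real.norm_eq_abs,
    abs_of_nonneg (freqNorm_nonneg k)]
  rcases (freqNorm_nonneg k).eq_or_lt with h | h
  · simp [← h]
  · rw [div_mul_eq_mul_div, div_le_iff₀ (by positivity)]
    calc ‖freqDot k c‖ * freqNorm k ≤ freqNorm k * ‖c‖ * freqNorm k :=
          mul_le_mul_of_nonneg_right (norm_freqDot_le k c) h.le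
      _ = _ := by ring

theorem freqDot_sub (k : Fin d → ℤ) (b c : EuclideanSpace ℂ (Fin d)) :
    freqDot k (b - c) = freqDot k b - freqDot k c := by
  rw [sub_eq_add_neg, freqDot_add, freqDot_neg, sub_eq_add_neg]

theorem lerayAt_sub (k : Fin d → ℤ) (b c : EuclideanSpace ℂ (Fin d)) :
    lerayAt k (b - c) = lerayAt k b - lerayAt k c := by
  rw [lerayAt_eq, lerayAt_eq, lerayAt_eq, freqDot_sub, sub_div, sub_smul]
  abel

theorem freqDot_lerayAt (k : Fin d → ℤ) (c : EuclideanSpace ℂ (Fin d)) :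
    freqDot k (lerayAt k c) = 0 := by
  by_cases hk : k = 0
  · simp [hk, freqDot]
  · have h1 : ∑ s, (k s : ℂ) * (k s : ℂ) = ((freqNorm k ^ 2 : ℝ) : ℂ) := by
      rw [freqNorm_sq]
      push_cast
      exact Finset.sum_congr rfl fun s _ => by ring
    have h2 : ((freqNorm k ^ 2 : ℝ) : ℂ) ≠ 0 := by
      exact_mod_cast (pow_pos (freqNorm_pos hk) 2).ne'
    have h3 : freqDot k (lerayAt k c) =
        freqDot k c - freqDot k c / ((freqNorm k ^ 2 : ℝ) : ℂ) * ∑ s, (k s : ℂ) * (k s : ℂ) := by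
      rw [Finset.mul_sum]
      conv_lhs => rw [freqDot]
      conv_rhs => rw [freqDot, ← Finset.sum_sub_distrib]
      refine Finset.sum_congr rfl fun s _ => ?_
      simp only [lerayAt, freqDot]
      ring
    rw [h3, h1, div_mul_cancel₀ _ h2, sub_self]

/-- The part removed by the projection is parallel to `k`, hence orthogonal to divergence free
fields: the pressure does no work. -/
theorem inner_lerayAt {k : Fin d → ℤ} {b : EuclideanSpace ℂ (Fin d)} (hb : freqDot k b = 0)
    (c : EuclideanSpace ℂ (Fin d)) : inner ℂ (lerayAt k c) b = inner ℂ c b := by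
  have h : inner ℂ (WithLp.toLp 2 (fun s => (k s : ℂ)) : EuclideanSpace ℂ (Fin d)) b = 0 := by
    rw [← hb]
    simp [freqDot, PiLp.inner_apply, mul_comm]
  rw [lerayAt_eq, inner_sub_left, inner_smul_left, h, mul_zero, sub_zero]

/-! ### Absolutely convergent Fourier series -/

/-- The constant of the embedding of the Sobolev space of order `n` in the space of fields with
absolutely convergent series of first derivatives. -/
def embedConst (d : ℕ) (n : ℝ) : ℝ := √(∑' k : Fin d → ℤ, freqNorm k ^ (2 * (1 - n)))

theorem embedConst_nonneg (d : ℕ) (n : ℝ) : 0 ≤ embedConst d n := Real.sqrt_nonneg _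

section embed

variable {n : ℝ} {v w : VField d}

/-- Cauchy–Schwarz for `|k| ‖v_k‖ = |k|^{1-n} (|k|^n ‖v_k‖)`; the first factor is square summable
because `2(n - 1) > d`. -/
theorem sum_freqNorm_mul_norm_le (hn : (d : ℝ) / 2 + 1 < n) (hv : SobolevSummable n v)
    (S : Finset (Fin d → ℤ)) :
    ∑ k ∈ S, freqNorm k * ‖v k‖ ≤ embedConst d n * sobolevNorm n v := by
  have hd : (0 : ℝ) ≤ d := Nat.cast_nonneg d
  have h0 : ∀ k : Fin d → ℤ, 0 ≤ freqNorm k ^ (2 * (1 - n)) := fun k =>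
    Real.rpow_nonneg (freqNorm_nonneg k) _
  have hs : Summable fun k : Fin d → ℤ => freqNorm k ^ (2 * (1 - n)) :=
    summable_freqNorm_rpow (by linarith)
  refine le_of_sq_le_sq ?_ (mul_nonneg (embedConst_nonneg _ _) (sobolevNorm_nonneg _ _))
  rw [mul_pow, embedConst, Real.sq_sqrt (tsum_nonneg h0)]
  refine (Finset.sum_sq_le_sum_mul_sum_of_sq_le_mul S (fun k _ => h0 k)
    (g := fun k => freqNorm k ^ (2 * n) * ‖v k‖ ^ 2) (fun k _ => ?_) (fun k _ => ?_)).trans ?_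
  · exact mul_nonneg (Real.rpow_nonneg (freqNorm_nonneg k) _) (sq_nonneg _)
  · rcases freqNorm_eq_zero_or_one_le k with h | h
    · simp [h, Real.zero_rpow (show 2 * n ≠ 0 by linarith)]
    · refine le_of_eq ?_
      rw [← mul_assoc, ← Real.rpow_add (by linarith), mul_pow]
      congr 1
      rw [show 2 * (1 - n) + 2 * n = (2 : ℕ) by push_cast; ring, Real.rpow_natCast]
  · exact mul_le_mul (hs.sum_le_tsum S fun k _ => h0 k) (hv.sum_le S)
      (Finset.sum_nonneg fun k _ =>
        mul_nonneg (Real.rpow_nonneg (freqNorm_nonneg k) _) (sq_nonneg _)) (tsum_nonneg h0)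

theorem summable_freqNorm_mul_norm (hn : (d : ℝ) / 2 + 1 < n) (hv : SobolevSummable n v) :
    Summable fun k => freqNorm k * ‖v k‖ :=
  summable_of_sum_le (fun k => mul_nonneg (freqNorm_nonneg k) (norm_nonneg _))
    (sum_freqNorm_mul_norm_le hn hv)

theorem tsum_freqNorm_mul_norm_le (hn : (d : ℝ) / 2 + 1 < n) (hv : SobolevSummable n v) :
    ∑' k, freqNorm k * ‖v k‖ ≤ embedConst d n * sobolevNorm n v :=
  (summable_freqNorm_mul_norm hn hv).tsum_le_of_sum_le (sum_freqNorm_mul_norm_le hn hv)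

theorem norm_le_freqNorm_mul_norm (h0 : v 0 = 0) (k : Fin d → ℤ) : ‖v k‖ ≤ freqNorm k * ‖v k‖ := by
  by_cases hk : k = 0
  · simp [hk, h0]
  · exact le_mul_of_one_le_left (norm_nonneg _) (one_le_freqNorm hk)

theorem summable_norm_of_sobolev (hn : (d : ℝ) / 2 + 1 < n) (hv : v ∈ HSigma d n) :
    Summable fun k => ‖v k‖ :=
  Summable.of_nonneg_of_le (fun _ => norm_nonneg _) (norm_le_freqNorm_mul_norm hv.2.1)
    (summable_freqNorm_mul_norm hn (HSigma.summable hv))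

theorem tsum_norm_le (hn : (d : ℝ) / 2 + 1 < n) (hv : v ∈ HSigma d n) :
    ∑' k, ‖v k‖ ≤ embedConst d n * sobolevNorm n v :=
  ((summable_norm_of_sobolev hn hv).tsum_le_tsum (norm_le_freqNorm_mul_norm hv.2.1)
    (summable_freqNorm_mul_norm hn (HSigma.summable hv))).trans
      (tsum_freqNorm_mul_norm_le hn (HSigma.summable hv))

/-! ### The convolution form of the bilinear map -/

/-- The Fourier coefficients of `v • ∂ w`, up to normalization. -/
def advectionCoeff (v w : VField d) (k : Fin d → ℤ) : EuclideanSpace ℂ (Fin d) :=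
  ∑' l, (Complex.I * freqDot l (v (k - l))) • w l

theorem norm_advection_term_le (v w : VField d) (k l : Fin d → ℤ) :
    ‖(Complex.I * freqDot l (v (k - l))) • w l‖ ≤ ‖v (k - l)‖ * (freqNorm l * ‖w l‖) := by
  rw [norm_smul, norm_mul, Complex.norm_I, one_mul]
  calc _ ≤ freqNorm l * ‖v (k - l)‖ * ‖w l‖ :=
        mul_le_mul_of_nonneg_right (norm_freqDot_le _ _) (norm_nonneg _)
    _ = _ := by ring

theorem summable_norm_mul_conv (hv : Summable fun k => ‖v k‖) {b : (Fin d → ℤ) → ℝ}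
    (hb0 : ∀ l, 0 ≤ b l) (hb : Summable b) (k : Fin d → ℤ) :
    Summable fun l => ‖v (k - l)‖ * b l := by
  refine Summable.of_nonneg_of_le (fun l => mul_nonneg (norm_nonneg _) (hb0 l)) (fun l => ?_)
    (hb.mul_left (∑' k, ‖v k‖))
  exact mul_le_mul_of_nonneg_right (hv.le_tsum (k - l) fun _ _ => norm_nonneg _) (hb0 l)

theorem summable_advection_term (hn : (d : ℝ) / 2 + 1 < n) (hv : v ∈ HSigma d n)
    (hw : w ∈ HSigma d n) (k : Fin d → ℤ) :
    Summable fun l => (Complex.I * freqDot l (v (k - l))) • w l :=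
  Summable.of_norm (Summable.of_nonneg_of_le (fun _ => norm_nonneg _)
    (norm_advection_term_le v w k)
    (summable_norm_mul_conv (summable_norm_of_sobolev hn hv)
      (fun l => mul_nonneg (freqNorm_nonneg l) (norm_nonneg _))
      (summable_freqNorm_mul_norm hn (HSigma.summable hw)) k))

/-- Absolute convergence replaces the definition by pointwise products and integrals with a
convolution of coefficients. Additivity, the symmetries and all bounds on the bilinear map are
derived from this form. -/
theorem eulerBilinear_eq (hn : (d : ℝ) / 2 + 1 < n) (hv : v ∈ HSigma d n)
    (hw : w ∈ HSigma d n) (k : Fin d → ℤ) :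
    eulerBilinear v w k = -lerayAt k ((modeConst d : ℂ) • advectionCoeff v w k) := by
  rw [eulerBilinear]
  congr 2
  ext r
  rw [PiLp.toLp_apply, fourierCoefficient_advection (summable_norm_of_sobolev hn hv)
    (summable_norm_of_sobolev hn hw) (summable_freqNorm_mul_norm hn (HSigma.summable hw)),
    PiLp.smul_apply, smul_eq_mul]
  congr 1
  have h := (EuclideanSpace.proj (𝕜 := ℂ) r).map_tsum (summable_advection_term hn hv hw k)
  exact h.symm

theorem eulerBilinear_sub_right (hn : (d : ℝ) / 2 + 1 < n) {w' : VField d} (hv : v ∈ HSigma d n)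
    (hw : w ∈ HSigma d n) (hw' : w' ∈ HSigma d n) :
    eulerBilinear v (w - w') = eulerBilinear v w - eulerBilinear v w' := by
  funext k
  rw [Pi.sub_apply, eulerBilinear_eq hn hv (HSigma.sub hw hw'), eulerBilinear_eq hn hv hw,
    eulerBilinear_eq hn hv hw']
  have h : advectionCoeff v (w - w') k = advectionCoeff v w k - advectionCoeff v w' k := by
    rw [advectionCoeff, advectionCoeff, advectionCoeff,
      ← (summable_advection_term hn hv hw k).tsum_sub (summable_advection_term hn hv hw' k)]
    exact tsum_congr fun l => by rw [Pi.sub_apply, smul_sub]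
  rw [h, smul_sub, lerayAt_sub]
  abel

theorem eulerBilinear_sub_left (hn : (d : ℝ) / 2 + 1 < n) {v' : VField d} (hv : v ∈ HSigma d n)
    (hv' : v' ∈ HSigma d n) (hw : w ∈ HSigma d n) :
    eulerBilinear (v - v') w = eulerBilinear v w - eulerBilinear v' w := by
  funext k
  rw [Pi.sub_apply, eulerBilinear_eq hn (HSigma.sub hv hv') hw, eulerBilinear_eq hn hv hw,
    eulerBilinear_eq hn hv' hw]
  have h : advectionCoeff (v - v') w k = advectionCoeff v w k - advectionCoeff v' w k := by
    rw [advectionCoeff, advectionCoeff, advectionCoeff,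
      ← (summable_advection_term hn hv hw k).tsum_sub (summable_advection_term hn hv' hw k)]
    exact tsum_congr fun l => by rw [Pi.sub_apply, freqDot_sub, mul_sub, sub_smul]
  rw [h, smul_sub, lerayAt_sub]
  abel

/-- The splitting is chosen so that, tested against `v - w`, the first term falls under Kato's
inequality, while in the second no derivative acts on the difference. -/
theorem eulerBilinear_self_sub (hn : (d : ℝ) / 2 + 1 < n) (hv : v ∈ HSigma d n)
    (hw : w ∈ HSigma d n) : eulerBilinear v v - eulerBilinear w w =
      eulerBilinear v (v - w) + eulerBilinear (v - w) w := by
  rw [eulerBilinear_sub_right hn hv hv hw, eulerBilinear_sub_left hn hv hw hw]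
  abel

theorem eulerBilinear_mem_solenoidal (hn : (d : ℝ) / 2 + 1 < n) (hv : v ∈ HSigma d n)
    (hw : w ∈ HSigma d n) : eulerBilinear v w ∈ solenoidal d := by
  refine ⟨fun k r => ?_, ?_, fun k => ?_⟩
  · have hconj : ∀ k s, advectionCoeff v w (-k) s = (starRingEnd ℂ) (advectionCoeff v w k s) := by
      intro k s
      have hcoord : ∀ k, advectionCoeff v w k s =
          ∑' l, Complex.I * freqDot l (v (k - l)) * w l s := fun k =>
        (EuclideanSpace.proj (𝕜 := ℂ) s).map_tsum (summable_advection_term hn hv hw k)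
      rw [hcoord, hcoord, Complex.conj_tsum, ← (Equiv.neg (Fin d → ℤ)).tsum_eq]
      refine tsum_congr fun l => ?_
      have h1 : freqDot (-l) (v (-k - -l)) = -(starRingEnd ℂ) (freqDot l (v (k - l))) := by
        rw [show -k - -l = -(k - l) by abel]
        simp only [freqDot, hv.1]
        simp
      simp only [Equiv.neg_apply, h1, hw.1, map_mul, Complex.conj_I]
      ring
    rw [eulerBilinear_eq hn hv hw, eulerBilinear_eq hn hv hw]
    simp [lerayAt, freqDot, hconj]
  · rw [eulerBilinear_eq hn hv hw]
    -- Zero mean: at `k = 0` each term contains `l • v_{-l}`, which vanishes since `v` is divergence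
    -- free.
    have h1 : advectionCoeff v w 0 = 0 := by
      rw [advectionCoeff]
      refine (tsum_congr fun l => ?_).trans tsum_zero
      have h2 := hv.2.2.1 (0 - l)
      rw [freqDot_sub_left] at h2
      have h3 : freqDot l (v (0 - l)) = 0 := by simpa [freqDot] using h2
      rw [h3, mul_zero, zero_smul]
    rw [h1, smul_zero, lerayAt_eq]
    simp [freqDot]
  · rw [eulerBilinear, freqDot_neg, freqDot_lerayAt, neg_zero]

theorem norm_eulerBilinear_le (hn : (d : ℝ) / 2 + 1 < n) (hv : v ∈ HSigma d n)
    (hw : w ∈ HSigma d n) (k : Fin d → ℤ) :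
    ‖eulerBilinear v w k‖ ≤ 2 * modeConst d * ∑' l, ‖v (k - l)‖ * (freqNorm l * ‖w l‖) := by
  rw [eulerBilinear_eq hn hv hw, norm_neg, mul_assoc]
  refine (norm_lerayAt_le _ _).trans (mul_le_mul_of_nonneg_left ?_ zero_le_two)
  rw [norm_smul, Complex.norm_real, Real.norm_of_nonneg (modeConst_pos d).le]
  refine mul_le_mul_of_nonneg_left ?_ (modeConst_pos d).le
  have hs := summable_norm_mul_conv (summable_norm_of_sobolev hn hv)
      (fun l => mul_nonneg (freqNorm_nonneg l) (norm_nonneg _))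
      (summable_freqNorm_mul_norm hn (HSigma.summable hw)) k
  exact tsum_of_norm_bounded hs.hasSum (norm_advection_term_le v w k)

end embed

/-! ### Convolution estimates -/

theorem sum_comp_sub_le {a : (Fin d → ℤ) → ℝ} {A : ℝ}
    (hA : ∀ F : Finset (Fin d → ℤ), ∑ k ∈ F, a k ≤ A) (F : Finset (Fin d → ℤ)) (l : Fin d → ℤ) :
    ∑ k ∈ F, a (k - l) ≤ A := by
  have h := hA (F.map (Equiv.subRight l).toEmbedding)
  rwa [Finset.sum_map] at h

theorem sum_comp_sub_le' {a : (Fin d → ℤ) → ℝ} {A : ℝ}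
    (hA : ∀ F : Finset (Fin d → ℤ), ∑ k ∈ F, a k ≤ A) (F : Finset (Fin d → ℤ)) (l : Fin d → ℤ) :
    ∑ k ∈ F, a (l - k) ≤ A := by
  have h := hA (F.map (Equiv.subLeft l).toEmbedding)
  rwa [Finset.sum_map] at h

/-- Young's inequality `ℓ² * ℓ¹ ⊆ ℓ²`, for partial sums. -/
theorem sum_conv_sq_le {a b : (Fin d → ℤ) → ℝ} {A : ℝ} (hb0 : ∀ k, 0 ≤ b k)
    (hA : ∀ F : Finset (Fin d → ℤ), ∑ k ∈ F, a k ^ 2 ≤ A) (hb : Summable b)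
    (F : Finset (Fin d → ℤ)) :
    ∑ k ∈ F, (∑' l, a (k - l) * b l) ^ 2 ≤ (∑' l, b l) ^ 2 * A := by
  have hB : 0 ≤ ∑' l, b l := tsum_nonneg hb0
  have hbd : ∀ k, |a k| ≤ √A := fun k => Real.abs_le_sqrt (by simpa using hA {k})
  have hA0 : 0 ≤ A := by simpa using hA ∅
  have hsum2 : ∀ k, Summable fun l => a (k - l) ^ 2 * b l := fun k => by
    refine Summable.of_nonneg_of_le (fun l => mul_nonneg (sq_nonneg _) (hb0 l)) (fun l => ?_)
      (hb.mul_left A)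
    exact mul_le_mul_of_nonneg_right (by simpa using hA {k - l}) (hb0 l)
  have hsum1 : ∀ k, Summable fun l => a (k - l) * b l := fun k => by
    refine Summable.of_norm_bounded (hb.mul_left (√A)) fun l => ?_
    rw [Real.norm_eq_abs, abs_mul, abs_of_nonneg (hb0 l)]
    exact mul_le_mul_of_nonneg_right (hbd _) (hb0 l)
  -- Cauchy–Schwarz with respect to the measure of density `b`; summing over `k` then uses
  -- translation invariance of the bound on `∑ a²`.
  have hcs : ∀ k, (∑' l, a (k - l) * b l) ^ 2 ≤ (∑' l, b l) * ∑' l, a (k - l) ^ 2 * b l := by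
    intro k
    refine le_of_tendsto ((hsum1 k).hasSum.pow 2) (Eventually.of_forall fun S => ?_)
    refine (Finset.sum_sq_le_sum_mul_sum_of_sq_le_mul S (f := b) (fun l _ => hb0 l)
      (g := fun l => a (k - l) ^ 2 * b l) (fun l _ => mul_nonneg (sq_nonneg _) (hb0 l))
      (fun l _ => le_of_eq (by ring))).trans ?_
    exact mul_le_mul (hb.sum_le_tsum S fun l _ => hb0 l)
      ((hsum2 k).sum_le_tsum S fun l _ => mul_nonneg (sq_nonneg _) (hb0 l))
      (Finset.sum_nonneg fun l _ => mul_nonneg (sq_nonneg _) (hb0 l)) hB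
  calc ∑ k ∈ F, (∑' l, a (k - l) * b l) ^ 2
      ≤ ∑ k ∈ F, (∑' l, b l) * ∑' l, a (k - l) ^ 2 * b l := Finset.sum_le_sum fun k _ => hcs k
    _ = (∑' l, b l) * ∑' l, ∑ k ∈ F, a (k - l) ^ 2 * b l := by
        rw [← Finset.mul_sum, Summable.tsum_finsetSum fun k _ => hsum2 k]
    _ ≤ (∑' l, b l) * ∑' l, A * b l := by
        refine mul_le_mul_of_nonneg_left ?_ hB
        refine (summable_sum fun k _ => hsum2 k).tsum_le_tsum (fun l => ?_) (hb.mul_left A)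
        rw [← Finset.sum_mul]
        exact mul_le_mul_of_nonneg_right (sum_comp_sub_le (a := fun k => a k ^ 2) hA F l) (hb0 l)
    _ = _ := by rw [tsum_mul_left]; ring

theorem rpow_add_le_two_rpow {m : ℝ} (hm : 0 ≤ m) {x y z : ℝ} (hx : 0 ≤ x) (hy : 0 ≤ y)
    (hz : 0 ≤ z) (h : x ≤ y + z) : x ^ m ≤ 2 ^ m * (y ^ m + z ^ m) := by
  have h1 : ∀ a b : ℝ, 0 ≤ a → 0 ≤ b → x ≤ 2 * a → x ^ m ≤ 2 ^ m * (a ^ m + b ^ m) := by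
    intro a b ha hb hab
    calc x ^ m ≤ (2 * a) ^ m := Real.rpow_le_rpow hx hab hm
      _ = 2 ^ m * a ^ m := Real.mul_rpow zero_le_two ha
      _ ≤ _ := by
        gcongr
        exact le_add_of_nonneg_right (Real.rpow_nonneg hb m)
  rcases le_total z y with h2 | h2
  · exact h1 y z hy hz (by linarith)
  · rw [add_comm]
    exact h1 z y hz hy (by linarith)

section basic

variable {n m : ℝ} {v w : VField d}

/-- A constant for the basic inequality `‖P(v,w)‖_m ≤ C ‖v‖_m ‖w‖_{m+1}`. -/
def basicConst (d : ℕ) (n m : ℝ) : ℝ := 2 * (2 * modeConst d * 2 ^ m) * embedConst d n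

theorem basicConst_nonneg (d : ℕ) (n m : ℝ) : 0 ≤ basicConst d n m := by
  have := (modeConst_pos d).le
  have := embedConst_nonneg d n
  unfold basicConst
  positivity

/-- Since `|k|^m ≤ 2^m (|k-l|^m + |l|^m)`, the convolution splits into one with the weight on `v`
and one with the weight on `w`. In each, the weighted factor is square summable and the other one
summable, so Young's inequality applies. Working with partial sums yields membership and norm bound
together. -/
theorem sum_eulerBilinear_sq_le (hn : (d : ℝ) / 2 + 1 < n) (hm : n ≤ m) (hv : v ∈ HSigma d m)
    (hw : w ∈ HSigma d (m + 1)) (F : Finset (Fin d → ℤ)) :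
    ∑ k ∈ F, freqNorm k ^ (2 * m) * ‖eulerBilinear v w k‖ ^ 2 ≤
      (basicConst d n m * sobolevNorm m v * sobolevNorm (m + 1) w) ^ 2 := by
  have hd : (0 : ℝ) ≤ d := Nat.cast_nonneg d
  have hn0 : 0 < n := by linarith
  have hm0 : 0 < m := by linarith
  have hvn : v ∈ HSigma d n := HSigma.mono hn0 hm hv
  have hwn : w ∈ HSigma d n := HSigma.mono hn0 (by linarith) hw
  set E := embedConst d n with hE
  have hE0 : 0 ≤ E := embedConst_nonneg d n
  have hc0 := modeConst_pos d
  set D := 2 * modeConst d * 2 ^ m with hD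
  have hD0 : 0 ≤ D := by positivity
  have hb0 : ∀ l, 0 ≤ freqNorm l * ‖w l‖ := fun l => mul_nonneg (freqNorm_nonneg l) (norm_nonneg _)
  have hbs := summable_freqNorm_mul_norm hn (HSigma.summable hwn)
  have hv1 := summable_norm_of_sobolev hn hvn
  have hr0 : ∀ (k : Fin d → ℤ) (a : ℝ), 0 ≤ freqNorm k ^ a := fun k a =>
    Real.rpow_nonneg (freqNorm_nonneg k) a
  set X : (Fin d → ℤ) → ℝ := fun k =>
    ∑' l, (freqNorm (k - l) ^ m * ‖v (k - l)‖) * (freqNorm l * ‖w l‖) with hX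
  set Y : (Fin d → ℤ) → ℝ := fun k =>
    ∑' l, (freqNorm (k - l) ^ (m + 1) * ‖w (k - l)‖) * ‖v l‖ with hY
  have hSX : ∀ k, Summable fun l =>
      (freqNorm (k - l) ^ m * ‖v (k - l)‖) * (freqNorm l * ‖w l‖) := fun k => by
    refine Summable.of_nonneg_of_le (fun l => mul_nonneg (mul_nonneg (hr0 _ _) (norm_nonneg _))
      (hb0 l)) (fun l => ?_) (hbs.mul_left (sobolevNorm m v))
    exact mul_le_mul_of_nonneg_right ((HSigma.summable hv).rpow_mul_norm_le _) (hb0 l)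
  have hSY' : ∀ k, Summable fun l =>
      (freqNorm (k - l) ^ (m + 1) * ‖w (k - l)‖) * ‖v l‖ := fun k => by
    refine Summable.of_nonneg_of_le (fun l => mul_nonneg (mul_nonneg (hr0 _ _) (norm_nonneg _))
      (norm_nonneg _)) (fun l => ?_) (hv1.mul_left (sobolevNorm (m + 1) w))
    exact mul_le_mul_of_nonneg_right ((HSigma.summable hw).rpow_mul_norm_le _) (norm_nonneg _)
  -- The substitution `l ↦ k - l` puts the square summable factor in the shifted position that
  -- `sum_conv_sq_le` requires.
  have hYeq : ∀ k l, (freqNorm (k - (k - l)) ^ (m + 1) * ‖w (k - (k - l))‖) * ‖v (k - l)‖ =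
      ‖v (k - l)‖ * (freqNorm l ^ (m + 1) * ‖w l‖) := fun k l => by
    rw [sub_sub_cancel, mul_comm]
  have hSY : ∀ k, Summable fun l => ‖v (k - l)‖ * (freqNorm l ^ (m + 1) * ‖w l‖) := fun k =>
    (((Equiv.subLeft k).summable_iff).2 (hSY' k)).congr fun l => hYeq k l
  have hYt : ∀ k, ∑' l, ‖v (k - l)‖ * (freqNorm l ^ (m + 1) * ‖w l‖) = Y k := fun k =>
    (tsum_congr fun l => (hYeq k l).symm).trans ((Equiv.subLeft k).tsum_eq
      fun l => (freqNorm (k - l) ^ (m + 1) * ‖w (k - l)‖) * ‖v l‖)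
  have hpt : ∀ k, freqNorm k ^ m * ‖eulerBilinear v w k‖ ≤ D * (X k + Y k) := by
    intro k
    have h1 := norm_eulerBilinear_le hn hvn hwn k
    have hs := summable_norm_mul_conv hv1 hb0 hbs k
    calc freqNorm k ^ m * ‖eulerBilinear v w k‖
        ≤ freqNorm k ^ m * (2 * modeConst d * ∑' l, ‖v (k - l)‖ * (freqNorm l * ‖w l‖)) :=
          mul_le_mul_of_nonneg_left h1 (hr0 _ _)
      _ = 2 * modeConst d * ∑' l, freqNorm k ^ m * (‖v (k - l)‖ * (freqNorm l * ‖w l‖)) := by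
          rw [tsum_mul_left]; ring
      _ ≤ 2 * modeConst d * ∑' l, 2 ^ m *
            ((freqNorm (k - l) ^ m * ‖v (k - l)‖) * (freqNorm l * ‖w l‖) +
              ‖v (k - l)‖ * (freqNorm l ^ (m + 1) * ‖w l‖)) := by
          refine mul_le_mul_of_nonneg_left ?_ (by positivity)
          refine (hs.mul_left _).tsum_le_tsum (fun l => ?_) (((hSX k).add (hSY k)).mul_left _)
          have h2 := rpow_add_le_two_rpow hm0.le (freqNorm_nonneg k) (freqNorm_nonneg (k - l))
            (freqNorm_nonneg l) (freqNorm_le_sub_add k l)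
          have h3 : freqNorm l ^ (m + 1) = freqNorm l ^ m * freqNorm l := by
            rw [Real.rpow_add_one' (freqNorm_nonneg l) (by linarith)]
          rw [h3]
          calc freqNorm k ^ m * (‖v (k - l)‖ * (freqNorm l * ‖w l‖))
              ≤ (2 ^ m * (freqNorm (k - l) ^ m + freqNorm l ^ m)) *
                (‖v (k - l)‖ * (freqNorm l * ‖w l‖)) :=
                mul_le_mul_of_nonneg_right h2 (mul_nonneg (norm_nonneg _) (hb0 l))
            _ = _ := by ring
      _ = D * (X k + Y k) := by
          rw [tsum_mul_left, (hSX k).tsum_add (hSY k), hYt, hD]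
          ring
  have hXsum : ∑ k ∈ F, X k ^ 2 ≤ (E * sobolevNorm (m + 1) w) ^ 2 * sobolevNorm m v ^ 2 := by
    refine (sum_conv_sq_le (a := fun k => freqNorm k ^ m * ‖v k‖) hb0 (A := sobolevNorm m v ^ 2)
      (fun S => ?_) hbs F).trans ?_
    · simpa only [mul_pow, ← freqNorm_rpow_two_mul] using (HSigma.summable hv).sum_le S
    · refine mul_le_mul_of_nonneg_right ?_ (sq_nonneg _)
      refine pow_le_pow_left₀ (tsum_nonneg hb0) ?_ 2
      refine (tsum_freqNorm_mul_norm_le hn (HSigma.summable hwn)).trans ?_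
      exact mul_le_mul_of_nonneg_left ((HSigma.summable hw).norm_mono hn0 (by linarith)) hE0
  have hYsum : ∑ k ∈ F, Y k ^ 2 ≤ (E * sobolevNorm m v) ^ 2 * sobolevNorm (m + 1) w ^ 2 := by
    refine (sum_conv_sq_le (a := fun k => freqNorm k ^ (m + 1) * ‖w k‖) (fun _ => norm_nonneg _)
      (A := sobolevNorm (m + 1) w ^ 2) (fun S => ?_) hv1 F).trans ?_
    · simpa only [mul_pow, ← freqNorm_rpow_two_mul] using (HSigma.summable hw).sum_le S
    · refine mul_le_mul_of_nonneg_right ?_ (sq_nonneg _)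
      refine pow_le_pow_left₀ (tsum_nonneg fun _ => norm_nonneg _) ?_ 2
      refine (tsum_norm_le hn hvn).trans ?_
      exact mul_le_mul_of_nonneg_left ((HSigma.summable hv).norm_mono hn0 hm) hE0
  calc ∑ k ∈ F, freqNorm k ^ (2 * m) * ‖eulerBilinear v w k‖ ^ 2
      ≤ ∑ k ∈ F, D ^ 2 * (2 * X k ^ 2 + 2 * Y k ^ 2) := by
        refine Finset.sum_le_sum fun k _ => ?_
        rw [freqNorm_rpow_two_mul, ← mul_pow]
        refine (pow_le_pow_left₀ (mul_nonneg (hr0 _ _) (norm_nonneg _)) (hpt k) 2).trans ?_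
        rw [mul_pow]
        refine mul_le_mul_of_nonneg_left ?_ (sq_nonneg _)
        nlinarith [sq_nonneg (X k - Y k)]
    _ = D ^ 2 * (2 * ∑ k ∈ F, X k ^ 2 + 2 * ∑ k ∈ F, Y k ^ 2) := by
        rw [← Finset.mul_sum, Finset.sum_add_distrib, Finset.mul_sum, Finset.mul_sum]
    _ ≤ D ^ 2 * (2 * ((E * sobolevNorm (m + 1) w) ^ 2 * sobolevNorm m v ^ 2) +
          2 * ((E * sobolevNorm m v) ^ 2 * sobolevNorm (m + 1) w ^ 2)) := by gcongr
    _ = _ := by rw [basicConst, ← hD, ← hE]; ring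

theorem eulerBilinear_mem (hn : (d : ℝ) / 2 + 1 < n) (hm : n ≤ m) (hv : v ∈ HSigma d m)
    (hw : w ∈ HSigma d (m + 1)) : eulerBilinear v w ∈ HSigma d m := by
  have hd : (0 : ℝ) ≤ d := Nat.cast_nonneg d
  exact mem_HSigma_iff.2 ⟨eulerBilinear_mem_solenoidal hn (HSigma.mono (by linarith) hm hv)
    (HSigma.mono (by linarith) (by linarith) hw),
    sobolevSummable_of_sum_le (sum_eulerBilinear_sq_le hn hm hv hw)⟩

theorem sobolevNorm_eulerBilinear_le (hn : (d : ℝ) / 2 + 1 < n) (hm : n ≤ m) (hv : v ∈ HSigma d m)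
    (hw : w ∈ HSigma d (m + 1)) : sobolevNorm m (eulerBilinear v w) ≤
      basicConst d n m * sobolevNorm m v * sobolevNorm (m + 1) w := by
  refine le_of_sq_le_sq ?_ (mul_nonneg (mul_nonneg (basicConst_nonneg _ _ _)
    (sobolevNorm_nonneg _ _)) (sobolevNorm_nonneg _ _))
  rw [sobolevNorm_sq]
  exact (HSigma.summable (eulerBilinear_mem hn hm hv hw)).tsum_le_of_sum_le
    (sum_eulerBilinear_sq_le hn hm hv hw)

end basic

/-! ### Weights that measure high frequencies -/

/-- The weight `min(x^m, x^{m+1}/L)`, as a function of `x = |k|`. -/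
def radialWeight (m L x : ℝ) : ℝ := min (x ^ m) (x ^ (m + 1) / L)

/-- The weight `min(|k|^m, |k|^{m+1}/L)`: it equals `|k|^m` for `|k| ≥ L`, and it is small at
fixed `k` if `L` is large. -/
def tailWeight (m L : ℝ) (k : Fin d → ℤ) : ℝ := radialWeight m L (freqNorm k)

/-- A constant for the commutator estimates with the weights `tailWeight m L`. -/
def weightConst (m : ℝ) : ℝ := 2 ^ (m + 1) + (m + 1) + 3 ^ (m + 1)

theorem weightConst_nonneg {m : ℝ} (hm : 1 ≤ m) : 0 ≤ weightConst m := by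
  unfold weightConst; positivity

theorem radialWeight_nonneg {m L x : ℝ} (hL : 0 < L) (hx : 0 ≤ x) : 0 ≤ radialWeight m L x :=
  le_min (Real.rpow_nonneg hx _) (div_nonneg (Real.rpow_nonneg hx _) hL.le)

/-- Both branches of the minimum grow at most like a power of exponent `m + 1`, so one factor `3 ^
(m + 1)` serves both, for every `L`. -/
theorem radialWeight_le_of_le_three_mul {m L x z : ℝ} (hm : 1 ≤ m) (hL : 0 < L) (hx : 0 ≤ x)
    (hz : 0 ≤ z) (hxz : x ≤ 3 * z) : radialWeight m L x ≤ 3 ^ (m + 1) * radialWeight m L z := by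
  have h1 : x ^ m ≤ 3 ^ (m + 1) * z ^ m := by
    calc x ^ m ≤ (3 * z) ^ m := Real.rpow_le_rpow hx hxz (by linarith)
      _ = 3 ^ m * z ^ m := Real.mul_rpow (by norm_num) hz
      _ ≤ 3 ^ (m + 1) * z ^ m := by
        gcongr
        · norm_num
        · linarith
  have h2 : x ^ (m + 1) / L ≤ 3 ^ (m + 1) * (z ^ (m + 1) / L) := by
    rw [← mul_div_assoc]
    gcongr
    calc x ^ (m + 1) ≤ (3 * z) ^ (m + 1) := Real.rpow_le_rpow hx hxz (by linarith)
      _ = 3 ^ (m + 1) * z ^ (m + 1) := Real.mul_rpow (by norm_num) hz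
  rw [radialWeight, radialWeight, mul_min_of_nonneg _ _ (by positivity)]
  exact min_le_min h1 h2

/-- If `x` differs from `y` by at most half of `y`, the relative change of `y ^ s` is linear in `z /
y`. The upper bound is the chord of the convex power on `[1, 2]`, the lower one is Bernoulli's
inequality; the constant serves both exponents `m` and `m + 1`. -/
theorem rpow_near {s m x y z : ℝ} (hs : 1 ≤ s) (hsm : s ≤ m + 1) (hx : 0 ≤ x) (hy : 0 < y)
    (hxy : |x - y| ≤ z) (hzy : 2 * z ≤ y) :
    x ^ s ≤ (1 + (2 ^ (m + 1) + (m + 1)) * (z / y)) * y ^ s ∧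
      (1 - (2 ^ (m + 1) + (m + 1)) * (z / y)) * y ^ s ≤ x ^ s := by
  have hz : 0 ≤ z := (abs_nonneg _).trans hxy
  obtain ⟨h1, h2⟩ := abs_le.1 hxy
  set t := z / y with ht
  have ht0 : 0 ≤ t := div_nonneg hz hy.le
  have hty : t * y = z := div_mul_cancel₀ z hy.ne'
  have ht1 : t ≤ 1 / 2 := by rw [ht, div_le_iff₀ hy]; linarith
  have h2s : (2 : ℝ) ^ s ≤ 2 ^ (m + 1) := Real.rpow_le_rpow_of_exponent_le (by norm_num) hsm
  have h2m : (0 : ℝ) < 2 ^ (m + 1) := by positivity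
  have hys : 0 ≤ y ^ s := Real.rpow_nonneg hy.le s
  constructor
  · have hconv := (convexOn_rpow hs).2 (show (1 : ℝ) ∈ Set.Ici 0 by simp)
      (show (2 : ℝ) ∈ Set.Ici 0 by simp) (show 0 ≤ 1 - t by linarith) ht0 (by ring)
    simp only [smul_eq_mul, mul_one, Real.one_rpow] at hconv
    calc x ^ s ≤ ((1 - t + t * 2) * y) ^ s := Real.rpow_le_rpow hx (by nlinarith) (by linarith)
      _ = (1 - t + t * 2) ^ s * y ^ s := Real.mul_rpow (by linarith) hy.le
      _ ≤ (1 + (2 ^ (m + 1) + (m + 1)) * t) * y ^ s := by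
        refine mul_le_mul_of_nonneg_right (hconv.trans ?_) hys
        nlinarith
  · have hb := one_add_mul_self_le_rpow_one_add (s := -t) (by linarith) hs
    calc (1 - (2 ^ (m + 1) + (m + 1)) * t) * y ^ s ≤ (1 + -t) ^ s * y ^ s := by
          refine mul_le_mul_of_nonneg_right (le_trans ?_ hb) hys
          nlinarith
      _ = ((1 + -t) * y) ^ s := (Real.mul_rpow (by linarith) hy.le).symm
      _ ≤ x ^ s := Real.rpow_le_rpow (mul_nonneg (by linarith) hy.le) (by nlinarith) (by linarith)

/-- If `y ≤ 2z`, then `x` and `y` are at most `3z`, and both weights are comparable to the weight at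
`z`. If `2z ≤ y`, the weight varies by a relative amount of order `z / y`, because both powers in
the minimum do. The point is that the constant does not depend on `L`. -/
theorem radialWeight_sub_le {m L x y z : ℝ} (hm : 1 ≤ m) (hL : 0 < L) (hx : 0 ≤ x) (hy : 0 ≤ y)
    (hxy : |x - y| ≤ z) : |radialWeight m L x - radialWeight m L y| * y ≤
      weightConst m * (z * radialWeight m L y + y * radialWeight m L z) := by
  have hz : 0 ≤ z := (abs_nonneg _).trans hxy
  have hx' := radialWeight_nonneg (m := m) hL hx
  have hy' := radialWeight_nonneg (m := m) hL hy
  have hz' := radialWeight_nonneg (m := m) hL hz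
  have h3 : (0 : ℝ) < 3 ^ (m + 1) := by positivity
  have h2 : (0 : ℝ) < 2 ^ (m + 1) := by positivity
  obtain ⟨hd1, hd2⟩ := abs_le.1 hxy
  rcases le_total y (2 * z) with hyz | hyz
  · have e1 := radialWeight_le_of_le_three_mul hm hL hx hz (by linarith)
    have e2 := radialWeight_le_of_le_three_mul hm hL hy hz (by linarith)
    have e3 : |radialWeight m L x - radialWeight m L y| ≤ 3 ^ (m + 1) * radialWeight m L z :=
      abs_le.2 ⟨by linarith, by linarith⟩
    calc _ ≤ 3 ^ (m + 1) * radialWeight m L z * y := mul_le_mul_of_nonneg_right e3 hy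
      _ = 3 ^ (m + 1) * (y * radialWeight m L z) := by ring
      _ ≤ weightConst m * (y * radialWeight m L z) := by
        refine mul_le_mul_of_nonneg_right ?_ (by positivity)
        unfold weightConst; linarith
      _ ≤ _ := mul_le_mul_of_nonneg_left (by nlinarith) (weightConst_nonneg hm)
  · rcases hy.eq_or_lt with rfl | hy0
    · rw [mul_zero]
      exact mul_nonneg (weightConst_nonneg hm) (by positivity)
    obtain ⟨a1, a2⟩ := rpow_near (s := m) (m := m) hm (by linarith) hx hy0 hxy hyz
    obtain ⟨b1, b2⟩ := rpow_near (s := m + 1) (m := m) (by linarith) le_rfl hx hy0 hxy hyz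
    set t := z / y with ht
    have ht0 : 0 ≤ t := div_nonneg hz hy
    set C := (2 : ℝ) ^ (m + 1) + (m + 1) with hC
    have hC0 : 0 < C := by positivity
    have up : radialWeight m L x ≤ (1 + C * t) * radialWeight m L y := by
      have h1 : 0 ≤ 1 + C * t := by positivity
      rw [radialWeight, radialWeight, mul_min_of_nonneg _ _ h1]
      refine min_le_min a1 ?_
      rw [← mul_div_assoc]
      gcongr
    have lo : (1 - C * t) * radialWeight m L y ≤ radialWeight m L x := by
      rcases le_total 0 (1 - C * t) with h1 | h1
      · rw [radialWeight, radialWeight, mul_min_of_nonneg _ _ h1]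
        refine min_le_min a2 ?_
        rw [← mul_div_assoc]
        gcongr
      · exact (mul_nonpos_of_nonpos_of_nonneg h1 hy').trans hx'
    have e3 : |radialWeight m L x - radialWeight m L y| ≤ C * t * radialWeight m L y :=
      abs_le.2 ⟨by linarith, by linarith⟩
    calc _ ≤ C * t * radialWeight m L y * y := mul_le_mul_of_nonneg_right e3 hy
      _ = C * (z * radialWeight m L y) := by rw [ht]; field_simp
      _ ≤ weightConst m * (z * radialWeight m L y) := by
        refine mul_le_mul_of_nonneg_right ?_ (by positivity)
        unfold weightConst; linarith
      _ ≤ _ := mul_le_mul_of_nonneg_left (le_add_of_nonneg_right (by positivity))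
        (weightConst_nonneg hm)

theorem tailWeight_nonneg {m L : ℝ} (hL : 0 < L) (k : Fin d → ℤ) : 0 ≤ tailWeight m L k :=
  radialWeight_nonneg hL (freqNorm_nonneg k)

theorem tailWeight_sub_le {m L : ℝ} (hm : 1 ≤ m) (hL : 0 < L) (k l : Fin d → ℤ) :
    |tailWeight m L k - tailWeight m L l| * freqNorm l ≤
      weightConst m * (freqNorm (k - l) * tailWeight m L l +
        freqNorm l * tailWeight m L (k - l)) := by
  refine radialWeight_sub_le hm hL (freqNorm_nonneg k) (freqNorm_nonneg l) (abs_le.2 ⟨?_, ?_⟩)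
  · have := freqNorm_le_sub_add l k
    rw [freqNorm_sub_comm] at this
    linarith
  · have := freqNorm_le_sub_add k l
    linarith

theorem tailWeight_le {m L : ℝ} (k : Fin d → ℤ) : tailWeight m L k ≤ freqNorm k ^ m :=
  min_le_left _ _

theorem tailWeight_eq {m L : ℝ} (hL : 0 < L) {k : Fin d → ℤ} (hk : L ≤ freqNorm k) :
    tailWeight m L k = freqNorm k ^ m := by
  refine min_eq_left ?_
  rw [Real.rpow_add_one (by linarith), le_div_iff₀ hL]
  exact mul_le_mul_of_nonneg_left hk (Real.rpow_nonneg (freqNorm_nonneg k) _)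

/-- For `L = 1` the tail estimates become ordinary Sobolev bounds, so one family of weights gives
both boundedness and smallness of tails. -/
theorem tailWeight_one {m : ℝ} (hm : 0 < m) (k : Fin d → ℤ) :
    tailWeight m 1 k = freqNorm k ^ m := by
  rcases freqNorm_eq_zero_or_one_le k with h | h
  · simp [tailWeight, radialWeight, h, Real.zero_rpow hm.ne', Real.zero_rpow (by linarith : m + 1 ≠ 0)]
  · exact tailWeight_eq one_pos h

theorem tendsto_tailWeight (m : ℝ) (k : Fin d → ℤ) :
    Tendsto (fun L : ℕ => tailWeight m ((L : ℝ) + 1) k) atTop (𝓝 0) := by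
  have h : Tendsto (fun L : ℕ => freqNorm k ^ (m + 1) / ((L : ℝ) + 1)) atTop (𝓝 0) := by
    have := (tendsto_one_div_add_atTop_nhds_zero_nat (𝕜 := ℝ)).const_mul (freqNorm k ^ (m + 1))
    simpa only [mul_one_div, mul_zero] using this
  exact squeeze_zero (fun L => tailWeight_nonneg (by positivity) k)
    (fun L => min_le_right _ _) h

/-! ### The commutator estimate -/

section commutator

variable {n : ℝ} {u : VField d} {S : Finset (Fin d → ℤ)}

theorem sum_le_sum_of_support {a : (Fin d → ℤ) → ℝ} (ha : ∀ k, 0 ≤ a k) (h : ∀ k ∉ S, a k = 0)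
    (F : Finset (Fin d → ℤ)) : ∑ k ∈ F, a k ≤ ∑ k ∈ S, a k :=
  sum_le_hasSum (L := .unconditional _) F (fun k _ => ha k) (hasSum_sum_of_ne_finset_zero h)

/-- Arithmetic–geometric mean on the two square summable factors, then translation invariance of the
sums: one contribution `A * B` for each of the two terms. -/
theorem sum_trilinear_le {a b : (Fin d → ℤ) → ℝ} {A B : ℝ} (hb : ∀ k, 0 ≤ b k)
    (hA : ∀ F : Finset (Fin d → ℤ), ∑ k ∈ F, a k ^ 2 ≤ A)
    (hB : ∀ F : Finset (Fin d → ℤ), ∑ k ∈ F, b k ≤ B) (F : Finset (Fin d → ℤ)) :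
    ∑ k ∈ F, ∑ l ∈ F, (a k * a l * b (k - l) + a k * a (k - l) * b l) ≤ 2 * (A * B) := by
  have hA0 : 0 ≤ A := by simpa using hA ∅
  have hB0 : 0 ≤ B := by simpa using hB ∅
  have h1 : ∑ k ∈ F, ∑ l ∈ F, a k * a l * b (k - l) ≤ A * B := by
    calc ∑ k ∈ F, ∑ l ∈ F, a k * a l * b (k - l)
        ≤ ∑ k ∈ F, ∑ l ∈ F, (a k ^ 2 / 2 * b (k - l) + a l ^ 2 / 2 * b (k - l)) := by
          refine Finset.sum_le_sum fun k _ => Finset.sum_le_sum fun l _ => ?_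
          rw [← add_mul]
          exact mul_le_mul_of_nonneg_right (by nlinarith [sq_nonneg (a k - a l)]) (hb _)
      _ = ∑ k ∈ F, a k ^ 2 / 2 * ∑ l ∈ F, b (k - l) + ∑ l ∈ F, a l ^ 2 / 2 * ∑ k ∈ F, b (k - l) := by
          simp only [Finset.sum_add_distrib, Finset.mul_sum]
          congr 1
          rw [Finset.sum_comm]
      _ ≤ ∑ k ∈ F, a k ^ 2 / 2 * B + ∑ l ∈ F, a l ^ 2 / 2 * B := by
          gcongr with k _ l _
          · exact sum_comp_sub_le' hB F k
          · exact sum_comp_sub_le hB F l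
      _ = (∑ k ∈ F, a k ^ 2) * B := by
          rw [← Finset.sum_mul, ← Finset.sum_div]; ring
      _ ≤ A * B := mul_le_mul_of_nonneg_right (hA F) hB0
  have h2 : ∑ k ∈ F, ∑ l ∈ F, a k * a (k - l) * b l ≤ A * B := by
    rw [Finset.sum_comm]
    calc ∑ l ∈ F, ∑ k ∈ F, a k * a (k - l) * b l
        ≤ ∑ l ∈ F, A * b l := by
          refine Finset.sum_le_sum fun l _ => ?_
          rw [← Finset.sum_mul]
          refine mul_le_mul_of_nonneg_right ?_ (hb l)
          have e1 := hA F
          have e2 := sum_comp_sub_le (a := fun k => a k ^ 2) hA F l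
          have e3 : ∑ k ∈ F, a k * a (k - l) ≤ ∑ k ∈ F, (a k ^ 2 + a (k - l) ^ 2) / 2 :=
            Finset.sum_le_sum fun k _ => by nlinarith [sq_nonneg (a k - a (k - l))]
          rw [← Finset.sum_div, Finset.sum_add_distrib] at e3
          linarith
      _ ≤ A * B := by
          rw [← Finset.mul_sum]
          exact mul_le_mul_of_nonneg_left (hB F) hA0
  simp only [Finset.sum_add_distrib]
  linarith

/-- Incompressibility replaces `k` by `l` in the scalar product, and reality conjugates the
coefficient. This is the skew symmetry of transport by a divergence free field. -/
theorem freqDot_swap (hu : u ∈ solenoidal d) (k l : Fin d → ℤ) :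
    freqDot k (u (l - k)) = (starRingEnd ℂ) (freqDot l (u (k - l))) := by
  have h1 := hu.2.2 (l - k)
  rw [freqDot_sub_left, sub_eq_zero] at h1
  rw [← h1, ← neg_sub k l]
  simp only [freqDot, hu.1]
  simp

/-- The energy estimate for trigonometric polynomials, with a slowly varying weight. -/
theorem abs_sum_inner_eulerBilinear_le (hn : (d : ℝ) / 2 + 1 < n) (hu : u ∈ solenoidal d)
    (hS : ∀ k ∉ S, u k = 0) {ω : (Fin d → ℤ) → ℝ} {C : ℝ} (hω : ∀ k, 0 ≤ ω k) (hC : 0 ≤ C)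
    (hW : ∀ k l, |ω k - ω l| * freqNorm l ≤
      C * (freqNorm (k - l) * ω l + freqNorm l * ω (k - l))) :
    |∑ k ∈ S, ω k ^ 2 * (inner ℂ (eulerBilinear u u k) (u k)).re| ≤
      2 * modeConst d * C * embedConst d n * sobolevNorm n u * ∑ k ∈ S, ω k ^ 2 * ‖u k‖ ^ 2 := by
  have hus : ∀ m, u ∈ HSigma d m := fun m =>
    mem_HSigma_iff.2 ⟨hu, SobolevSummable.of_support hS m⟩
  have hc := (modeConst_pos d).le
  set Q : (Fin d → ℤ) → (Fin d → ℤ) → ℂ := fun k l =>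
    (starRingEnd ℂ) (Complex.I * freqDot l (u (k - l))) * inner ℂ (u l) (u k) with hQ
  have hP : ∀ k, (inner ℂ (eulerBilinear u u k) (u k)).re = -(modeConst d * ∑ l ∈ S, (Q k l).re) := by
    intro k
    have hadv : advectionCoeff u u k =
        ∑ l ∈ S, (Complex.I * freqDot l (u (k - l))) • u l :=
      tsum_eq_sum fun l hl => by rw [hS l hl, smul_zero]
    rw [eulerBilinear_eq hn (hus n) (hus n), inner_neg_left, inner_lerayAt (hu.2.2 k),
      inner_smul_left, hadv, sum_inner, Complex.conj_ofReal, Complex.neg_re, Complex.re_ofReal_mul,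
      Complex.re_sum]
    simp only [hQ, inner_smul_left]
  have hskew : ∀ k l, (Q l k).re = -(Q k l).re := by
    intro k l
    have : Q l k = -(starRingEnd ℂ) (Q k l) := by
      simp only [hQ, freqDot_swap hu k l, map_mul, Complex.conj_I, Complex.conj_conj, inner_conj_symm]
      simp
    rw [this, Complex.neg_re, Complex.conj_re]
  -- A symmetric weight against a kernel with skew symmetric real part contributes nothing.
  have hzero : ∑ k ∈ S, ∑ l ∈ S, ω k * ω l * (Q k l).re = 0 := by
    have h1 : ∑ k ∈ S, ∑ l ∈ S, ω k * ω l * (Q k l).re =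
        -∑ k ∈ S, ∑ l ∈ S, ω k * ω l * (Q k l).re := by
      conv_lhs => rw [Finset.sum_comm]
      rw [← Finset.sum_neg_distrib]
      refine Finset.sum_congr rfl fun k _ => ?_
      rw [← Finset.sum_neg_distrib]
      refine Finset.sum_congr rfl fun l _ => ?_
      rw [hskew k l]
      ring
    linarith
  -- Subtracting the vanishing sum replaces `ω_k²` by `ω_k (ω_k - ω_l)`; the difference of weights
  -- then absorbs the derivative factor `|l|` in `Q`.
  have hsplit : ∑ k ∈ S, ω k ^ 2 * (inner ℂ (eulerBilinear u u k) (u k)).re =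
      -(modeConst d * ∑ k ∈ S, ∑ l ∈ S, ω k * (ω k - ω l) * (Q k l).re) := by
    have h1 : ∑ k ∈ S, ∑ l ∈ S, ω k * (ω k - ω l) * (Q k l).re =
        ∑ k ∈ S, ∑ l ∈ S, ω k ^ 2 * (Q k l).re := by
      rw [← sub_zero (∑ k ∈ S, ∑ l ∈ S, ω k ^ 2 * (Q k l).re), ← hzero, ← Finset.sum_sub_distrib]
      refine Finset.sum_congr rfl fun k _ => ?_
      rw [← Finset.sum_sub_distrib]
      exact Finset.sum_congr rfl fun l _ => by ring
    rw [h1, Finset.mul_sum, ← Finset.sum_neg_distrib]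
    refine Finset.sum_congr rfl fun k _ => ?_
    rw [hP k, ← Finset.mul_sum]
    ring
  set a : (Fin d → ℤ) → ℝ := fun k => ω k * ‖u k‖ with ha
  set b : (Fin d → ℤ) → ℝ := fun k => freqNorm k * ‖u k‖ with hb
  have hterm : ∀ k l, |ω k * (ω k - ω l) * (Q k l).re| ≤
      C * (a k * a l * b (k - l) + a k * a (k - l) * b l) := by
    intro k l
    have hQn : |(Q k l).re| ≤ freqNorm l * (‖u (k - l)‖ * ‖u l‖ * ‖u k‖) := by
      refine (Complex.abs_re_le_norm _).trans ?_
      simp only [hQ, norm_mul, RCLike.norm_conj, Complex.norm_I, one_mul]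
      calc _ ≤ freqNorm l * ‖u (k - l)‖ * (‖u l‖ * ‖u k‖) :=
            mul_le_mul (norm_freqDot_le _ _) (norm_inner_le_norm _ _) (norm_nonneg _)
              (mul_nonneg (freqNorm_nonneg l) (norm_nonneg _))
        _ = _ := by ring
    rw [abs_mul, abs_mul, abs_of_nonneg (hω k)]
    calc ω k * |ω k - ω l| * |(Q k l).re|
        ≤ ω k * |ω k - ω l| * (freqNorm l * (‖u (k - l)‖ * ‖u l‖ * ‖u k‖)) :=
          mul_le_mul_of_nonneg_left hQn (mul_nonneg (hω k) (abs_nonneg _))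
      _ = ω k * ‖u (k - l)‖ * ‖u l‖ * ‖u k‖ * (|ω k - ω l| * freqNorm l) := by ring
      _ ≤ ω k * ‖u (k - l)‖ * ‖u l‖ * ‖u k‖ *
          (C * (freqNorm (k - l) * ω l + freqNorm l * ω (k - l))) := by
          refine mul_le_mul_of_nonneg_left (hW k l) ?_
          have := hω k
          positivity
      _ = _ := by simp only [ha, hb]; ring
  have htri := sum_trilinear_le (a := a) (b := b) (A := ∑ k ∈ S, ω k ^ 2 * ‖u k‖ ^ 2)
    (B := embedConst d n * sobolevNorm n u)
    (fun k => mul_nonneg (freqNorm_nonneg k) (norm_nonneg _))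
    (fun F => by
      simp only [ha, mul_pow]
      exact sum_le_sum_of_support (fun k => mul_nonneg (sq_nonneg _) (sq_nonneg _))
        (fun k hk => by simp [hS k hk]) F)
    (sum_freqNorm_mul_norm_le hn (HSigma.summable (hus n))) S
  rw [hsplit, abs_neg, abs_mul, abs_of_nonneg hc]
  calc modeConst d * |∑ k ∈ S, ∑ l ∈ S, ω k * (ω k - ω l) * (Q k l).re|
      ≤ modeConst d * ∑ k ∈ S, ∑ l ∈ S, C * (a k * a l * b (k - l) + a k * a (k - l) * b l) := by
        refine mul_le_mul_of_nonneg_left ?_ hc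
        refine (Finset.abs_sum_le_sum_abs _ _).trans (Finset.sum_le_sum fun k _ => ?_)
        exact (Finset.abs_sum_le_sum_abs _ _).trans (Finset.sum_le_sum fun l _ => hterm k l)
    _ = modeConst d * C * ∑ k ∈ S, ∑ l ∈ S, (a k * a l * b (k - l) + a k * a (k - l) * b l) := by
        simp only [← Finset.mul_sum]
        ring
    _ ≤ modeConst d * C * (2 * ((∑ k ∈ S, ω k ^ 2 * ‖u k‖ ^ 2) *
          (embedConst d n * sobolevNorm n u))) := by gcongr
    _ = _ := by ring

end commutator

/-! ### Time domains -/

theorem timeDomain_mono {T T' : EReal} (h : T ≤ T') : timeDomain T ⊆ timeDomain T' :=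
  fun _ ht => ⟨ht.1, ht.2.trans_le h⟩

theorem Icc_subset_timeDomain {T : EReal} {b : ℝ} (hb : b ∈ timeDomain T) :
    Set.Icc 0 b ⊆ timeDomain T :=
  fun _ ht => ⟨ht.1, (EReal.coe_le_coe_iff.2 ht.2).trans_lt hb.2⟩

theorem isOpen_setOf_coe_lt (T : EReal) : IsOpen {t : ℝ | (t : EReal) < T} :=
  isOpen_lt continuous_coe_real_ereal continuous_const

theorem timeDomain_mem_nhdsGE {T : EReal} {t : ℝ} (ht : t ∈ timeDomain T) :
    timeDomain T ∈ 𝓝[≥] t := by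
  filter_upwards [self_mem_nhdsWithin,
    mem_nhdsWithin_of_mem_nhds ((isOpen_setOf_coe_lt T).mem_nhds ht.2)] with s hs hs'
  exact ⟨ht.1.trans hs, hs'⟩

/-! ### Curves in Sobolev spaces as curves in a Hilbert space -/

section curves

variable {m : ℝ} {T : EReal} {u u' : ℝ → VField d}

theorem IsContinuousInto.continuousOn_toCoeff (h : IsContinuousInto m T u) :
    ContinuousOn (fun t => toCoeff m (u t)) (timeDomain T) := by
  intro t ht
  refine tendsto_iff_norm_sub_tendsto_zero.2 ((h.2 t ht).congr' ?_)
  filter_upwards [self_mem_nhdsWithin] with s hs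
  rw [← (HSigma.summable (h.1 s hs)).toCoeff_sub (HSigma.summable (h.1 t ht)), norm_toCoeff]

theorem IsContinuousInto.continuousOn_norm (h : IsContinuousInto m T u) :
    ContinuousOn (fun t => sobolevNorm m (u t)) (timeDomain T) := by
  simp only [← norm_toCoeff]
  exact h.continuousOn_toCoeff.norm

theorem IsContinuousInto.mono {T' : EReal} (h : IsContinuousInto m T u) (hT : T' ≤ T) :
    IsContinuousInto m T' u :=
  ⟨fun t ht => h.1 t (timeDomain_mono hT ht), fun t ht =>
    (h.2 t (timeDomain_mono hT ht)).mono_left (nhdsWithin_mono _ (timeDomain_mono hT))⟩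

theorem IsContinuousInto.mono_order {m' : ℝ} (hm : 0 < m) (hmm : m ≤ m')
    (hu : IsContinuousInto m' T u) : IsContinuousInto m T u := by
  refine ⟨fun t ht => HSigma.mono hm hmm (hu.1 t ht), fun t ht => ?_⟩
  refine squeeze_zero' (Eventually.of_forall fun _ => sobolevNorm_nonneg _ _) ?_ (hu.2 t ht)
  filter_upwards [self_mem_nhdsWithin] with s hs
  exact (HSigma.summable (HSigma.sub (hu.1 s hs) (hu.1 t ht))).norm_mono hm hmm

theorem IsC1Into.hasDerivWithinAt (h : IsC1Into m T u u') {t : ℝ} (ht : t ∈ timeDomain T) :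
    HasDerivWithinAt (fun s => toCoeff m (u s)) (toCoeff m (u' t)) (timeDomain T) t := by
  rw [hasDerivWithinAt_iff_tendsto_slope]
  refine tendsto_iff_norm_sub_tendsto_zero.2 ((h.2.2 t ht).congr' ?_)
  filter_upwards [self_mem_nhdsWithin] with s hs
  have h1 := HSigma.summable (h.1.1 s hs.1)
  have h2 := HSigma.summable (h.1.1 t ht)
  have h3 := HSigma.summable (h.2.1.1 t ht)
  rw [slope_def_module, ← h1.toCoeff_sub h2, ← (h1.sub h2).toCoeff_smul,
    ← ((h1.sub h2).smul _).toCoeff_sub h3, norm_toCoeff]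

end curves

/-! ### Comparison of Dini derivatives -/

theorem upperRightDini_frequently {R : ℝ → ℝ} {t c : ℝ} (h : (c : EReal) < upperRightDini R t) :
    ∃ᶠ z in 𝓝[>] t, c < slope R t z := by
  have h1 := frequently_lt_of_lt_limsup (f := 𝓝[>] (0 : ℝ)) (by isBoundedDefault) h
  have h2 : Tendsto (fun s : ℝ => t + s) (𝓝[>] 0) (𝓝[>] t) := by
    refine tendsto_nhdsWithin_iff.2 ⟨?_, ?_⟩
    · have : Tendsto (fun s : ℝ => t + s) (𝓝 0) (𝓝 (t + 0)) :=
        (continuous_const.add continuous_id).tendsto 0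
      rw [add_zero] at this
      exact this.mono_left nhdsWithin_le_nhds
    · filter_upwards [self_mem_nhdsWithin] with s hs
      simpa using hs
  refine h2.frequently (h1.mono fun s hs => ?_)
  rw [slope_def_field, add_sub_cancel_left]
  exact_mod_cast hs

/-- The slopes of `R` are only frequently large, but those of `r` are eventually small, so the
slopes of `r - R` are frequently small. That suffices to compare `r - R` with a strict exponential
barrier, whose height tends to 0. -/
theorem le_of_upperRightDini {r R : ℝ → ℝ} {F : ℝ → ℝ → ℝ} {b Λ : ℝ}
    (hr : ContinuousOn r (Set.Icc 0 b)) (hR : ContinuousOn R (Set.Icc 0 b)) (h0 : r 0 ≤ R 0)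
    (hr' : ∀ t ∈ Set.Ico 0 b, ∀ ρ, F t (r t) < ρ → ∀ᶠ z in 𝓝[>] t, slope r t z < ρ)
    (hR' : ∀ t ∈ Set.Ico 0 b, (F t (R t) : EReal) ≤ upperRightDini R t)
    (hF : ∀ t ∈ Set.Ico 0 b, R t ≤ r t → F t (r t) - F t (R t) ≤ Λ * (r t - R t)) :
    ∀ t ∈ Set.Icc 0 b, r t ≤ R t := by
  intro t ht
  refine le_of_forall_pos_le_add fun η hη => ?_
  -- With this amplitude the barrier `κ e^{(Λ+1)s}` has value exactly `η` at the time `t`.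
  set κ := η / Real.exp ((Λ + 1) * t) with hκ
  have hκ0 : 0 < κ := div_pos hη (Real.exp_pos _)
  have key := image_le_of_liminf_slope_right_lt_deriv_boundary' (f := fun s => r s - R s)
    (f' := fun s => F s (r s) - F s (R s)) (a := 0) (b := b)
    (B := fun s => κ * Real.exp ((Λ + 1) * s))
    (B' := fun s => κ * (Real.exp ((Λ + 1) * s) * (Λ + 1))) (hr.sub hR) ?_ ?_ ?_ ?_ ?_ ht
  · simp only [hκ, div_mul_cancel₀ η (Real.exp_pos ((Λ + 1) * t)).ne'] at key
    linarith
  · intro s hs ρ hρ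
    set e := (ρ - (F s (r s) - F s (R s))) / 2 with he
    have he0 : 0 < e := by simp only [he]; linarith
    have h1 := hr' s hs (F s (r s) + e) (by linarith)
    have h2 : ∃ᶠ z in 𝓝[>] s, F s (R s) - e < slope R s z :=
      upperRightDini_frequently (lt_of_lt_of_le
        (EReal.coe_lt_coe_iff.2 (by linarith)) (hR' s hs))
    refine (h2.and_eventually h1).mono fun z hz => ?_
    have h3 : slope (fun s => r s - R s) s z = slope r s z - slope R s z := by
      simp only [slope_def_field]; ring
    rw [h3]
    have := hz.1
    have := hz.2
    linarith
  · simp only [mul_zero, Real.exp_zero, mul_one]; linarith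
  · exact (by fun_prop : Continuous fun s => κ * Real.exp ((Λ + 1) * s)).continuousOn
  · intro s _
    have h1 : HasDerivAt (fun s => (Λ + 1) * s) (Λ + 1) s := by
      simpa using (hasDerivAt_id s).const_mul (Λ + 1)
    exact (h1.exp.const_mul κ).hasDerivWithinAt
  -- At a contact point `r - R` equals the positive barrier, so its rate is at most `Λ` times the
  -- barrier, strictly less than the barrier's own rate.
  · intro s hs heq
    have hp : 0 < κ * Real.exp ((Λ + 1) * s) := mul_pos hκ0 (Real.exp_pos _)
    have h1 := hF s hs (by linarith)
    have h2 : κ * (Real.exp ((Λ + 1) * s) * (Λ + 1)) =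
        Λ * (κ * Real.exp ((Λ + 1) * s)) + κ * Real.exp ((Λ + 1) * s) := by ring
    rw [heq] at h1
    linarith

/-- Away from zero the norm has right derivative `⟨W, W'⟩ / ‖W‖`. At a zero of `W` it need not be
differentiable, but its right slopes are the norms of the slopes of `W` and tend to `‖W'‖`. -/
theorem eventually_slope_norm_lt {E : Type*} [NormedAddCommGroup E] [InnerProductSpace ℝ E]
    {W : ℝ → E} {W' : E} {t c ρ : ℝ} (hW : HasDerivWithinAt W W' (Set.Ici t) t)
    (hpos : W t ≠ 0 → inner ℝ (W t) W' ≤ c * ‖W t‖) (hzero : W t = 0 → ‖W'‖ ≤ c) (hρ : c < ρ) :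
    ∀ᶠ z in 𝓝[>] t, slope (fun s => ‖W s‖) t z < ρ := by
  by_cases h0 : W t = 0
  · have h1 := ((hasDerivWithinAt_iff_tendsto_slope' (by simp : t ∉ Set.Ioi t)).1
      hW.Ioi_of_Ici).norm
    filter_upwards [h1.eventually_lt_const ((hzero h0).trans_lt hρ), self_mem_nhdsWithin] with z hz hz'
    refine lt_of_le_of_lt (le_of_eq ?_) hz
    have h2 : 0 < z - t := sub_pos.2 hz'
    rw [slope_def_field, slope_def_module, h0, norm_smul, norm_zero, sub_zero, sub_zero, norm_inv,
      Real.norm_of_nonneg h2.le]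
    field_simp
  · have hn : 0 < ‖W t‖ := norm_pos_iff.2 h0
    have h1 : HasDerivWithinAt (fun s => ‖W s‖) (inner ℝ (W t) W' / ‖W t‖) (Set.Ici t) t := by
      have h2 := (hW.norm_sq).sqrt (by positivity)
      simp only [Real.sqrt_sq (norm_nonneg _)] at h2
      convert h2 using 1
      field_simp
    have h3 := (hasDerivWithinAt_iff_tendsto_slope' (by simp : t ∉ Set.Ioi t)).1
      h1.Ioi_of_Ici
    refine h3.eventually_lt_const (lt_of_le_of_lt ?_ hρ)
    rw [div_le_iff₀ hn]
    exact hpos h0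

/-! ### The distance between exact and approximate solutions -/

theorem sobolevInner_comm {m : ℝ} {v w : VField d} (hv : SobolevSummable m v)
    (hw : SobolevSummable m w) : sobolevInner m v w = sobolevInner m w v := by
  rw [← hv.re_inner_toCoeff hw, ← hw.re_inner_toCoeff hv, real_inner_comm]

/-- The energy estimate behind the control inequality: Poincaré for the Laplacian, Kato for `P(v, v
- a)` with `‖v‖_n ≤ ‖v - a‖_n + D`, the basic inequality for `P(v - a, a)`, and Cauchy–Schwarz for
`e`. It is reused for differences of Galerkin approximations. -/
theorem sobolevInner_difference_le {n K G ν : ℝ} (hn : (d : ℝ) / 2 + 1 < n)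
    (hK : IsBasicConstant d n K) (hG : IsKatoConstant d n G) (hν : 0 ≤ ν)
    {v a e : VField d} (hv : v ∈ HSigma d (n + 2)) (ha : a ∈ HSigma d (n + 2))
    (he : e ∈ HSigma d n) {D D₁ ε : ℝ} (hD : sobolevNorm n a ≤ D)
    (hD₁ : sobolevNorm (n + 1) a ≤ D₁) (hε : sobolevNorm n e ≤ ε) :
    sobolevInner n (ν • laplacian (v - a) + (eulerBilinear v v - eulerBilinear a a) - e) (v - a) ≤
      (-ν * sobolevNorm n (v - a) + (G * D + K * D₁) * sobolevNorm n (v - a) +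
        G * sobolevNorm n (v - a) ^ 2 + ε) * sobolevNorm n (v - a) := by
  have hd : (0 : ℝ) ≤ d := Nat.cast_nonneg d
  have hn0 : 0 < n := by linarith
  set w := v - a with hw
  have hw2 : w ∈ HSigma d (n + 2) := HSigma.sub hv ha
  have hw1 : w ∈ HSigma d (n + 1) := HSigma.mono (by linarith) (by linarith) hw2
  have hw0 : w ∈ HSigma d n := HSigma.mono hn0 (by linarith) hw2
  have hv0 : v ∈ HSigma d n := HSigma.mono hn0 (by linarith) hv
  have ha1 : a ∈ HSigma d (n + 1) := HSigma.mono (by linarith) (by linarith) ha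
  have ha0 : a ∈ HSigma d n := HSigma.mono hn0 (by linarith) ha
  have s0 := HSigma.summable hw0
  have s1 := (HSigma.summable (HSigma.laplacian hn0 hw2)).smul ν
  have s2 := HSigma.summable (eulerBilinear_mem hn le_rfl hv0 hw1)
  have s3 := HSigma.summable (eulerBilinear_mem hn le_rfl hw0 ha1)
  have s4 := HSigma.summable he
  have hN : 0 ≤ sobolevNorm n w := sobolevNorm_nonneg _ _
  have hva : sobolevNorm n v ≤ sobolevNorm n w + D := by
    have h := s0.norm_add_le (HSigma.summable ha0)
    rw [hw, sub_add_cancel] at h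
    linarith
  rw [eulerBilinear_self_sub hn hv0 ha0, ← hw, (s1.add (s2.add s3)).sobolevInner_sub_left s4 s0,
    s1.sobolevInner_add_left (s2.add s3) s0, s2.sobolevInner_add_left s3 s0]
  have e1 : sobolevInner n (ν • laplacian w) w ≤ ν * -sobolevNorm n w ^ 2 := by
    have h1 : sobolevInner n (ν • laplacian w) w = ν * sobolevInner n (laplacian w) w := by
      have h2 := HSigma.summable (HSigma.laplacian hn0 hw2)
      rw [← (h2.smul ν).re_inner_toCoeff s0, ← h2.re_inner_toCoeff s0, h2.toCoeff_smul,
        real_inner_smul_left]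
    rw [h1]
    exact mul_le_mul_of_nonneg_left (sobolevInner_laplacian_le hn0 hw2) hν
  have e2 : sobolevInner n (eulerBilinear v w) w ≤
      G * (sobolevNorm n w + D) * sobolevNorm n w ^ 2 := by
    refine (le_abs_self _).trans ((hG.2 v hv0 w hw1).trans ?_)
    have := hG.1.le
    gcongr
  have e3 : sobolevInner n (eulerBilinear w a) w ≤
      K * sobolevNorm n w * D₁ * sobolevNorm n w := by
    refine (le_abs_self _).trans ((s3.abs_sobolevInner_le s0).trans ?_)
    refine mul_le_mul_of_nonneg_right ((hK.2 w hw0 a ha1).trans ?_) hN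
    have := hK.1.le
    gcongr
  have e4 : -sobolevInner n e w ≤ ε * sobolevNorm n w := by
    refine (neg_le_abs _).trans ((s4.abs_sobolevInner_le s0).trans ?_)
    gcongr
  nlinarith

theorem sobolevNorm_sub_le_of_control {n K G ν : ℝ} (hn : (d : ℝ) / 2 + 1 < n)
    (hK : IsBasicConstant d n K) (hG : IsKatoConstant d n G) (hν : 0 ≤ ν)
    {f u ua ua' : ℝ → VField d} {u₀ : VField d} {T Ta Tc : EReal}
    (hu : IsSolution n ν f u₀ T u) (hua : IsApproxSolution n Ta ua ua') {ε D D₁ R : ℝ → ℝ} {δ : ℝ}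
    (hε : IsEstimator n Ta (differentialError ν f ua ua') ε)
    (hδ : sobolevNorm n (ua 0 - u₀) ≤ δ) (hD : IsEstimator n Ta ua D)
    (hD₁ : IsEstimator (n + 1) Ta ua D₁) (hTc : Tc ≤ Ta)
    (hR : ControlInequalities ν K G ε δ D D₁ Tc R) :
    ∀ t ∈ timeDomain (min Tc T), sobolevNorm n (u t - ua t) ≤ R t := by
  obtain ⟨hT0, hu2, ⟨u', hu1, hode⟩, hu0⟩ := hu
  obtain ⟨hTa0, hua2, hua1⟩ := hua
  obtain ⟨hRc, hR0, hRd, hRδ⟩ := hR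
  have hd : (0 : ℝ) ≤ d := Nat.cast_nonneg d
  have hn0 : 0 < n := by linarith
  intro b hb
  have hbc : b ∈ timeDomain Tc := timeDomain_mono (min_le_left _ _) hb
  have hbT : b ∈ timeDomain T := timeDomain_mono (min_le_right _ _) hb
  have hba : b ∈ timeDomain Ta := timeDomain_mono hTc hbc
  have IT := Icc_subset_timeDomain hbT
  have Ia := Icc_subset_timeDomain hba
  have Ic := Icc_subset_timeDomain hbc
  set W : ℝ → CoeffSpace d := fun s => toCoeff n (u s) - toCoeff n (ua s) with hW
  have hWeq : ∀ s ∈ Set.Icc 0 b, W s = toCoeff n (u s - ua s) := fun s hs =>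
    ((HSigma.summable (hu1.1.1 s (IT hs))).toCoeff_sub
      (HSigma.summable (hua1.1.1 s (Ia hs)))).symm
  have hnW : ∀ s ∈ Set.Icc 0 b, ‖W s‖ = sobolevNorm n (u s - ua s) := fun s hs => by
    rw [hWeq s hs, norm_toCoeff]
  have hWd : ∀ s ∈ Set.Icc 0 b, HasDerivWithinAt W (toCoeff n (u' s - ua' s)) (Set.Ici s) s := by
    intro s hs
    rw [(HSigma.summable (hu1.2.1.1 s (IT hs))).toCoeff_sub
      (HSigma.summable (hua1.2.1.1 s (Ia hs)))]
    exact ((hu1.hasDerivWithinAt (IT hs)).mono_of_mem_nhdsWithin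
      (timeDomain_mem_nhdsGE (IT hs))).sub
      ((hua1.hasDerivWithinAt (Ia hs)).mono_of_mem_nhdsWithin (timeDomain_mem_nhdsGE (Ia hs)))
  have hcr : ContinuousOn (fun s => ‖W s‖) (Set.Icc 0 b) :=
    ((hu1.1.continuousOn_toCoeff.mono IT).sub (hua1.1.continuousOn_toCoeff.mono Ia)).norm
  have hcR : ContinuousOn R (Set.Icc 0 b) := hRc.mono Ic
  set F : ℝ → ℝ → ℝ := fun s x =>
    -ν * x + (G * D s + K * D₁ s) * x + G * x ^ 2 + ε s with hF
  -- The difference quotient of `F s` between `R s` and `‖W s‖` is this function minus `ν`; its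
  -- bound on the compact interval supplies `Λ`.
  have hcoef : ContinuousOn (fun s => G * D s + K * D₁ s + G * (‖W s‖ + R s)) (Set.Icc 0 b) :=
    ((continuousOn_const.mul (hD.1.mono Ia)).add (continuousOn_const.mul (hD₁.1.mono Ia))).add
      (continuousOn_const.mul (hcr.add hcR))
  obtain ⟨Λ, hΛ⟩ := (isCompact_Icc.image_of_continuousOn hcoef).bddAbove
  have hdiff : ∀ s ∈ Set.Icc 0 b, u' s - ua' s = ν • laplacian (u s - ua s) +
      (eulerBilinear (u s) (u s) - eulerBilinear (ua s) (ua s)) -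
        differentialError ν f ua ua' s := fun s hs => by
    rw [hode s (IT hs), differentialError, laplacian_sub, smul_sub]
    abel
  -- Membership of the error in the Sobolev space is read off from the equation for `u`, where every
  -- other term is known to belong to it.
  have herr : ∀ s ∈ Set.Icc 0 b, differentialError ν f ua ua' s ∈ HSigma d n := fun s hs => by
    have h1 : differentialError ν f ua ua' s = ν • laplacian (u s - ua s) +
        (eulerBilinear (u s) (u s) - eulerBilinear (ua s) (ua s)) - (u' s - ua' s) := by
      rw [hdiff s hs]; abel
    have m1 := hu2.1 s (IT hs)
    have m2 := hua2.1 s (Ia hs)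
    rw [h1]
    exact HSigma.sub (HSigma.add (HSigma.smul ν (HSigma.laplacian hn0 (HSigma.sub m1 m2)))
      (HSigma.sub
        (eulerBilinear_mem hn le_rfl (HSigma.mono hn0 (by linarith) m1)
          (HSigma.mono (by linarith) (by linarith) m1))
        (eulerBilinear_mem hn le_rfl (HSigma.mono hn0 (by linarith) m2)
          (HSigma.mono (by linarith) (by linarith) m2))))
      (HSigma.sub (hu1.2.1.1 s (IT hs)) (hua1.2.1.1 s (Ia hs)))
  have key := le_of_upperRightDini (r := fun s => ‖W s‖) (R := R) (F := F) (b := b) (Λ := Λ)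
    hcr hcR ?_ ?_ ?_ ?_ b ⟨hb.1, le_rfl⟩
  · rw [← hnW b ⟨hb.1, le_rfl⟩]
    exact key
  · simp only [hnW 0 ⟨le_rfl, hb.1⟩, hu0]
    rw [sobolevNorm_sub_comm]
    exact hδ.trans hRδ
  · intro s hs ρ hρ
    have hs' : s ∈ Set.Icc 0 b := ⟨hs.1, hs.2.le⟩
    have hw0 := HSigma.summable (HSigma.sub (hu1.1.1 s (IT hs')) (hua1.1.1 s (Ia hs')))
    have hw' := HSigma.summable (HSigma.sub (hu1.2.1.1 s (IT hs')) (hua1.2.1.1 s (Ia hs')))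
    refine eventually_slope_norm_lt (hWd s hs') (fun _ => ?_) (fun h0 => ?_) hρ
    · rw [hnW s hs', hWeq s hs', hw0.re_inner_toCoeff hw', sobolevInner_comm hw0 hw',
        hdiff s hs']
      exact sobolevInner_difference_le hn hK hG hν (hu2.1 s (IT hs')) (hua2.1 s (Ia hs'))
        (herr s hs') (hD.2 s (Ia hs')).2 (hD₁.2 s (Ia hs')).2 (hε.2 s (Ia hs')).2
    -- Where the two curves meet, the nonlinear and viscous differences vanish, so only the
    -- differential error remains, and `F s 0 = ε s`.
    · have h1 : u s = ua s := HSigma.eq_of_norm_sub_eq_zero hn0 (hu1.1.1 s (IT hs'))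
        (hua1.1.1 s (Ia hs')) (by rw [← hnW s hs', h0, norm_zero])
      have h2 : u' s - ua' s = -differentialError ν f ua ua' s := by
        rw [hdiff s hs', h1]
        have : laplacian (ua s - ua s) = 0 := by funext k; simp [laplacian]
        rw [this]
        simp
      rw [h2, norm_toCoeff, sobolevNorm_neg]
      simp only [hF, h0, norm_zero, mul_zero]
      simpa using (hε.2 s (Ia hs')).2
  · intro s hs
    exact hRd s (Ic ⟨hs.1, hs.2.le⟩)
  · intro s hs hle
    have h1 := hΛ (Set.mem_image_of_mem _ (⟨hs.1, hs.2.le⟩ : s ∈ Set.Icc 0 b))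
    simp only [hF]
    have h2 := mul_le_mul_of_nonneg_right h1 (sub_nonneg.2 hle)
    have h3 := mul_nonneg hν (sub_nonneg.2 hle)
    nlinarith

/-- Uniqueness is the control estimate for `v` as an approximate solution of `u` with zero errors:
`R = 0` fulfills the control inequalities. -/
theorem IsSolution.eq_of_isSolution {n K G ν : ℝ} (hn : (d : ℝ) / 2 + 1 < n)
    (hK : IsBasicConstant d n K) (hG : IsKatoConstant d n G) (hν : 0 ≤ ν)
    {f u v : ℝ → VField d} {u₀ : VField d} {T T' : EReal}
    (hu : IsSolution n ν f u₀ T u) (hv : IsSolution n ν f u₀ T' v) :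
    ∀ t ∈ timeDomain (min T' T), u t = v t := by
  obtain ⟨hT0, hv2, ⟨v', hv1, hode⟩, hv0⟩ := id hv
  have hd : (0 : ℝ) ≤ d := Nat.cast_nonneg d
  have hn0 : 0 < n := by linarith
  have hv1' : IsContinuousInto (n + 1) T' v := hv2.mono_order (by linarith) (by linarith)
  have h := sobolevNorm_sub_le_of_control hn hK hG hν hu ⟨hT0, hv2, hv1⟩
    (ε := fun _ => 0) (δ := 0) (D := fun t => sobolevNorm n (v t))
    (D₁ := fun t => sobolevNorm (n + 1) (v t)) (R := fun _ => 0)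
    ⟨continuousOn_const, fun t ht => ⟨le_rfl, by
      have : differentialError ν f v v' t = 0 := by
        rw [differentialError, hode t ht]; abel
      rw [this, sobolevNorm_zero]⟩⟩
    (by rw [hv0, sub_self, sobolevNorm_zero])
    ⟨hv1.1.continuousOn_norm, fun t _ => ⟨sobolevNorm_nonneg _ _, le_rfl⟩⟩
    ⟨hv1'.continuousOn_norm, fun t _ => ⟨sobolevNorm_nonneg _ _, le_rfl⟩⟩ le_rfl
    ⟨continuousOn_const, fun _ _ => le_rfl, fun t _ => by simp [upperRightDini], le_rfl⟩
  intro t ht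
  exact HSigma.eq_of_norm_sub_eq_zero hn0
    (HSigma.mono hn0 (by linarith) (hu.2.1.1 t (timeDomain_mono (min_le_right _ _) ht)))
    (HSigma.mono hn0 (by linarith) (hv2.1 t (timeDomain_mono (min_le_left _ _) ht))) (h t ht)

/-! ### An ordinary differential equation with an energy estimate -/

section ode

variable {E : Type*} [NormedAddCommGroup E] [InnerProductSpace ℝ E]

/-- The radial retraction on the closed ball of radius `M`. -/
def radialRetract (M : ℝ) (z : E) : E := (M / max M ‖z‖) • z

theorem norm_radialRetract_le {M : ℝ} (hM : 0 < M) (z : E) : ‖radialRetract M z‖ ≤ M := by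
  have h : 0 < max M ‖z‖ := lt_max_of_lt_left hM
  rw [radialRetract, norm_smul, Real.norm_of_nonneg (by positivity), div_mul_eq_mul_div,
    div_le_iff₀ h]
  exact mul_le_mul_of_nonneg_left (le_max_right _ _) hM.le

theorem radialRetract_of_norm_le {M : ℝ} (hM : 0 < M) {z : E} (hz : ‖z‖ ≤ M) :
    radialRetract M z = z := by
  rw [radialRetract, max_eq_left hz, div_self hM.ne', one_smul]

theorem norm_radialRetract_sub_le {M : ℝ} (hM : 0 < M) (z w : E) :
    ‖radialRetract M z - radialRetract M w‖ ≤ 2 * ‖z - w‖ := by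
  have ha : 0 < max M ‖z‖ := lt_max_of_lt_left hM
  have hb : 0 < max M ‖w‖ := lt_max_of_lt_left hM
  set a := max M ‖z‖ with hadef
  set b := max M ‖w‖ with hbdef
  have hMa : M ≤ a := le_max_left _ _
  have hwb : ‖w‖ ≤ b := le_max_right _ _
  have hab : |b - a| ≤ ‖z - w‖ := by
    rw [hadef, hbdef, max_comm M, max_comm M]
    refine (abs_max_sub_max_le_abs _ _ _).trans ?_
    rw [abs_sub_comm]
    exact abs_norm_sub_norm_le z w
  have h1 : radialRetract M z - radialRetract M w =
      (M / a) • (z - w) + (M / a * ((b - a) / b)) • w := by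
    have h2 : M / b = M / a - M / a * ((b - a) / b) := by field_simp; ring
    rw [radialRetract, radialRetract, ← hadef, ← hbdef, h2, sub_smul, smul_sub]
    abel
  have hMa1 : M / a ≤ 1 := (div_le_one ha).2 hMa
  have hMa0 : 0 ≤ M / a := by positivity
  rw [h1, two_mul]
  refine (norm_add_le _ _).trans (add_le_add ?_ ?_)
  · rw [norm_smul, Real.norm_of_nonneg hMa0]
    exact mul_le_of_le_one_left (norm_nonneg _) hMa1
  · rw [norm_smul, Real.norm_eq_abs, abs_mul, abs_of_nonneg hMa0, abs_div, abs_of_pos hb]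
    calc M / a * (|b - a| / b) * ‖w‖ = M / a * (|b - a| * (‖w‖ / b)) := by ring
      _ ≤ 1 * (|b - a| * 1) := by
        gcongr
        exact (div_le_one hb).2 hwb
      _ ≤ ‖z - w‖ := by simpa using hab

/-- The retraction multiplies `z` by a positive scalar, so the sign information of the energy
inequality survives, and dividing by the scalar leaves linear growth. -/
theorem inner_radialRetract_le {M G : ℝ} (hM : 0 < M) (hG : 0 ≤ G) {A : E → E}
    (hA : ∀ z, ‖z‖ ≤ M → inner ℝ z (A z) ≤ G * ‖z‖ ^ 3) (z : E) :
    inner ℝ z (A (radialRetract M z)) ≤ G * M ^ 2 * ‖z‖ := by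
  have h : 0 < max M ‖z‖ := lt_max_of_lt_left hM
  set c := M / max M ‖z‖ with hc
  have hc0 : 0 < c := by positivity
  have h1 := hA _ (norm_radialRetract_le hM z)
  have h2 := norm_radialRetract_le hM z
  have h3 : ‖radialRetract M z‖ = c * ‖z‖ := by
    rw [radialRetract, norm_smul, Real.norm_of_nonneg hc0.le]
  have h4 : inner ℝ (radialRetract M z) (A (radialRetract M z)) =
      c * inner ℝ z (A (radialRetract M z)) := by
    conv_lhs => rw [radialRetract, real_inner_smul_left, ← radialRetract]
  have h5 : c * inner ℝ z (A (radialRetract M z)) ≤ c * (G * M ^ 2 * ‖z‖) := by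
    rw [← h4]
    calc _ ≤ G * ‖radialRetract M z‖ ^ 3 := h1
      _ = G * ‖radialRetract M z‖ ^ 2 * (c * ‖z‖) := by rw [← h3]; ring
      _ ≤ G * M ^ 2 * (c * ‖z‖) := by gcongr
      _ = _ := by ring
  exact le_of_mul_le_mul_left h5 hc0

/-- A differential equation `α' = A α + g` has a solution on `[0, T]`, if `A` is Lipschitz on the
ball of radius `M` and the energy estimate does not allow to leave this ball. -/
theorem exists_solution_of_energy [CompleteSpace E] {A : E → E} {g : ℝ → E} {M C G Φ T : ℝ} {x₀ : E}
    (hM : 0 < M) (hC : 0 ≤ C) (hG : 0 ≤ G) (hT : 0 ≤ T)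
    (hLip : ∀ z w, ‖z‖ ≤ M → ‖w‖ ≤ M → ‖A z - A w‖ ≤ C * ‖z - w‖) (hA0 : A 0 = 0)
    (hA : ∀ z, ‖z‖ ≤ M → inner ℝ z (A z) ≤ G * ‖z‖ ^ 3)
    (hg : ContinuousOn g (Set.Icc 0 T)) (hΦ : ∀ t ∈ Set.Icc 0 T, ‖g t‖ ≤ Φ)
    (hx₀ : ‖x₀‖ + (G * M ^ 2 + Φ) * T ≤ M) :
    ∃ α : ℝ → E, α 0 = x₀ ∧ ∀ t ∈ Set.Icc 0 T, ‖α t‖ ≤ M ∧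
      HasDerivWithinAt α (A (α t) + g t) (Set.Icc 0 T) t := by
  have hΦ0 : 0 ≤ Φ := (norm_nonneg _).trans (hΦ 0 ⟨le_rfl, hT⟩)
  -- Composed with the retraction, the field is globally Lipschitz and bounded by `C M + Φ`. A ball
  -- of radius `(C M + Φ) T` thus contains the motion, and Picard–Lindelöf covers all of `[0, T]` at
  -- once.
  set F : ℝ → E → E := fun t z => A (radialRetract M z) + g t with hF
  have hpl : IsPicardLindelof F (tmin := 0) (tmax := T) ⟨0, le_rfl, hT⟩ x₀
      (⟨(C * M + Φ) * T, by positivity⟩ : NNReal) 0 ⟨C * M + Φ, by positivity⟩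
      ⟨C * 2, by positivity⟩ := by
    refine ⟨fun t _ => LipschitzOnWith.of_dist_le_mul fun z _ w _ => ?_, fun z _ => ?_,
      fun t ht z _ => ?_, ?_⟩
    · simp only [hF]
      rw [dist_eq_norm, dist_eq_norm, add_sub_add_right_eq_sub]
      change _ ≤ C * 2 * ‖z - w‖
      calc _ ≤ C * ‖radialRetract M z - radialRetract M w‖ :=
            hLip _ _ (norm_radialRetract_le hM z) (norm_radialRetract_le hM w)
        _ ≤ C * (2 * ‖z - w‖) := by
            gcongr
            exact norm_radialRetract_sub_le hM z w
        _ = _ := by ring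
    · exact continuousOn_const.add hg
    · simp only [hF]
      refine (norm_add_le _ _).trans (add_le_add ?_ (hΦ t ht))
      have h1 := hLip (radialRetract M z) 0 (norm_radialRetract_le hM z) (by simpa using hM.le)
      rw [hA0, sub_zero, sub_zero] at h1
      exact h1.trans (mul_le_mul_of_nonneg_left (norm_radialRetract_le hM z) hC)
    · change (C * M + Φ) * max (T - 0) (0 - 0) ≤ (C * M + Φ) * T - 0
      rw [sub_zero, sub_zero, sub_zero, max_eq_left hT]
  obtain ⟨α, hα0, hα⟩ := hpl.exists_eq_forall_mem_Icc_hasDerivWithinAt₀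
  have hα0' : α 0 = x₀ := hα0
  -- The norm grows at rate at most `G M² + Φ`, so `α` stays in the ball where the retraction is the
  -- identity and the original equation holds.
  have hbound : ∀ t ∈ Set.Icc 0 T, ‖α t‖ ≤ ‖x₀‖ + (G * M ^ 2 + Φ) * t := by
    intro t ht
    refine image_le_of_liminf_slope_right_le_deriv_boundary (f := fun s => ‖α s‖)
      (B := fun s => ‖x₀‖ + (G * M ^ 2 + Φ) * s) (B' := fun _ => G * M ^ 2 + Φ)
      (fun s hs => (hα s hs).continuousWithinAt.norm) (by simp [hα0']) (by fun_prop)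
      (fun s _ => ?_) (fun s hs ρ hρ => Eventually.frequently ?_) ht
    · simpa using! (((hasDerivAt_id s).const_mul (G * M ^ 2 + Φ)).const_add ‖x₀‖).hasDerivWithinAt
    · have hs' : s ∈ Set.Icc 0 T := ⟨hs.1, hs.2.le⟩
      refine eventually_slope_norm_lt ((hα s hs').mono_of_mem_nhdsWithin ?_) (fun _ => ?_)
        (fun h0 => ?_) hρ
      · exact mem_of_superset (Icc_mem_nhdsGE hs.2) (Set.Icc_subset_Icc_left hs.1)
      · simp only [hF]
        rw [inner_add_right, add_mul]
        refine add_le_add (inner_radialRetract_le hM hG hA _) ?_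
        refine (real_inner_le_norm _ _).trans ?_
        rw [mul_comm]
        exact mul_le_mul_of_nonneg_right (hΦ s hs') (norm_nonneg _)
      · simp only [hF, h0]
        rw [radialRetract, smul_zero, hA0, zero_add]
        exact (hΦ s hs').trans (le_add_of_nonneg_left (by positivity))
  refine ⟨α, hα0', fun t ht => ?_⟩
  have hle : ‖α t‖ ≤ M := (hbound t ht).trans <| le_trans
    (by have := mul_le_mul_of_nonneg_left ht.2 (by positivity : 0 ≤ G * M ^ 2 + Φ); linarith) hx₀
  refine ⟨hle, ?_⟩
  have h := hα t ht
  simp only [hF, radialRetract_of_norm_le hM hle] at h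
  exact h

end ode

/-! ### Galerkin spaces -/

/-- The wave vectors with `|k| ≤ N`. -/
def modes (d N : ℕ) : Finset (Fin d → ℤ) := (finite_setOf_freqNorm_le (d := d) (N : ℝ)).toFinset

theorem mem_modes {N : ℕ} {k : Fin d → ℤ} : k ∈ modes d N ↔ freqNorm k ≤ N := by
  simp [modes]

/-- Truncation to the modes `|k| ≤ N`. -/
def truncate (N : ℕ) (v : VField d) : VField d := fun k => if k ∈ modes d N then v k else 0

theorem truncate_apply_of_mem {N : ℕ} {k : Fin d → ℤ} (hk : k ∈ modes d N) (v : VField d) :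
    truncate N v k = v k := if_pos hk

theorem truncate_apply_of_notMem {N : ℕ} {k : Fin d → ℤ} (hk : k ∉ modes d N) (v : VField d) :
    truncate N v k = 0 := if_neg hk

/-- Real, zero mean, divergence free trigonometric polynomials with modes `|k| ≤ N`. -/
def galerkinSubmodule (d N : ℕ) : Submodule ℝ (VField d) where
  carrier := {v | v ∈ solenoidal d ∧ ∀ k ∉ modes d N, v k = 0}
  add_mem' := fun hv hw => ⟨add_mem hv.1 hw.1, fun k hk => by simp [hv.2 k hk, hw.2 k hk]⟩
  zero_mem' := ⟨zero_mem _, fun _ _ => rfl⟩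
  smul_mem' := fun c v hv => ⟨Submodule.smul_mem _ c hv.1, fun k hk => by simp [hv.2 k hk]⟩

theorem truncate_mem {N : ℕ} {v : VField d} (hv : v ∈ solenoidal d) :
    truncate N v ∈ galerkinSubmodule d N := by
  refine ⟨⟨fun k r => ?_, ?_, fun k => ?_⟩, fun k hk => truncate_apply_of_notMem hk v⟩
  · have h : -k ∈ modes d N ↔ k ∈ modes d N := by simp [mem_modes]
    by_cases hk : k ∈ modes d N
    · rw [truncate_apply_of_mem hk, truncate_apply_of_mem (h.2 hk), hv.1]
    · rw [truncate_apply_of_notMem hk, truncate_apply_of_notMem (mt h.1 hk)]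
      simp
  · simp [truncate, hv.2.1]
  · by_cases hk : k ∈ modes d N
    · rw [truncate_apply_of_mem hk, hv.2.2]
    · rw [truncate_apply_of_notMem hk, freqDot_zero_right]

theorem truncate_sub (N : ℕ) (v w : VField d) :
    truncate N (v - w) = truncate N v - truncate N w := by
  funext k; by_cases hk : k ∈ modes d N <;> simp [truncate, hk]

theorem truncate_add (N : ℕ) (v w : VField d) :
    truncate N (v + w) = truncate N v + truncate N w := by
  funext k; by_cases hk : k ∈ modes d N <;> simp [truncate, hk]

theorem sobolevSummable_truncate (N : ℕ) (m : ℝ) (v : VField d) :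
    SobolevSummable m (truncate N v) :=
  SobolevSummable.of_support (S := modes d N) (fun _ hk => truncate_apply_of_notMem hk v) m

theorem sobolevNorm_sq_of_support {S : Finset (Fin d → ℤ)} {v : VField d} (m : ℝ)
    (hv : ∀ k ∉ S, v k = 0) :
    sobolevNorm m v ^ 2 = ∑ k ∈ S, freqNorm k ^ (2 * m) * ‖v k‖ ^ 2 := by
  rw [sobolevNorm_sq]
  exact tsum_eq_sum fun k hk => by simp [hv k hk]

theorem sobolevNorm_truncate_le {m : ℝ} {v : VField d} (hv : SobolevSummable m v) (N : ℕ) :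
    sobolevNorm m (truncate N v) ≤ sobolevNorm m v := by
  refine le_of_sq_le_sq ?_ (sobolevNorm_nonneg _ _)
  rw [sobolevNorm_sq_of_support m fun k hk => truncate_apply_of_notMem (N := N) hk v]
  refine le_trans (le_of_eq (Finset.sum_congr rfl fun k hk => ?_)) (hv.sum_le (modes d N))
  rw [truncate_apply_of_mem hk]

/-- Truncation is an orthogonal projection in every order, so it disappears when tested against
retained modes. Hence the Galerkin equations inherit the energy estimates. -/
theorem sobolevInner_truncate {m : ℝ} {N : ℕ} {w : VField d} (hw : ∀ k ∉ modes d N, w k = 0)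
    (v : VField d) : sobolevInner m (truncate N v) w = sobolevInner m v w := by
  refine tsum_congr fun k => ?_
  by_cases hk : k ∈ modes d N
  · rw [truncate_apply_of_mem hk]
  · simp [hw k hk]

section galerkin

variable {N : ℕ}

theorem galerkin_mem_HSigma {v : VField d} (hv : v ∈ galerkinSubmodule d N) (m : ℝ) :
    v ∈ HSigma d m :=
  mem_HSigma_iff.2 ⟨hv.1, SobolevSummable.of_support hv.2 m⟩

/-- Bernstein's inequality. It depends on the cutoff, so it serves only to solve each Galerkin
system, not to pass to the limit. -/
theorem sobolevNorm_add_le_pow {v : VField d} (hv : v ∈ galerkinSubmodule d N) {m : ℝ} (hm : 0 < m)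
    (j : ℕ) : sobolevNorm (m + j) v ≤ (N : ℝ) ^ j * sobolevNorm m v := by
  refine le_of_sq_le_sq ?_ (mul_nonneg (by positivity) (sobolevNorm_nonneg _ _))
  rw [mul_pow, sobolevNorm_sq_of_support _ hv.2, sobolevNorm_sq_of_support _ hv.2, Finset.mul_sum]
  refine Finset.sum_le_sum fun k hk => ?_
  rw [← mul_assoc]
  refine mul_le_mul_of_nonneg_right ?_ (sq_nonneg _)
  rw [freqNorm_rpow_two_mul, freqNorm_rpow_two_mul, ← mul_pow]
  refine pow_le_pow_left₀ (Real.rpow_nonneg (freqNorm_nonneg k) _) ?_ 2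
  have hj : (0 : ℝ) ≤ j := Nat.cast_nonneg j
  rw [Real.rpow_add' (freqNorm_nonneg k) (by linarith), Real.rpow_natCast, mul_comm]
  exact mul_le_mul_of_nonneg_right (pow_le_pow_left₀ (freqNorm_nonneg k) (mem_modes.1 hk) j)
    (Real.rpow_nonneg (freqNorm_nonneg k) _)

instance finiteDimensional_galerkinSubmodule (d N : ℕ) :
    FiniteDimensional ℝ (galerkinSubmodule d N) := by
  let φ : galerkinSubmodule d N →ₗ[ℝ] (modes d N → EuclideanSpace ℂ (Fin d)) :=
    { toFun := fun v k => (v : VField d) k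
      map_add' := fun _ _ => rfl
      map_smul' := fun _ _ => rfl }
  refine Module.Finite.of_injective φ fun v w h => Subtype.ext (funext fun k => ?_)
  by_cases hk : k ∈ modes d N
  · exact congrFun h ⟨k, hk⟩
  · rw [v.2.2 k hk, w.2.2 k hk]

/-- The map `toCoeff` on trigonometric polynomials. -/
def galerkinCoeff (d : ℕ) (n : ℝ) (N : ℕ) : galerkinSubmodule d N →ₗ[ℝ] CoeffSpace d where
  toFun v := toCoeff n (v : VField d)
  map_add' v w := (HSigma.summable (galerkin_mem_HSigma v.2 n)).toCoeff_add
    (HSigma.summable (galerkin_mem_HSigma w.2 n))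
  map_smul' c v := (HSigma.summable (galerkin_mem_HSigma v.2 n)).toCoeff_smul c

theorem galerkinCoeff_injective {n : ℝ} (hn : 0 < n) :
    Function.Injective (galerkinCoeff d n N) := by
  intro v w h
  have hv := galerkin_mem_HSigma v.2 n
  have hw := galerkin_mem_HSigma w.2 n
  refine Subtype.ext (HSigma.eq_of_norm_sub_eq_zero hn hv hw ?_)
  rw [← norm_toCoeff, (HSigma.summable hv).toCoeff_sub (HSigma.summable hw)]
  have h' : toCoeff n (v : VField d) = toCoeff n (w : VField d) := h
  rw [h', sub_self, norm_zero]

theorem laplacian_zero : laplacian (0 : VField d) = 0 := by funext k; simp [laplacian]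

theorem truncate_zero (N : ℕ) : truncate N (0 : VField d) = 0 := by funext k; simp [truncate]

theorem eulerBilinear_zero {n : ℝ} (hn : (d : ℝ) / 2 + 1 < n) :
    eulerBilinear (0 : VField d) 0 = 0 := by
  simpa using eulerBilinear_sub_left hn (v := (0 : VField d)) (v' := 0) (w := 0) HSigma.zero
    HSigma.zero HSigma.zero

/-! ### The Galerkin vector field and its solutions -/

section field

variable {n K G ν M : ℝ} {v y : VField d}

theorem galerkin_field_mem (hn : (d : ℝ) / 2 + 1 < n) (hv : v ∈ galerkinSubmodule d N) :
    ν • laplacian v + eulerBilinear v v ∈ HSigma d n := by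
  have hd : (0 : ℝ) ≤ d := Nat.cast_nonneg d
  exact HSigma.add (HSigma.smul ν (HSigma.laplacian (by linarith) (galerkin_mem_HSigma hv _)))
    (eulerBilinear_mem hn le_rfl (galerkin_mem_HSigma hv _) (galerkin_mem_HSigma hv _))

/-- The Laplacian costs two powers of `N`; each of the two halves of `P(v,v) - P(y,y)` costs one. -/
theorem galerkin_field_lipschitz (hn : (d : ℝ) / 2 + 1 < n) (hK : IsBasicConstant d n K)
    (hν : 0 ≤ ν) (hv : v ∈ galerkinSubmodule d N) (hy : y ∈ galerkinSubmodule d N)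
    (hvM : sobolevNorm n v ≤ M) (hyM : sobolevNorm n y ≤ M) :
    sobolevNorm n (truncate N (ν • laplacian v + eulerBilinear v v) -
      truncate N (ν • laplacian y + eulerBilinear y y)) ≤
      (ν * N ^ 2 + 2 * K * M * N) * sobolevNorm n (v - y) := by
  have hd : (0 : ℝ) ≤ d := Nat.cast_nonneg d
  have hn0 : 0 < n := by linarith
  have hx : v - y ∈ galerkinSubmodule d N := sub_mem hv hy
  set x := v - y with hxe
  rw [← truncate_sub]
  refine (sobolevNorm_truncate_le ((HSigma.summable (galerkin_field_mem hn hv)).sub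
    (HSigma.summable (galerkin_field_mem hn hy))) N).trans ?_
  have h2 : ν • laplacian v + eulerBilinear v v - (ν • laplacian y + eulerBilinear y y) =
      ν • laplacian x + (eulerBilinear v x + eulerBilinear x y) := by
    rw [hxe, ← eulerBilinear_self_sub hn (galerkin_mem_HSigma hv n) (galerkin_mem_HSigma hy n),
      laplacian_sub, smul_sub]
    abel
  have gz := galerkin_mem_HSigma hv
  have gw := galerkin_mem_HSigma hy
  have gx := galerkin_mem_HSigma hx
  have s1 := HSigma.summable (HSigma.laplacian hn0 (gx (n + 2)))
  have s2 := HSigma.summable (eulerBilinear_mem hn le_rfl (gz n) (gx (n + 1)))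
  have s3 := HSigma.summable (eulerBilinear_mem hn le_rfl (gx n) (gw (n + 1)))
  have hpow1 : ∀ v ∈ galerkinSubmodule d N, sobolevNorm (n + 1) v ≤ N * sobolevNorm n v :=
    fun v hv => by simpa using sobolevNorm_add_le_pow hv hn0 1
  have hpow2 : sobolevNorm (n + 2) x ≤ (N : ℝ) ^ 2 * sobolevNorm n x := by
    simpa using sobolevNorm_add_le_pow hx hn0 2
  rw [h2]
  refine ((s1.smul ν).norm_add_le (s2.add s3)).trans ?_
  have e1 : sobolevNorm n (ν • laplacian x) ≤ ν * ((N : ℝ) ^ 2 * sobolevNorm n x) := by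
    rw [sobolevNorm_smul, abs_of_nonneg hν, sobolevNorm_laplacian hn0]
    exact mul_le_mul_of_nonneg_left hpow2 hν
  have hKp := hK.1.le
  have x0 := sobolevNorm_nonneg n x
  have e2 : sobolevNorm n (eulerBilinear v x) ≤ K * M * (N * sobolevNorm n x) := by
    refine (hK.2 _ (gz n) _ (gx (n + 1))).trans ?_
    have := hpow1 x hx
    have := sobolevNorm_nonneg (n + 1) x
    have := (sobolevNorm_nonneg n v).trans hvM
    gcongr
  have e3 : sobolevNorm n (eulerBilinear x y) ≤ K * sobolevNorm n x * (N * M) := by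
    refine (hK.2 _ (gx n) _ (gw (n + 1))).trans ?_
    have := (hpow1 y hy).trans (mul_le_mul_of_nonneg_left hyM (Nat.cast_nonneg N))
    gcongr
  have e4 := s2.norm_add_le s3
  have e5 : (ν * N ^ 2 + 2 * K * M * N) * sobolevNorm n x = ν * ((N : ℝ) ^ 2 * sobolevNorm n x) +
      (K * M * (N * sobolevNorm n x) + K * sobolevNorm n x * (N * M)) := by ring
  linarith

theorem galerkin_field_energy (hn : (d : ℝ) / 2 + 1 < n) (hG : IsKatoConstant d n G)
    (hν : 0 ≤ ν) (hv : v ∈ galerkinSubmodule d N) :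
    sobolevInner n (truncate N (ν • laplacian v + eulerBilinear v v)) v ≤
      G * sobolevNorm n v ^ 3 := by
  have hd : (0 : ℝ) ≤ d := Nat.cast_nonneg d
  have hn0 : 0 < n := by linarith
  rw [sobolevInner_truncate hv.2]
  have gz := galerkin_mem_HSigma hv
  have s0 := HSigma.summable (gz n)
  have s1 := HSigma.summable (HSigma.laplacian hn0 (gz (n + 2)))
  have s2 := HSigma.summable (eulerBilinear_mem hn le_rfl (gz n) (gz (n + 1)))
  rw [(s1.smul ν).sobolevInner_add_left s2 s0]
  have e1 : sobolevInner n (ν • laplacian v) v ≤ 0 := by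
    rw [← (s1.smul ν).re_inner_toCoeff s0, s1.toCoeff_smul, real_inner_smul_left,
      s1.re_inner_toCoeff s0]
    refine mul_nonpos_of_nonneg_of_nonpos hν ((sobolevInner_laplacian_le hn0 (gz (n + 2))).trans ?_)
    exact neg_nonpos.2 (sq_nonneg _)
  have e2 := (le_abs_self _).trans (hG.2 v (gz n) v (gz (n + 1)))
  have e3 : G * sobolevNorm n v * sobolevNorm n v ^ 2 = G * sobolevNorm n v ^ 3 := by ring
  linarith

end field

/-- `u` solves the Galerkin equations with modes `|k| ≤ N` on `[0, T]`, and `‖u‖_n ≤ M`. -/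
structure IsGalerkin (n ν : ℝ) (f : ℝ → VField d) (u₀ : VField d) (T M : ℝ) (N : ℕ)
    (u : ℝ → VField d) : Prop where
  mem : ∀ t ∈ Set.Icc 0 T, u t ∈ galerkinSubmodule d N
  norm_le : ∀ t ∈ Set.Icc 0 T, sobolevNorm n (u t) ≤ M
  init : u 0 = truncate N u₀
  deriv : ∀ t ∈ Set.Icc 0 T, ∀ k, HasDerivWithinAt (fun s => u s k)
    (truncate N (ν • laplacian (u t) + eulerBilinear (u t) (u t) + f t) k) (Set.Icc 0 T) t

/-- The equations are posed on the image of `galerkinCoeff`, a finite dimensional subspace whose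
norm is the Sobolev norm of order `n`, where Kato's inequality is the required energy estimate. The
interval and the radius `M` do not depend on `N`. -/
theorem exists_isGalerkin {n K G ν : ℝ} (hn : (d : ℝ) / 2 + 1 < n)
    (hK : IsBasicConstant d n K) (hG : IsKatoConstant d n G) (hν : 0 ≤ ν)
    {f : ℝ → VField d} (hf : IsContinuousInto n ⊤ f) {u₀ : VField d} (hu₀ : u₀ ∈ HSigma d n)
    {M Φ T : ℝ} (hM : 0 < M) (hT : 0 ≤ T) (hΦ : ∀ t ∈ Set.Icc 0 T, sobolevNorm n (f t) ≤ Φ)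
    (hMT : sobolevNorm n u₀ + (G * M ^ 2 + Φ) * T ≤ M) (N : ℕ) :
    ∃ u, IsGalerkin n ν f u₀ T M N u := by
  have hd : (0 : ℝ) ≤ d := Nat.cast_nonneg d
  have hn0 : 0 < n := by linarith
  have hftop : ∀ t : ℝ, 0 ≤ t → t ∈ timeDomain ⊤ := fun t ht => ⟨ht, EReal.coe_lt_top t⟩
  set J := galerkinCoeff d n N with hJ
  set e := LinearEquiv.ofInjective J (galerkinCoeff_injective hn0) with he
  have hcoe : ∀ v : galerkinSubmodule d N, ((e v : J.range) : CoeffSpace d) = toCoeff n (v : VField d) :=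
    fun v => rfl
  have hnorm : ∀ v : galerkinSubmodule d N, ‖e v‖ = sobolevNorm n (v : VField d) := fun v => by
    rw [← norm_toCoeff, ← hcoe]; rfl
  have hnorm' : ∀ z : J.range, ‖z‖ = sobolevNorm n ((e.symm z : galerkinSubmodule d N) : VField d) :=
    fun z => by rw [← hnorm, e.apply_symm_apply]
  set A : J.range → J.range := fun z =>
    e ⟨truncate N (ν • laplacian (e.symm z : VField d) + eulerBilinear (e.symm z : VField d) (e.symm z)),
      truncate_mem (mem_HSigma_iff.1 (galerkin_field_mem hn (e.symm z).2)).1⟩ with hA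
  have hgmem : ∀ t, 0 ≤ t → f t ∈ HSigma d n := fun t ht => hf.1 t (hftop t ht)
  -- Using `max t 0` makes the truncated force well defined at all times; membership of `f t` in the
  -- Sobolev space is known only for `t ≥ 0`.
  set g : ℝ → J.range := fun t =>
    e ⟨truncate N (f (max t 0)), truncate_mem (mem_HSigma_iff.1 (hgmem _ (le_max_right _ _))).1⟩ with hg
  have hcomplete : CompleteSpace J.range := FiniteDimensional.complete ℝ _
  have hsub : ∀ z w : J.range, ((e.symm (z - w) : galerkinSubmodule d N) : VField d) =
      (e.symm z : VField d) - (e.symm w : VField d) := fun z w => by rw [map_sub]; rfl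
  have hinner : ∀ (z : J.range) (v : galerkinSubmodule d N), inner ℝ z (e v) =
      sobolevInner n (v : VField d) (e.symm z : VField d) := fun z v => by
    have h1 : (z : CoeffSpace d) = toCoeff n (e.symm z : VField d) := by
      rw [← hcoe, e.apply_symm_apply]
    have s1 := HSigma.summable (galerkin_mem_HSigma v.2 n)
    have s2 := HSigma.summable (galerkin_mem_HSigma (e.symm z).2 n)
    rw [← s1.re_inner_toCoeff s2, real_inner_comm, ← h1, ← hcoe]
    rfl
  have hsol := exists_solution_of_energy (E := J.range) (A := A) (g := g) (M := M)
    (C := ν * N ^ 2 + 2 * K * M * N) (G := G) (Φ := Φ) (T := T)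
    (x₀ := e ⟨truncate N u₀, truncate_mem (mem_HSigma_iff.1 hu₀).1⟩) hM
    (by have := hK.1; positivity) hG.1.le hT ?_ ?_ ?_ ?_ ?_ ?_
  · obtain ⟨α, hα0, hα⟩ := hsol
    refine ⟨fun t => (e.symm (α t) : VField d), fun t _ => (e.symm (α t)).2, fun t ht => ?_, ?_,
      fun t ht k => ?_⟩
    · rw [← hnorm']; exact (hα t ht).1
    · rw [hα0, e.symm_apply_apply]
    -- Reading off one Fourier coefficient is linear, hence continuous in finite dimension, and so
    -- commutes with the time derivative.
    · let ev : J.range →ₗ[ℝ] EuclideanSpace ℂ (Fin d) :=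
        { toFun := fun z => (e.symm z : VField d) k
          map_add' := fun z w => by rw [map_add]; rfl
          map_smul' := fun c z => by rw [map_smul]; rfl }
      have h1 := (LinearMap.toContinuousLinearMap ev).hasFDerivAt.comp_hasDerivWithinAt t (hα t ht).2
      refine h1.congr_deriv ?_
      change (e.symm (A (α t) + g t) : VField d) k = _
      rw [map_add, hA, hg, e.symm_apply_apply, e.symm_apply_apply, truncate_add N _ (f t)]
      simp only [max_eq_left ht.1]
      rfl
  · intro z w hz hw
    rw [hnorm'] at hz hw
    have h1 := galerkin_field_lipschitz hn hK hν (e.symm z).2 (e.symm w).2 hz hw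
    rw [hA, ← map_sub, hnorm, hnorm' (z - w), hsub]
    exact h1
  · have h0 : ((e.symm 0 : galerkinSubmodule d N) : VField d) = 0 := by rw [map_zero]; rfl
    refine norm_eq_zero.1 ?_
    rw [hA, hnorm]
    simp only [h0, eulerBilinear_zero hn, laplacian_zero, smul_zero, add_zero, truncate_zero]
    exact sobolevNorm_zero n
  · intro z _
    rw [hA, hinner, hnorm']
    exact galerkin_field_energy hn hG hν (e.symm z).2
  · intro t ht
    refine tendsto_iff_norm_sub_tendsto_zero.2 ?_
    have h1 : Tendsto (fun s => sobolevNorm n (f s - f t)) (𝓝[Set.Icc 0 T] t) (𝓝 0) :=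
      (hf.2 t (hftop t ht.1)).mono_left (nhdsWithin_mono _ fun s hs => hftop s hs.1)
    refine squeeze_zero' (Eventually.of_forall fun _ => norm_nonneg _) ?_ h1
    filter_upwards [self_mem_nhdsWithin] with s hs
    rw [hg, ← map_sub, hnorm]
    have h2 : sobolevNorm n (truncate N (f s - f t)) ≤ sobolevNorm n (f s - f t) :=
      sobolevNorm_truncate_le (HSigma.summable (HSigma.sub (hgmem s hs.1) (hgmem t ht.1))) N
    rw [truncate_sub] at h2
    simpa only [max_eq_left ht.1, max_eq_left hs.1] using! h2
  · intro t ht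
    rw [hg, hnorm]
    simp only [max_eq_left ht.1]
    exact (sobolevNorm_truncate_le (HSigma.summable (hgmem t ht.1)) N).trans (hΦ t ht)
  · rw [hnorm]
    have := sobolevNorm_truncate_le (HSigma.summable hu₀) N
    simp only
    linarith

end galerkin

/-! ### A Grönwall inequality for energies -/

/-- Formally `(√Y)' ≤ a √Y + g`. Adding `η²` under the root avoids its singularity at 0; then
`e^{-at} √(Y + η²) - ∫ g` is nonincreasing, and `η` tends to 0. -/
theorem sqrt_le_of_deriv_le {Y Y' g : ℝ → ℝ} {a T : ℝ} (ha : 0 ≤ a)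
    (hY : ∀ t ∈ Set.Icc 0 T, HasDerivWithinAt Y (Y' t) (Set.Icc 0 T) t)
    (hY0 : ∀ t ∈ Set.Icc 0 T, 0 ≤ Y t) (hg : ContinuousOn g (Set.Icc 0 T))
    (hg0 : ∀ t ∈ Set.Icc 0 T, 0 ≤ g t)
    (hle : ∀ t ∈ Set.Icc 0 T, Y' t ≤ 2 * a * Y t + 2 * g t * √(Y t)) :
    ∀ t ∈ Set.Icc 0 T, √(Y t) ≤ Real.exp (a * t) * (√(Y 0) + ∫ s in (0)..t, g s) := by
  intro t ht
  have hT : 0 ≤ T := ht.1.trans ht.2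
  have hgint : ∀ s ∈ Set.Icc 0 T, IntervalIntegrable g volume 0 s := fun s hs =>
    (hg.mono (by rw [Set.uIcc_of_le hs.1]; exact Set.Icc_subset_Icc_right hs.2)).intervalIntegrable
  have key : ∀ η > 0, √(Y t + η ^ 2) ≤
      Real.exp (a * t) * (√(Y 0 + η ^ 2) + ∫ s in (0)..t, g s) := by
    intro η hη
    set f : ℝ → ℝ := fun s => √(Y s + η ^ 2) with hf
    have hpos : ∀ s ∈ Set.Icc 0 T, 0 < Y s + η ^ 2 := fun s hs => by
      have := hY0 s hs; positivity
    set h : ℝ → ℝ := fun s => Real.exp (-a * s) * f s - ∫ x in (0)..s, g x with hh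
    have hcont : ContinuousOn h (Set.Icc 0 T) := by
      refine ContinuousOn.sub (ContinuousOn.mul (by fun_prop) ?_) ?_
      · exact ContinuousOn.sqrt (fun s hs => ((hY s hs).continuousWithinAt).add
          continuousWithinAt_const)
      · have := intervalIntegral.continuousOn_primitive_interval (μ := volume) (a := 0) (b := T)
          (f := g) (by rw [Set.uIcc_of_le hT]; exact hg.integrableOn_Icc)
        rwa [Set.uIcc_of_le hT] at this
    have hderiv : ∀ s ∈ Set.Ioo 0 T, HasDerivAt h
        (Real.exp (-a * s) * -a * f s + Real.exp (-a * s) * (Y' s / (2 * f s)) - g s) s := by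
      intro s hs
      have hs' : s ∈ Set.Icc 0 T := ⟨hs.1.le, hs.2.le⟩
      have h1 : HasDerivAt Y (Y' s) s := (hY s hs').hasDerivAt (Icc_mem_nhds hs.1 hs.2)
      have h2 : HasDerivAt f (Y' s / (2 * f s)) s :=
        (h1.add_const (η ^ 2)).sqrt (hpos s hs').ne'
      have h3 : HasDerivAt (fun s => Real.exp (-a * s)) (Real.exp (-a * s) * -a) s := by
        have : HasDerivAt (fun s : ℝ => -a * s) (-a) s := by
          simpa using (hasDerivAt_id s).const_mul (-a)
        exact this.exp
      have hga : ∀ x ∈ Set.Ioo 0 T, ContinuousAt g x := fun x hx =>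
        (hg x ⟨hx.1.le, hx.2.le⟩).continuousAt (Icc_mem_nhds hx.1 hx.2)
      have h4 : HasDerivAt (fun s => ∫ x in (0)..s, g x) (g s) s :=
        intervalIntegral.integral_hasDerivAt_right (hgint s hs')
          (ContinuousAt.stronglyMeasurableAtFilter isOpen_Ioo hga s hs) (hga s hs)
      exact (h3.mul h2).sub h4
    have hanti : AntitoneOn h (Set.Icc 0 T) := by
      refine antitoneOn_of_deriv_nonpos (convex_Icc 0 T) hcont ?_ ?_
      · rw [interior_Icc]
        exact fun s hs => (hderiv s hs).differentiableAt.differentiableWithinAt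
      · rw [interior_Icc]
        intro s hs
        have hs' : s ∈ Set.Icc 0 T := ⟨hs.1.le, hs.2.le⟩
        rw [(hderiv s hs).deriv]
        have hfs : 0 < f s := Real.sqrt_pos.2 (hpos s hs')
        have hfsq : f s ^ 2 = Y s + η ^ 2 := Real.sq_sqrt (hpos s hs').le
        have hsq : √(Y s) ≤ f s := Real.sqrt_le_sqrt (by nlinarith)
        have e1 : Y' s / (2 * f s) ≤ a * f s + g s := by
          rw [div_le_iff₀ (by positivity)]
          have := hle s hs'
          have h6 := mul_le_mul_of_nonneg_left hsq (hg0 s hs')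
          nlinarith [mul_nonneg ha (sq_nonneg η)]
        -- The decaying factor in front of `g` is discarded, so the integral in the result is
        -- unweighted.
        have e2 : Real.exp (-a * s) ≤ 1 :=
          Real.exp_le_one_iff.2 (by nlinarith [mul_nonneg ha hs.1.le])
        have e3 := Real.exp_pos (-a * s)
        have e4 := mul_le_mul_of_nonneg_left e1 e3.le
        have e5 := mul_le_mul_of_nonneg_right e2 (hg0 s hs')
        nlinarith
    have h5 := hanti (⟨le_rfl, hT⟩ : (0 : ℝ) ∈ Set.Icc 0 T) ht ht.1
    simp only [hh, mul_zero, Real.exp_zero, one_mul, intervalIntegral.integral_same,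
      sub_zero] at h5
    have h6 : Real.exp (a * t) * Real.exp (-a * t) = 1 := by
      rw [← Real.exp_add]; simp
    calc √(Y t + η ^ 2) = Real.exp (a * t) * (Real.exp (-a * t) * f t) := by
          rw [← mul_assoc, h6, one_mul]
      _ ≤ _ := mul_le_mul_of_nonneg_left (by linarith) (Real.exp_pos _).le
  refine le_of_forall_pos_le_add fun e he => ?_
  have hE := Real.exp_pos (a * t)
  have h1 := key (e / Real.exp (a * t)) (div_pos he hE)
  have h2 : √(Y t) ≤ √(Y t + (e / Real.exp (a * t)) ^ 2) :=
    Real.sqrt_le_sqrt (le_add_of_nonneg_right (sq_nonneg _))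
  have h3 : √(Y 0 + (e / Real.exp (a * t)) ^ 2) ≤ √(Y 0) + e / Real.exp (a * t) := by
    have e1 := (div_pos he hE).le
    have e2 := Real.sqrt_nonneg (Y 0)
    refine Real.sqrt_le_iff.2 ⟨by positivity, ?_⟩
    nlinarith [Real.sq_sqrt (hY0 0 ⟨le_rfl, hT⟩), mul_nonneg e2 e1]
  have h4 := mul_le_mul_of_nonneg_left h3 hE.le
  have h5 : Real.exp (a * t) * (e / Real.exp (a * t)) = e := by field_simp
  nlinarith

/-! ### Weighted energies -/

theorem hasDerivWithinAt_sum_mul_norm_sq {S : Finset (Fin d → ℤ)} {c : (Fin d → ℤ) → ℝ}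
    {u : ℝ → VField d} {v : VField d} {s : Set ℝ} {t : ℝ}
    (h : ∀ k ∈ S, HasDerivWithinAt (fun s => u s k) (v k) s t) :
    HasDerivWithinAt (fun s => ∑ k ∈ S, c k * ‖u s k‖ ^ 2)
      (2 * ∑ k ∈ S, c k * (inner ℂ (v k) (u t k)).re) s t := by
  have h1 := HasDerivWithinAt.fun_sum (u := S) fun k hk => ((h k hk).norm_sq).const_mul (c k)
  refine h1.congr_deriv ?_
  rw [Finset.mul_sum]
  refine Finset.sum_congr rfl fun k _ => ?_
  rw [real_inner_comm, real_inner_eq_re]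
  ring

theorem sum_mul_re_inner_le {S : Finset (Fin d → ℤ)} {ω : (Fin d → ℤ) → ℝ} (v w : VField d) :
    ∑ k ∈ S, ω k ^ 2 * (inner ℂ (v k) (w k)).re ≤
      √(∑ k ∈ S, ω k ^ 2 * ‖v k‖ ^ 2) * √(∑ k ∈ S, ω k ^ 2 * ‖w k‖ ^ 2) := by
  calc ∑ k ∈ S, ω k ^ 2 * (inner ℂ (v k) (w k)).re
      ≤ ∑ k ∈ S, (|ω k| * ‖v k‖) * (|ω k| * ‖w k‖) := by
        refine Finset.sum_le_sum fun k _ => ?_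
        have h1 : (inner ℂ (v k) (w k)).re ≤ ‖v k‖ * ‖w k‖ :=
          (Complex.re_le_norm _).trans (norm_inner_le_norm _ _)
        calc ω k ^ 2 * (inner ℂ (v k) (w k)).re ≤ ω k ^ 2 * (‖v k‖ * ‖w k‖) :=
              mul_le_mul_of_nonneg_left h1 (sq_nonneg _)
          _ = _ := by rw [← sq_abs]; ring
    _ ≤ √(∑ k ∈ S, (|ω k| * ‖v k‖) ^ 2) * √(∑ k ∈ S, (|ω k| * ‖w k‖) ^ 2) :=
        Real.sum_mul_le_sqrt_mul_sqrt S _ _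
    _ = _ := by simp only [mul_pow, sq_abs]

theorem re_inner_laplacian (v : VField d) (k : Fin d → ℤ) :
    (inner ℂ (laplacian v k) (v k)).re = -(freqNorm k ^ 2 * ‖v k‖ ^ 2) := by
  have h3 := real_inner_smul_left (v k) (v k) (-(freqNorm k ^ 2))
  rw [real_inner_self_eq_norm_sq, real_inner_eq_re, neg_mul] at h3
  exact h3

theorem IsContinuousInto.continuousOn_apply {m : ℝ} (hm : 0 < m) {T : EReal} {u : ℝ → VField d}
    (h : IsContinuousInto m T u) (k : Fin d → ℤ) :
    ContinuousOn (fun t => u t k) (timeDomain T) := by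
  intro t ht
  refine tendsto_iff_norm_sub_tendsto_zero.2 ?_
  refine squeeze_zero' (Eventually.of_forall fun _ => norm_nonneg _) ?_ (h.2 t ht)
  filter_upwards [self_mem_nhdsWithin] with s hs
  exact HSigma.norm_apply_le hm (HSigma.sub (h.1 s hs) (h.1 t ht)) k

theorem continuousOn_sqrt_sum {S : Finset (Fin d → ℤ)} {c : (Fin d → ℤ) → ℝ} {f : ℝ → VField d}
    {s : Set ℝ} (hf : ∀ k, ContinuousOn (fun t => f t k) s) :
    ContinuousOn (fun t => √(∑ k ∈ S, c k * ‖f t k‖ ^ 2)) s :=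
  (continuousOn_finsetSum S fun k _ => continuousOn_const.mul ((hf k).norm.pow 2)).sqrt

/-- The growth rate in the energy estimates of order `n + 2`. -/
def growthConst (d : ℕ) (n : ℝ) : ℝ :=
  2 * modeConst d * weightConst (n + 2) * embedConst d n

section energy

variable {n ν T M : ℝ} {f : ℝ → VField d} {u₀ : VField d} {N : ℕ} {u : ℝ → VField d}

theorem growthConst_nonneg (hn : (d : ℝ) / 2 + 1 < n) : 0 ≤ growthConst d n := by
  have hd : (0 : ℝ) ≤ d := Nat.cast_nonneg d
  have h1 := (modeConst_pos d).le
  have h2 := weightConst_nonneg (m := n + 2) (by linarith)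
  have h3 := embedConst_nonneg d n
  unfold growthConst
  positivity

/-- The weighted energy loses by viscosity, gains at rate `growthConst d n * M` by the commutator
estimate, and is driven by the weighted force. The rate depends neither on `L` nor on `N`, and
involves the solution only through its bound of order `n`. -/
theorem IsGalerkin.tail_le (hu : IsGalerkin n ν f u₀ T M N u) (hn : (d : ℝ) / 2 + 1 < n)
    (hν : 0 ≤ ν) (hM : 0 ≤ M) (hf : IsContinuousInto n ⊤ f) {L : ℝ} (hL : 0 < L) :
    ∀ t ∈ Set.Icc 0 T, √(∑ k ∈ modes d N, tailWeight (n + 2) L k ^ 2 * ‖u t k‖ ^ 2) ≤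
      Real.exp (growthConst d n * M * t) *
        (√(∑ k ∈ modes d N, tailWeight (n + 2) L k ^ 2 * ‖u₀ k‖ ^ 2) +
          ∫ s in (0)..t, √(∑ k ∈ modes d N, tailWeight (n + 2) L k ^ 2 * ‖f s k‖ ^ 2)) := by
  have hd : (0 : ℝ) ≤ d := Nat.cast_nonneg d
  have hn0 : 0 < n := by linarith
  set ω : (Fin d → ℤ) → ℝ := tailWeight (n + 2) L with hω
  have hinit : ∑ k ∈ modes d N, ω k ^ 2 * ‖u₀ k‖ ^ 2 = ∑ k ∈ modes d N, ω k ^ 2 * ‖u 0 k‖ ^ 2 :=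
    Finset.sum_congr rfl fun k hk => by rw [hu.init, truncate_apply_of_mem hk]
  rw [hinit]
  have hfc : ∀ k, ContinuousOn (fun t => f t k) (Set.Icc 0 T) := fun k =>
    (hf.continuousOn_apply hn0 k).mono fun t ht => ⟨ht.1, EReal.coe_lt_top t⟩
  refine sqrt_le_of_deriv_le (Y := fun t => ∑ k ∈ modes d N, ω k ^ 2 * ‖u t k‖ ^ 2)
    (g := fun s => √(∑ k ∈ modes d N, ω k ^ 2 * ‖f s k‖ ^ 2))
    (mul_nonneg (growthConst_nonneg hn) hM)
    (fun t ht => hasDerivWithinAt_sum_mul_norm_sq fun k _ => hu.deriv t ht k)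
    (fun t _ => Finset.sum_nonneg fun k _ => by positivity) (continuousOn_sqrt_sum hfc)
    (fun t _ => Real.sqrt_nonneg _) fun t ht => ?_
  have hmem := hu.mem t ht
  set Y := ∑ k ∈ modes d N, ω k ^ 2 * ‖u t k‖ ^ 2 with hY
  have hY0 : 0 ≤ Y := Finset.sum_nonneg fun k _ => by positivity
  have hsplit : ∑ k ∈ modes d N, ω k ^ 2 * (inner ℂ (truncate N (ν • laplacian (u t) +
      eulerBilinear (u t) (u t) + f t) k) (u t k)).re =
      -∑ k ∈ modes d N, ω k ^ 2 * (ν * (freqNorm k ^ 2 * ‖u t k‖ ^ 2)) +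
      ∑ k ∈ modes d N, ω k ^ 2 * (inner ℂ (eulerBilinear (u t) (u t) k) (u t k)).re +
      ∑ k ∈ modes d N, ω k ^ 2 * (inner ℂ (f t k) (u t k)).re := by
    rw [← Finset.sum_neg_distrib, ← Finset.sum_add_distrib, ← Finset.sum_add_distrib]
    refine Finset.sum_congr rfl fun k hk => ?_
    have h1 : (inner ℂ (ν • laplacian (u t) k) (u t k)).re =
        ν * -(freqNorm k ^ 2 * ‖u t k‖ ^ 2) := by
      rw [← re_inner_laplacian, ← real_inner_eq_re, ← real_inner_eq_re, real_inner_smul_left]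
    rw [truncate_apply_of_mem hk, Pi.add_apply, Pi.add_apply, inner_add_left, inner_add_left,
      Complex.add_re, Complex.add_re, Pi.smul_apply, h1]
    ring
  have e1 : 0 ≤ ∑ k ∈ modes d N, ω k ^ 2 * (ν * (freqNorm k ^ 2 * ‖u t k‖ ^ 2)) :=
    Finset.sum_nonneg fun k _ => by positivity
  have e2 := (le_abs_self _).trans (abs_sum_inner_eulerBilinear_le hn hmem.1 hmem.2
    (fun k => tailWeight_nonneg (m := n + 2) hL k) (weightConst_nonneg (m := n + 2) (by linarith))
    (tailWeight_sub_le (by linarith) hL))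
  have e3 := sum_mul_re_inner_le (S := modes d N) (ω := ω) (f t) (u t)
  have e4 : 2 * modeConst d * weightConst (n + 2) * embedConst d n * sobolevNorm n (u t) * Y ≤
      growthConst d n * M * Y :=
    mul_le_mul_of_nonneg_right (mul_le_mul_of_nonneg_left (hu.norm_le t ht)
      (growthConst_nonneg hn)) hY0
  rw [hsplit]
  simp only [hω] at e2 e3 ⊢
  simp only [hY, hω] at e4
  linarith

end energy

/-! ### Uniform bounds for the high frequencies -/

theorem modes_mono : Monotone (modes d) := fun _ _ h _ hk =>
  mem_modes.2 ((mem_modes.1 hk).trans (by exact_mod_cast h))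

theorem tendsto_modes_atTop : Tendsto (modes d) atTop atTop :=
  tendsto_atTop_finset_of_monotone modes_mono fun k =>
    ⟨⌈freqNorm k⌉₊, mem_modes.2 (Nat.le_ceil _)⟩

/-- The weighted norm which measures the high frequencies of a field. -/
def tailNorm (m L : ℝ) (v : VField d) : ℝ := √(∑' k, tailWeight m L k ^ 2 * ‖v k‖ ^ 2)

section tailNorm

variable {m L : ℝ} {v : VField d}

theorem tailWeight_sq_mul_le (hL : 0 < L) (v : VField d) (k : Fin d → ℤ) :
    tailWeight m L k ^ 2 * ‖v k‖ ^ 2 ≤ freqNorm k ^ (2 * m) * ‖v k‖ ^ 2 := by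
  rw [freqNorm_rpow_two_mul]
  exact mul_le_mul_of_nonneg_right (pow_le_pow_left₀ (tailWeight_nonneg hL k) (tailWeight_le k) 2)
    (sq_nonneg _)

theorem summable_tail (hL : 0 < L) (hv : SobolevSummable m v) :
    Summable fun k => tailWeight m L k ^ 2 * ‖v k‖ ^ 2 :=
  Summable.of_nonneg_of_le (fun _ => mul_nonneg (sq_nonneg _) (sq_nonneg _))
    (tailWeight_sq_mul_le hL v) hv

theorem tailNorm_nonneg (m L : ℝ) (v : VField d) : 0 ≤ tailNorm m L v := Real.sqrt_nonneg _

theorem tailNorm_le (hL : 0 < L) (hv : SobolevSummable m v) : tailNorm m L v ≤ sobolevNorm m v := by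
  rw [tailNorm, sobolevNorm, sobolevInner_self]
  exact Real.sqrt_le_sqrt ((summable_tail hL hv).tsum_le_tsum (tailWeight_sq_mul_le hL v) hv)

theorem sqrt_sum_le_tailNorm (hL : 0 < L) (hv : SobolevSummable m v) (S : Finset (Fin d → ℤ)) :
    √(∑ k ∈ S, tailWeight m L k ^ 2 * ‖v k‖ ^ 2) ≤ tailNorm m L v :=
  Real.sqrt_le_sqrt ((summable_tail hL hv).sum_le_tsum S fun _ _ =>
    mul_nonneg (sq_nonneg _) (sq_nonneg _))

theorem tendsto_sqrt_sum_tailNorm (hL : 0 < L) (hv : SobolevSummable m v) :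
    Tendsto (fun N => √(∑ k ∈ modes d N, tailWeight m L k ^ 2 * ‖v k‖ ^ 2)) atTop
      (𝓝 (tailNorm m L v)) :=
  ((summable_tail hL hv).hasSum.comp tendsto_modes_atTop).sqrt

/-- Dominated convergence: each weight tends to 0, below the majorant `|k|^{2m} ‖v_k‖²`. -/
theorem tendsto_tailNorm (hv : SobolevSummable m v) :
    Tendsto (fun L : ℕ => tailNorm m ((L : ℝ) + 1) v) atTop (𝓝 0) := by
  have h : Tendsto (fun L : ℕ => ∑' k, tailWeight m ((L : ℝ) + 1) k ^ 2 * ‖v k‖ ^ 2) atTop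
      (𝓝 (∑' _ : Fin d → ℤ, (0 : ℝ))) := by
    refine tendsto_tsum_of_dominated_convergence hv (fun k => ?_) (Eventually.of_forall fun L k => ?_)
    · simpa using ((tendsto_tailWeight m k).pow 2).mul_const (‖v k‖ ^ 2)
    · rw [Real.norm_of_nonneg (by positivity)]
      exact tailWeight_sq_mul_le (by positivity) v k
  simpa [tailNorm] using h.sqrt

end tailNorm

section locallyIntegrable

variable {n m T : ℝ} {f : ℝ → VField d}

theorem IsLocallyIntegrableInto.ae_mem (h : IsLocallyIntegrableInto m f) (T : ℝ) :
    ∀ᵐ t ∂(volume.restrict (Set.Ioc 0 T)), f t ∈ HSigma d m :=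
  ae_restrict_of_ae_restrict_of_subset (fun _ ht => ht.1.le) h.1

theorem IsLocallyIntegrableInto.intervalIntegrable (h : IsLocallyIntegrableInto m f) (hT : 0 ≤ T) :
    IntervalIntegrable (fun t => sobolevNorm m (f t)) volume 0 T := by
  rw [intervalIntegrable_iff_integrableOn_Icc_of_le hT]
  exact h.2.integrableOn_compact_subset (fun _ ht => ht.1) isCompact_Icc

/-- Continuity of `f` in order `n` gives continuity of each coefficient, so the tail norm is an
almost everywhere limit of continuous finite sums. -/
theorem aestronglyMeasurable_tailNorm (hn : 0 < n) (hf : IsContinuousInto n ⊤ f)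
    (h : IsLocallyIntegrableInto m f) {L : ℝ} (hL : 0 < L) :
    AEStronglyMeasurable (fun t => tailNorm m L (f t)) (volume.restrict (Set.Ioc 0 T)) := by
  refine aestronglyMeasurable_of_tendsto_ae atTop
    (f := fun N t => √(∑ k ∈ modes d N, tailWeight m L k ^ 2 * ‖f t k‖ ^ 2)) (fun N => ?_) ?_
  · refine ContinuousOn.aestronglyMeasurable (continuousOn_sqrt_sum fun k => ?_) measurableSet_Ioc
    exact (hf.continuousOn_apply hn k).mono fun t ht => ⟨ht.1.le, EReal.coe_lt_top t⟩
  · filter_upwards [h.ae_mem T] with t ht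
    exact tendsto_sqrt_sum_tailNorm hL (HSigma.summable ht)

theorem intervalIntegrable_tailNorm (hn : 0 < n) (hf : IsContinuousInto n ⊤ f)
    (h : IsLocallyIntegrableInto m f) (hT : 0 ≤ T) {L : ℝ} (hL : 0 < L) :
    IntervalIntegrable (fun t => tailNorm m L (f t)) volume 0 T := by
  rw [intervalIntegrable_iff, Set.uIoc_of_le hT]
  have h1 := (intervalIntegrable_iff.1 (h.intervalIntegrable hT))
  rw [Set.uIoc_of_le hT] at h1
  refine Integrable.mono' h1 (aestronglyMeasurable_tailNorm hn hf h hL) ?_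
  filter_upwards [h.ae_mem T] with t ht
  rw [Real.norm_of_nonneg (tailNorm_nonneg _ _ _)]
  exact tailNorm_le hL (HSigma.summable ht)

theorem tendsto_integral_tailNorm (hn : 0 < n) (hf : IsContinuousInto n ⊤ f)
    (h : IsLocallyIntegrableInto m f) (hT : 0 ≤ T) :
    Tendsto (fun L : ℕ => ∫ t in (0)..T, tailNorm m ((L : ℝ) + 1) (f t)) atTop (𝓝 0) := by
  have hlim := intervalIntegral.tendsto_integral_filter_of_dominated_convergence
    (μ := volume) (a := 0) (b := T) (l := atTop)
    (F := fun (L : ℕ) t => tailNorm m ((L : ℝ) + 1) (f t)) (f := fun _ => (0 : ℝ))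
    (fun t => sobolevNorm m (f t)) ?_ ?_ (h.intervalIntegrable hT) ?_
  · simpa using hlim
  · refine Eventually.of_forall fun L => ?_
    rw [Set.uIoc_of_le hT]
    exact aestronglyMeasurable_tailNorm hn hf h (by positivity)
  · refine Eventually.of_forall fun L => ?_
    rw [← ae_restrict_iff' measurableSet_uIoc, Set.uIoc_of_le hT]
    filter_upwards [h.ae_mem T] with t ht
    rw [Real.norm_of_nonneg (tailNorm_nonneg _ _ _)]
    exact tailNorm_le (by positivity) (HSigma.summable ht)
  · rw [← ae_restrict_iff' measurableSet_uIoc, Set.uIoc_of_le hT]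
    filter_upwards [h.ae_mem T] with t ht
    exact tendsto_tailNorm (HSigma.summable ht)

end locallyIntegrable

/-- The Galerkin solutions are bounded in the space of order `n + 2`, and their high frequencies
are uniformly small. -/
theorem exists_tail_bound {n ν T M : ℝ} {f : ℝ → VField d} {u₀ : VField d}
    (hn : (d : ℝ) / 2 + 1 < n) (hν : 0 ≤ ν) (hM : 0 ≤ M) (hT : 0 ≤ T)
    (hf : IsContinuousInto n ⊤ f) (hf' : IsLocallyIntegrableInto (n + 2) f)
    (hu₀ : u₀ ∈ HSigma d (n + 2)) :
    ∃ τ : ℕ → ℝ, Tendsto τ atTop (𝓝 0) ∧ (∀ L, 0 ≤ τ L) ∧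
      ∀ N u, IsGalerkin n ν f u₀ T M N u → ∀ L : ℕ, ∀ t ∈ Set.Icc 0 T,
        ∀ S : Finset (Fin d → ℤ),
          ∑ k ∈ S, tailWeight (n + 2) ((L : ℝ) + 1) k ^ 2 * ‖u t k‖ ^ 2 ≤ τ L ^ 2 := by
  have hd : (0 : ℝ) ≤ d := Nat.cast_nonneg d
  have hn0 : 0 < n := by linarith
  have hc := mul_nonneg (growthConst_nonneg hn) hM
  -- The bound of `IsGalerkin.tail_le` at the final time, with sums over all modes: it no longer
  -- depends on `N` or on `t`.
  set τ : ℕ → ℝ := fun L => Real.exp (growthConst d n * M * T) *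
    (tailNorm (n + 2) ((L : ℝ) + 1) u₀ + ∫ t in (0)..T, tailNorm (n + 2) ((L : ℝ) + 1) (f t)) with hτ
  have hτ0 : ∀ L, 0 ≤ τ L := fun L => by
    have h1 : 0 ≤ ∫ t in (0)..T, tailNorm (n + 2) ((L : ℝ) + 1) (f t) :=
      intervalIntegral.integral_nonneg hT fun t _ => tailNorm_nonneg _ _ _
    have h2 := tailNorm_nonneg (n + 2) ((L : ℝ) + 1) u₀
    positivity
  refine ⟨τ, ?_, hτ0, fun N u hu L t ht S => ?_⟩
  · have h1 := ((tendsto_tailNorm (HSigma.summable hu₀)).add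
      (tendsto_integral_tailNorm hn0 hf hf' hT)).const_mul (Real.exp (growthConst d n * M * T))
    simpa using! h1
  · have hL : (0 : ℝ) < (L : ℝ) + 1 := by positivity
    have h1 := hu.tail_le hn hν hM hf hL t ht
    have hmem := hu.mem t ht
    have h2 : ∑ k ∈ S, tailWeight (n + 2) ((L : ℝ) + 1) k ^ 2 * ‖u t k‖ ^ 2 ≤
        ∑ k ∈ modes d N, tailWeight (n + 2) ((L : ℝ) + 1) k ^ 2 * ‖u t k‖ ^ 2 :=
      sum_le_sum_of_support (fun k => mul_nonneg (sq_nonneg _) (sq_nonneg _))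
        (fun k hk => by simp [hmem.2 k hk]) S
    have h3 : √(∑ k ∈ modes d N, tailWeight (n + 2) ((L : ℝ) + 1) k ^ 2 * ‖u t k‖ ^ 2) ≤ τ L := by
      refine h1.trans ?_
      have hgc : ContinuousOn (fun s => √(∑ k ∈ modes d N,
          tailWeight (n + 2) ((L : ℝ) + 1) k ^ 2 * ‖f s k‖ ^ 2)) (Set.Icc 0 T) :=
        continuousOn_sqrt_sum fun k => (hf.continuousOn_apply hn0 k).mono
          fun t ht => ⟨ht.1, EReal.coe_lt_top t⟩
      have hgi : IntervalIntegrable (fun s => √(∑ k ∈ modes d N,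
          tailWeight (n + 2) ((L : ℝ) + 1) k ^ 2 * ‖f s k‖ ^ 2)) volume 0 T :=
        ContinuousOn.intervalIntegrable (by rwa [Set.uIcc_of_le hT])
      have i1 : ∫ s in (0)..t, √(∑ k ∈ modes d N,
          tailWeight (n + 2) ((L : ℝ) + 1) k ^ 2 * ‖f s k‖ ^ 2) ≤
          ∫ s in (0)..T, √(∑ k ∈ modes d N,
            tailWeight (n + 2) ((L : ℝ) + 1) k ^ 2 * ‖f s k‖ ^ 2) :=
        intervalIntegral.integral_mono_interval le_rfl ht.1 ht.2
          (Eventually.of_forall fun s => Real.sqrt_nonneg _) hgi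
      have i2 : ∫ s in (0)..T, √(∑ k ∈ modes d N,
            tailWeight (n + 2) ((L : ℝ) + 1) k ^ 2 * ‖f s k‖ ^ 2) ≤
          ∫ s in (0)..T, tailNorm (n + 2) ((L : ℝ) + 1) (f s) := by
        rw [intervalIntegral.integral_of_le hT, intervalIntegral.integral_of_le hT]
        refine integral_mono_ae ((intervalIntegrable_iff_integrableOn_Ioc_of_le hT).1 hgi)
          ((intervalIntegrable_iff_integrableOn_Ioc_of_le hT).1
            (intervalIntegrable_tailNorm hn0 hf hf' hT hL)) ?_
        filter_upwards [hf'.ae_mem T] with s hs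
        exact sqrt_sum_le_tailNorm hL (HSigma.summable hs) _
      have i3 := sqrt_sum_le_tailNorm hL (HSigma.summable hu₀) (modes d N)
      have i4 : Real.exp (growthConst d n * M * t) ≤ Real.exp (growthConst d n * M * T) :=
        Real.exp_le_exp.2 (mul_le_mul_of_nonneg_left ht.2 hc)
      refine mul_le_mul i4 (by linarith) ?_ (Real.exp_pos _).le
      exact add_nonneg (Real.sqrt_nonneg _)
        (intervalIntegral.integral_nonneg ht.1 fun s _ => Real.sqrt_nonneg _)
    exact h2.trans ((Real.sqrt_le_left (hτ0 L)).1 h3)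

/-! ### Convergence of the Galerkin approximations -/

section truncation

variable {m : ℝ} {N : ℕ} {v : VField d}

theorem sub_truncate_apply (v : VField d) (k : Fin d → ℤ) :
    (v - truncate N v) k = if k ∈ modes d N then 0 else v k := by
  by_cases hk : k ∈ modes d N <;> simp [truncate, hk]

theorem HSigma.truncate (hv : v ∈ HSigma d m) (N : ℕ) : truncate N v ∈ HSigma d m :=
  galerkin_mem_HSigma (truncate_mem (mem_HSigma_iff.1 hv).1) m

theorem sobolevNorm_sub_truncate_le (hv : SobolevSummable m v) (N : ℕ) :
    sobolevNorm m (v - truncate N v) ≤ sobolevNorm m v := by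
  refine le_of_sq_le_sq ?_ (sobolevNorm_nonneg _ _)
  rw [sobolevNorm_sq, sobolevNorm_sq]
  refine (hv.sub (sobolevSummable_truncate N m v)).tsum_le_tsum (fun k => ?_) hv
  refine mul_le_mul_of_nonneg_left ?_ (Real.rpow_nonneg (freqNorm_nonneg k) _)
  rw [sub_truncate_apply]
  split_ifs
  · simp
  · exact le_rfl

/-- The discarded modes have `|k| > N`: one extra order of regularity is worth a factor `1/N`, the
source of the convergence rate. -/
theorem mul_sobolevNorm_sub_truncate_le (hm : 0 < m) (hv : SobolevSummable (m + 1) v) (N : ℕ) :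
    N * sobolevNorm m (v - truncate N v) ≤ sobolevNorm (m + 1) v := by
  refine le_of_sq_le_sq ?_ (sobolevNorm_nonneg _ _)
  rw [mul_pow, sobolevNorm_sq, sobolevNorm_sq, ← tsum_mul_left]
  have hs : SobolevSummable m (v - truncate N v) :=
    (hv.mono hm (by linarith)).sub (sobolevSummable_truncate N m v)
  refine (hs.mul_left _).tsum_le_tsum (fun k => ?_) hv
  rw [sub_truncate_apply]
  split_ifs with hk
  · have := Real.rpow_nonneg (freqNorm_nonneg k) (2 * (m + 1))
    rw [norm_zero, zero_pow two_ne_zero, mul_zero, mul_zero]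
    positivity
  · rw [← mul_assoc]
    refine mul_le_mul_of_nonneg_right ?_ (sq_nonneg _)
    have h1 : (N : ℝ) ≤ freqNorm k := (not_le.1 (mt mem_modes.2 hk)).le
    rw [freqNorm_rpow_two_mul, freqNorm_rpow_two_mul, ← mul_pow,
      Real.rpow_add_one' (freqNorm_nonneg k) (by linarith), mul_comm]
    have := Real.rpow_nonneg (freqNorm_nonneg k) m
    gcongr

theorem truncate_truncate_of_le {N' : ℕ} (h : N ≤ N') (v : VField d) :
    truncate N' (truncate N v) = truncate N v := by
  funext k
  by_cases hk : k ∈ modes d N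
  · rw [truncate_apply_of_mem (modes_mono h hk)]
  · by_cases hk' : k ∈ modes d N'
    · rw [truncate_apply_of_mem hk']
    · rw [truncate_apply_of_notMem hk', truncate_apply_of_notMem hk]

theorem truncate_of_mem (hv : v ∈ galerkinSubmodule d N) : truncate N v = v := by
  funext k
  by_cases hk : k ∈ modes d N
  · rw [truncate_apply_of_mem hk]
  · rw [truncate_apply_of_notMem hk, hv.2 k hk]

theorem galerkinSubmodule_mono {N' : ℕ} (h : N ≤ N') :
    galerkinSubmodule d N ≤ galerkinSubmodule d N' :=
  fun _ hv => ⟨hv.1, fun k hk => hv.2 k (mt (fun h' => modes_mono h h') hk)⟩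

theorem laplacian_mem_galerkin (hv : v ∈ galerkinSubmodule d N) :
    laplacian v ∈ galerkinSubmodule d N :=
  ⟨(mem_HSigma_iff.1 (HSigma.laplacian one_pos (galerkin_mem_HSigma hv _))).1,
    fun k hk => by rw [laplacian, hv.2 k hk, smul_zero]⟩

end truncation

section cauchy

variable {n K G ν T M B : ℝ} {f : ℝ → VField d} {u₀ : VField d} {N N' : ℕ} {u v : ℝ → VField d}

theorem continuousOn_norm_sub_truncate (hf : IsContinuousInto n ⊤ f) (N : ℕ) :
    ContinuousOn (fun t => sobolevNorm n (f t - truncate N (f t))) (timeDomain ⊤) := by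
  refine IsContinuousInto.continuousOn_norm (T := ⊤)
    ⟨fun t ht => HSigma.sub (hf.1 t ht) (HSigma.truncate (hf.1 t ht) N), fun t ht => ?_⟩
  refine squeeze_zero' (Eventually.of_forall fun _ => sobolevNorm_nonneg _ _) ?_ (hf.2 t ht)
  filter_upwards [self_mem_nhdsWithin] with s hs
  refine le_trans (le_of_eq ?_) (sobolevNorm_sub_truncate_le
    (HSigma.summable (HSigma.sub (hf.1 s hs) (hf.1 t ht))) N)
  rw [truncate_sub]
  congr 1
  abel

/-- The difference between the equations of two Galerkin approximations, in the energy norm. -/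
theorem IsGalerkin.inner_difference_le (hu : IsGalerkin n ν f u₀ T M N u)
    (hv : IsGalerkin n ν f u₀ T M N' v) (hN : 1 ≤ N) (hNN' : N ≤ N')
    (hn : (d : ℝ) / 2 + 1 < n) (hK : IsBasicConstant d n K) (hG : IsKatoConstant d n G)
    (hν : 0 ≤ ν) (hf : IsContinuousInto n ⊤ f) {t : ℝ} (ht : t ∈ Set.Icc 0 T)
    (huB : sobolevNorm (n + 2) (u t) ≤ B) :
    sobolevInner n (truncate N' (ν • laplacian (v t) + eulerBilinear (v t) (v t) + f t) -
      truncate N (ν • laplacian (u t) + eulerBilinear (u t) (u t) + f t)) (v t - u t) ≤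
      (3 * (G * M) + K * B) * sobolevNorm n (v t - u t) ^ 2 +
      (sobolevNorm n (f t - truncate N (f t)) + basicConst d n (n + 1) * B ^ 2 / N) *
        sobolevNorm n (v t - u t) := by
  have hd : (0 : ℝ) ≤ d := Nat.cast_nonneg d
  have hn0 : 0 < n := by linarith
  have hum := hu.mem t ht
  have hvm := hv.mem t ht
  have gu := galerkin_mem_HSigma hum
  have gv := galerkin_mem_HSigma hvm
  have hft : f t ∈ HSigma d n := hf.1 t ⟨ht.1, EReal.coe_lt_top t⟩
  have hw : v t - u t ∈ galerkinSubmodule d N' := sub_mem hvm (galerkinSubmodule_mono hNN' hum)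
  set P := eulerBilinear (u t) (u t) with hP
  have hP1 : P ∈ HSigma d (n + 1) :=
    eulerBilinear_mem hn (by linarith) (gu (n + 1)) (gu (n + 1 + 1))
  have hP0 : P ∈ HSigma d n := HSigma.mono hn0 (by linarith) hP1
  -- The coarser solution is treated as an approximate solution of the finer system; its error
  -- consists of the modes of `P(u,u)` and `f` discarded at level `N`.
  set e : VField d := -((P - truncate N P) + (f t - truncate N (f t))) with he
  have hPt := HSigma.sub hP0 (HSigma.truncate hP0 N)
  have hFt := HSigma.sub hft (HSigma.truncate hft N)
  have hemem : e ∈ HSigma d n := by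
    have h := HSigma.smul (-1) (HSigma.add hPt hFt)
    rwa [neg_smul, one_smul] at h
  have hB0 : 0 ≤ B := (sobolevNorm_nonneg _ _).trans huB
  have huB1 : sobolevNorm (n + 1) (u t) ≤ B :=
    ((HSigma.summable (gu (n + 2))).norm_mono (by linarith) (by linarith)).trans huB
  have hNpos : (0 : ℝ) < N := by exact_mod_cast hN
  have hPnorm : sobolevNorm n (P - truncate N P) ≤ basicConst d n (n + 1) * B ^ 2 / N := by
    rw [le_div_iff₀ hNpos, mul_comm]
    refine (mul_sobolevNorm_sub_truncate_le hn0 (HSigma.summable hP1) N).trans ?_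
    refine (sobolevNorm_eulerBilinear_le hn (by linarith) (gu (n + 1)) (gu (n + 1 + 1))).trans ?_
    have h1 : n + 1 + 1 = n + 2 := by ring
    rw [h1, pow_two, ← mul_assoc]
    have := basicConst_nonneg d n (n + 1)
    have := sobolevNorm_nonneg (n + 1) (u t)
    have := sobolevNorm_nonneg (n + 2) (u t)
    gcongr
  have henorm : sobolevNorm n e ≤
      sobolevNorm n (f t - truncate N (f t)) + basicConst d n (n + 1) * B ^ 2 / N := by
    rw [he, sobolevNorm_neg]
    refine ((HSigma.summable hPt).norm_add_le (HSigma.summable hFt)).trans ?_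
    linarith
  have hkey := sobolevInner_difference_le hn hK hG hν (gv (n + 2)) (gu (n + 2)) hemem
    (hu.norm_le t ht) huB1 henorm
  have heq : sobolevInner n (truncate N' (ν • laplacian (v t) + eulerBilinear (v t) (v t) + f t) -
      truncate N (ν • laplacian (u t) + P + f t)) (v t - u t) =
      sobolevInner n (ν • laplacian (v t - u t) + (eulerBilinear (v t) (v t) - P) - e)
        (v t - u t) := by
    rw [← truncate_truncate_of_le hNN' (ν • laplacian (u t) + P + f t), ← truncate_sub,
      sobolevInner_truncate hw.2]
    congr 1
    rw [truncate_add, truncate_add, truncate_of_mem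
      (Submodule.smul_mem _ ν (laplacian_mem_galerkin hum)), he, laplacian_sub, smul_sub]
    abel
  rw [heq]
  refine hkey.trans ?_
  -- The a priori bounds make the quadratic term linear: `G r ≤ 2 G M`, which with `G M` from Kato's
  -- inequality gives the factor `3 (G M)`.
  have hr : sobolevNorm n (v t - u t) ≤ 2 * M := by
    have := (HSigma.summable (gv n)).norm_sub_le (HSigma.summable (gu n))
    have := hu.norm_le t ht
    have := hv.norm_le t ht
    linarith
  set r := sobolevNorm n (v t - u t) with hrdef
  have hr0 : 0 ≤ r := sobolevNorm_nonneg _ _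
  have h1 : 0 ≤ ν * r ^ 2 := by positivity
  have h2 : G * r ^ 2 * r ≤ G * r ^ 2 * (2 * M) :=
    mul_le_mul_of_nonneg_left hr (by have := hG.1; positivity)
  nlinarith

/-- Grönwall multiplied by `N`: the truncation errors of the datum, the force and the bilinear term
are all of order `1/N`, the first two thanks to regularity beyond order `n`, the last to the bound
`B`. -/
theorem IsGalerkin.mul_norm_sub_le (hu : IsGalerkin n ν f u₀ T M N u)
    (hv : IsGalerkin n ν f u₀ T M N' v) (hN : 1 ≤ N) (hNN' : N ≤ N')
    (hn : (d : ℝ) / 2 + 1 < n) (hK : IsBasicConstant d n K) (hG : IsKatoConstant d n G)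
    (hν : 0 ≤ ν) (hM : 0 ≤ M) (hf : IsContinuousInto n ⊤ f)
    (hf' : IsLocallyIntegrableInto (n + 2) f) (hu₀ : u₀ ∈ HSigma d (n + 2)) (hB : 0 ≤ B)
    (huB : ∀ t ∈ Set.Icc 0 T, sobolevNorm (n + 2) (u t) ≤ B) :
    ∀ t ∈ Set.Icc 0 T, N * sobolevNorm n (v t - u t) ≤
      Real.exp ((3 * (G * M) + K * B) * T) * (sobolevNorm (n + 1) u₀ +
        ((∫ s in (0)..T, sobolevNorm (n + 2) (f s)) + T * (basicConst d n (n + 1) * B ^ 2))) := by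
  intro t ht
  have hT : 0 ≤ T := ht.1.trans ht.2
  have hd : (0 : ℝ) ≤ d := Nat.cast_nonneg d
  have hn0 : 0 < n := by linarith
  have hNpos : (0 : ℝ) < N := by exact_mod_cast hN
  have hbc := basicConst_nonneg d n (n + 1)
  set a := 3 * (G * M) + K * B with ha
  have ha0 : 0 ≤ a := by have := hK.1; have := hG.1; positivity
  set g : ℝ → ℝ := fun s => sobolevNorm n (f s - truncate N (f s)) +
    basicConst d n (n + 1) * B ^ 2 / N with hg
  have hsub : Set.Icc 0 T ⊆ timeDomain ⊤ := fun t ht => ⟨ht.1, EReal.coe_lt_top t⟩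
  have hgc : ContinuousOn g (Set.Icc 0 T) :=
    ((continuousOn_norm_sub_truncate hf N).mono hsub).add continuousOn_const
  have hg0 : ∀ s, 0 ≤ g s := fun s => add_nonneg (sobolevNorm_nonneg _ _) (by positivity)
  have hwm : ∀ s ∈ Set.Icc 0 T, v s - u s ∈ galerkinSubmodule d N' := fun s hs =>
    sub_mem (hv.mem s hs) (galerkinSubmodule_mono hNN' (hu.mem s hs))
  have hYeq : ∀ s ∈ Set.Icc 0 T, ∑ k ∈ modes d N', freqNorm k ^ (2 * n) * ‖(v s - u s) k‖ ^ 2 =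
      sobolevNorm n (v s - u s) ^ 2 := fun s hs =>
    (sobolevNorm_sq_of_support n (hwm s hs).2).symm
  have hgron := sqrt_le_of_deriv_le (T := T)
    (Y := fun s => ∑ k ∈ modes d N', freqNorm k ^ (2 * n) * ‖(v s - u s) k‖ ^ 2)
    (g := g) ha0
    (fun s hs => hasDerivWithinAt_sum_mul_norm_sq (u := fun s => v s - u s)
      (v := truncate N' (ν • laplacian (v s) + eulerBilinear (v s) (v s) + f s) -
        truncate N (ν • laplacian (u s) + eulerBilinear (u s) (u s) + f s))
      fun k _ => (hv.deriv s hs k).sub (hu.deriv s hs k))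
    (fun s hs => by rw [hYeq s hs]; exact sq_nonneg _) hgc (fun s _ => hg0 s)
    (fun s hs => by
      rw [hYeq s hs, Real.sqrt_sq (sobolevNorm_nonneg _ _)]
      have h1 := hu.inner_difference_le hv hN hNN' hn hK hG hν hf hs (huB s hs)
      have h2 : sobolevInner n
          (truncate N' (ν • laplacian (v s) + eulerBilinear (v s) (v s) + f s) -
          truncate N (ν • laplacian (u s) + eulerBilinear (u s) (u s) + f s)) (v s - u s) =
          ∑ k ∈ modes d N', freqNorm k ^ (2 * n) * (inner ℂ
          ((truncate N' (ν • laplacian (v s) + eulerBilinear (v s) (v s) + f s) -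
          truncate N (ν • laplacian (u s) + eulerBilinear (u s) (u s) + f s)) k)
            ((v s - u s) k)).re :=
        tsum_eq_sum fun k hk => by simp [(hwm s hs).2 k hk]
      rw [← h2]
      linarith) t ht
  simp only [hYeq t ht, hYeq 0 ⟨le_rfl, hT⟩, Real.sqrt_sq (sobolevNorm_nonneg _ _)] at hgron
  have hu₀1 : SobolevSummable (n + 1) u₀ :=
    (HSigma.summable hu₀).mono (by linarith) (by linarith)
  have hinit : N * sobolevNorm n (v 0 - u 0) ≤ sobolevNorm (n + 1) u₀ := by
    rw [hu.init, hv.init, ← truncate_truncate_of_le hNN' u₀, ← truncate_sub]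
    refine le_trans ?_ (mul_sobolevNorm_sub_truncate_le hn0 hu₀1 N)
    refine mul_le_mul_of_nonneg_left (sobolevNorm_truncate_le ?_ N') hNpos.le
    exact (hu₀1.mono hn0 (by linarith)).sub (sobolevSummable_truncate N n u₀)
  have hgi : IntervalIntegrable g volume 0 T :=
    ContinuousOn.intervalIntegrable (by rwa [Set.uIcc_of_le hT])
  have i1 : ∫ s in (0)..t, g s ≤ ∫ s in (0)..T, g s :=
    intervalIntegral.integral_mono_interval le_rfl ht.1 ht.2
      (Eventually.of_forall fun s => hg0 s) hgi
  have i2 : N * ∫ s in (0)..T, g s ≤ (∫ s in (0)..T, sobolevNorm (n + 2) (f s)) +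
      T * (basicConst d n (n + 1) * B ^ 2) := by
    have h1 : ∫ s in (0)..T, (sobolevNorm (n + 2) (f s) + basicConst d n (n + 1) * B ^ 2) =
        (∫ s in (0)..T, sobolevNorm (n + 2) (f s)) + T * (basicConst d n (n + 1) * B ^ 2) := by
      rw [intervalIntegral.integral_add (hf'.intervalIntegrable hT)
        intervalIntegrable_const, intervalIntegral.integral_const]
      simp
    rw [← h1, ← intervalIntegral.integral_const_mul, intervalIntegral.integral_of_le hT,
      intervalIntegral.integral_of_le hT]
    refine integral_mono_ae
      ((intervalIntegrable_iff_integrableOn_Ioc_of_le hT).1 (hgi.const_mul _))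
      ((intervalIntegrable_iff_integrableOn_Ioc_of_le hT).1
        ((hf'.intervalIntegrable hT).add intervalIntegrable_const)) ?_
    filter_upwards [hf'.ae_mem T] with s hs
    simp only [hg]
    have h2 := (mul_sobolevNorm_sub_truncate_le hn0
      ((HSigma.summable hs).mono (m := n + 1) (by linarith) (by linarith)) N).trans
      ((HSigma.summable hs).norm_mono (by linarith) (by linarith))
    have h3 : (N : ℝ) * (basicConst d n (n + 1) * B ^ 2 / N) = basicConst d n (n + 1) * B ^ 2 := by
      field_simp
    rw [mul_add, h3]
    linarith
  have hexp : Real.exp (a * t) ≤ Real.exp (a * T) :=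
    Real.exp_le_exp.2 (mul_le_mul_of_nonneg_left ht.2 ha0)
  have hint0 : 0 ≤ ∫ s in (0)..t, g s := intervalIntegral.integral_nonneg ht.1 fun s _ => hg0 s
  calc N * sobolevNorm n (v t - u t)
      ≤ N * (Real.exp (a * t) * (sobolevNorm n (v 0 - u 0) + ∫ s in (0)..t, g s)) :=
        mul_le_mul_of_nonneg_left hgron hNpos.le
    _ = Real.exp (a * t) * (N * sobolevNorm n (v 0 - u 0) + N * ∫ s in (0)..t, g s) := by ring
    _ ≤ _ := by
        refine mul_le_mul hexp (add_le_add hinit (le_trans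
          (mul_le_mul_of_nonneg_left i1 hNpos.le) i2)) ?_ (Real.exp_pos _).le
        exact add_nonneg (mul_nonneg hNpos.le (sobolevNorm_nonneg _ _))
          (mul_nonneg hNpos.le hint0)

end cauchy

/-! ### Regularity of curves from their Fourier coefficients -/

section regularity

variable {m : ℝ} {T : EReal} {u g : ℝ → VField d}

theorem isContinuousInto_of_continuousOn (hmem : ∀ t ∈ timeDomain T, u t ∈ HSigma d m)
    (hc : ContinuousOn (fun t => toCoeff m (u t)) (timeDomain T)) : IsContinuousInto m T u := by
  refine ⟨hmem, fun t ht => (tendsto_iff_norm_sub_tendsto_zero.1 (hc t ht)).congr' ?_⟩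
  filter_upwards [self_mem_nhdsWithin] with s hs
  rw [← (HSigma.summable (hmem s hs)).toCoeff_sub (HSigma.summable (hmem t ht)), norm_toCoeff]

theorem isC1Into_of_hasDerivWithinAt (hmem : ∀ t ∈ timeDomain T, u t ∈ HSigma d m)
    (hg : IsContinuousInto m T g)
    (h : ∀ t ∈ timeDomain T, HasDerivWithinAt (fun s => toCoeff m (u s)) (toCoeff m (g t))
      (timeDomain T) t) : IsC1Into m T u g := by
  refine ⟨isContinuousInto_of_continuousOn hmem fun t ht => (h t ht).continuousWithinAt, hg,
    fun t ht => (tendsto_iff_norm_sub_tendsto_zero.1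
      (hasDerivWithinAt_iff_tendsto_slope.1 (h t ht))).congr' ?_⟩
  filter_upwards [self_mem_nhdsWithin] with s hs
  have h1 := HSigma.summable (hmem s hs.1)
  have h2 := HSigma.summable (hmem t ht)
  have h3 := HSigma.summable (hg.1 t ht)
  rw [slope_def_module, ← h1.toCoeff_sub h2, ← (h1.sub h2).toCoeff_smul,
    ← ((h1.sub h2).smul _).toCoeff_sub h3, norm_toCoeff]

theorem exists_mem_timeDomain_gt {t : ℝ} (ht : t ∈ timeDomain T) : ∃ b ∈ timeDomain T, t < b := by
  obtain ⟨b, hb, hbT⟩ := EReal.lt_iff_exists_real_btwn.1 ht.2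
  have hb' : t < b := EReal.coe_lt_coe_iff.1 hb
  exact ⟨b, ⟨ht.1.trans hb'.le, hbT⟩, hb'⟩

/-- Each coefficient is the integral of its derivative, so `u` is the Hilbert space integral of the
continuous curve `g`, and the fundamental theorem of calculus gives the strong derivative. -/
theorem isC1Into_of_hasDerivAt_apply (hmem : ∀ t ∈ timeDomain T, u t ∈ HSigma d m)
    (hg : IsContinuousInto m T g) (hc : ∀ k, ContinuousOn (fun t => u t k) (timeDomain T))
    (hd : ∀ t ∈ timeDomain T, 0 < t → ∀ k, HasDerivAt (fun s => u s k) (g t k) t) :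
    IsC1Into m T u g := by
  refine isC1Into_of_hasDerivWithinAt hmem hg fun t ht => ?_
  obtain ⟨b, hb, htb⟩ := exists_mem_timeDomain_gt ht
  have hb0 : 0 ≤ b := hb.1
  have hI := Icc_subset_timeDomain hb
  -- Extending `g` by constants beyond `[0, b]` makes it continuous on the line, so the integral is
  -- differentiable at `t = 0` as well.
  set Γ : ℝ → CoeffSpace d :=
    Set.IccExtend hb0 (Set.domRestrict (Set.Icc 0 b) fun s => toCoeff m (g s)) with hΓ
  have hΓc : Continuous Γ := (hg.continuousOn_toCoeff.mono hI).domRestrict.Icc_extend'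
  have hΓe : ∀ s ∈ Set.Icc 0 b, Γ s = toCoeff m (g s) := fun s hs => by
    rw [hΓ, Set.IccExtend_of_mem _ _ hs]; rfl
  have hF : HasDerivAt (fun s => toCoeff m (u 0) + ∫ x in (0)..s, Γ x) (toCoeff m (g t)) t := by
    rw [← hΓe t ⟨ht.1, htb.le⟩]
    exact (hΓc.integral_hasStrictDerivAt 0 t).hasDerivAt.const_add _
  have heq : ∀ s ∈ Set.Icc 0 b, toCoeff m (u s) = toCoeff m (u 0) + ∫ x in (0)..s, Γ x := by
    intro s hs
    ext1; funext k
    set E : CoeffSpace d →L[ℝ] EuclideanSpace ℂ (Fin d) :=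
      lp.evalCLM ℝ (fun _ : Fin d → ℤ => EuclideanSpace ℂ (Fin d)) 2 k with hE
    have hEa : ∀ x : CoeffSpace d, E x = x k := fun x => rfl
    rw [← hEa, ← hEa, map_add, ← ContinuousLinearMap.intervalIntegral_comp_comm E
      (hΓc.intervalIntegrable _ _)]
    have h1 := intervalIntegral.integral_eq_sub_of_hasDerivAt_of_le (a := 0) (b := s)
      (f := fun x => (freqNorm k ^ m) • u x k) (f' := fun x => E (Γ x)) hs.1
      ((((hc k).mono hI).mono (Set.Icc_subset_Icc_right hs.2)).const_smul (freqNorm k ^ m)) ?_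
      ((E.continuous.comp hΓc).intervalIntegrable _ _)
    · rw [h1, hEa, hEa, toCoeff_apply (HSigma.summable (hmem s (hI hs))),
        toCoeff_apply (HSigma.summable (hmem 0 (hI ⟨le_rfl, hb0⟩)))]
      abel
    · intro x hx
      have hx' : x ∈ Set.Icc 0 b := ⟨hx.1.le, hx.2.le.trans hs.2⟩
      simp only [hΓe x hx', hEa, toCoeff_apply (HSigma.summable (hg.1 x (hI hx')))]
      exact (hd x (hI hx') hx.1 k).const_smul (freqNorm k ^ m)
  refine (hF.hasDerivWithinAt (s := timeDomain T)).congr_of_eventuallyEq ?_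
    (heq t ⟨ht.1, htb.le⟩)
  filter_upwards [self_mem_nhdsWithin, mem_nhdsWithin_of_mem_nhds (Iio_mem_nhds htb)] with s hs hs'
  exact heq s ⟨hs.1, le_of_lt hs'⟩

/-- Coefficientwise continuous curves with uniformly small tails are continuous. -/
theorem isContinuousInto_of_tail {τ : ℕ → ℝ} (hτ : Tendsto τ atTop (𝓝 0))
    (hmem : ∀ t ∈ timeDomain T, u t ∈ HSigma d m)
    (hc : ∀ k, ContinuousOn (fun t => u t k) (timeDomain T))
    (htail : ∀ L : ℕ, ∀ t ∈ timeDomain T, ∀ S : Finset (Fin d → ℤ),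
      ∑ k ∈ S, tailWeight m ((L : ℝ) + 1) k ^ 2 * ‖u t k‖ ^ 2 ≤ τ L ^ 2) :
    IsContinuousInto m T u := by
  refine ⟨hmem, fun t ht => ?_⟩
  have hbound : ∀ L : ℕ, ∀ s ∈ timeDomain T, sobolevNorm m (u s - u t) ^ 2 ≤
      ∑ k ∈ modes d (L + 1), freqNorm k ^ (2 * m) * ‖u s k - u t k‖ ^ 2 + 4 * τ L ^ 2 := by
    intro L s hs
    rw [sobolevNorm_sq]
    refine (HSigma.summable (HSigma.sub (hmem s hs) (hmem t ht))).tsum_le_of_sum_le fun S => ?_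
    classical
    rw [← Finset.sum_filter_add_sum_filter_not S (· ∈ modes d (L + 1))]
    refine add_le_add (Finset.sum_le_sum_of_subset_of_nonneg
      (fun k hk => (Finset.mem_filter.1 hk).2) fun k _ _ =>
        mul_nonneg (Real.rpow_nonneg (freqNorm_nonneg k) _) (sq_nonneg _)) ?_
    -- On these modes the tail weight is the full `|k|^m`; the parallelogram bound for the
    -- difference of two times then gives `2 τ² + 2 τ²`.
    set S' := S.filter (· ∉ modes d (L + 1)) with hS'
    have h1 : ∀ k ∈ S', freqNorm k ^ (2 * m) * ‖(u s - u t) k‖ ^ 2 ≤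
        2 * (tailWeight m ((L : ℝ) + 1) k ^ 2 * ‖u s k‖ ^ 2) +
        2 * (tailWeight m ((L : ℝ) + 1) k ^ 2 * ‖u t k‖ ^ 2) := by
      intro k hk
      have h2 : ((L : ℝ) + 1) ≤ freqNorm k := by
        have := mt mem_modes.2 (Finset.mem_filter.1 hk).2
        push_cast at this
        linarith
      rw [tailWeight_eq (by positivity) h2, freqNorm_rpow_two_mul]
      have h3 : ‖(u s - u t) k‖ ^ 2 ≤ 2 * ‖u s k‖ ^ 2 + 2 * ‖u t k‖ ^ 2 := by
        have h4 : ‖(u s - u t) k‖ ≤ ‖u s k‖ + ‖u t k‖ := norm_sub_le _ _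
        have h5 := pow_le_pow_left₀ (norm_nonneg _) h4 2
        nlinarith [sq_nonneg (‖u s k‖ - ‖u t k‖)]
      have := mul_le_mul_of_nonneg_left h3 (sq_nonneg (freqNorm k ^ m))
      linarith
    refine (Finset.sum_le_sum h1).trans ?_
    rw [Finset.sum_add_distrib, ← Finset.mul_sum, ← Finset.mul_sum]
    have := htail L s hs S'
    have := htail L t ht S'
    linarith
  have hsq : Tendsto (fun s => sobolevNorm m (u s - u t) ^ 2) (𝓝[timeDomain T] t) (𝓝 0) := by
    refine (nhds_basis_zero_abs_lt ℝ).tendsto_right_iff.2 fun ε hε => ?_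
    -- `L` is fixed first, uniformly in time; only finitely many continuous coefficients remain.
    obtain ⟨L, hL⟩ : ∃ L, 4 * τ L ^ 2 < ε / 2 := by
      have h1 : Tendsto (fun L => 4 * τ L ^ 2) atTop (𝓝 (4 * 0 ^ 2)) := (hτ.pow 2).const_mul 4
      exact (h1.eventually_lt_const (by norm_num; exact hε)).exists
    have h2 : Tendsto (fun s => ∑ k ∈ modes d (L + 1), freqNorm k ^ (2 * m) * ‖u s k - u t k‖ ^ 2)
        (𝓝[timeDomain T] t) (𝓝 0) := by
      have h0 : (0 : ℝ) = ∑ k ∈ modes d (L + 1), 0 := Finset.sum_const_zero.symm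
      conv => arg 3; rw [h0]
      refine tendsto_finsetSum _ fun k _ => ?_
      have h3 := (tendsto_iff_norm_sub_tendsto_zero.1 (hc k t ht)).pow 2
      simpa using h3.const_mul (freqNorm k ^ (2 * m))
    filter_upwards [self_mem_nhdsWithin, h2.eventually_lt_const (half_pos hε)] with s hs hs'
    have := hbound L s hs
    rw [abs_of_nonneg (sq_nonneg _)]
    linarith
  have h := hsq.sqrt
  simp only [Real.sqrt_sq (sobolevNorm_nonneg _ _), Real.sqrt_zero] at h
  exact h

end regularity

/-! ### The right hand side of the evolution equation -/

section field

variable {n K ν : ℝ} {T : EReal} {f u : ℝ → VField d}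

theorem sobolevNorm_eulerBilinear_self_sub_le (hn : (d : ℝ) / 2 + 1 < n)
    (hK : IsBasicConstant d n K) {v w : VField d} (hv : v ∈ HSigma d (n + 1))
    (hw : w ∈ HSigma d (n + 1)) :
    sobolevNorm n (eulerBilinear v v - eulerBilinear w w) ≤
      K * (sobolevNorm (n + 1) v + sobolevNorm (n + 1) w) * sobolevNorm (n + 1) (v - w) := by
  have hd : (0 : ℝ) ≤ d := Nat.cast_nonneg d
  have hn0 : 0 < n := by linarith
  have hv0 := HSigma.mono hn0 (by linarith) hv
  have hw0 := HSigma.mono hn0 (by linarith) hw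
  have hvw := HSigma.sub hv hw
  have hvw0 := HSigma.sub hv0 hw0
  have hK0 := hK.1
  rw [eulerBilinear_self_sub hn hv0 hw0]
  refine ((HSigma.summable (eulerBilinear_mem hn le_rfl hv0 hvw)).norm_add_le
    (HSigma.summable (eulerBilinear_mem hn le_rfl hvw0 hw))).trans ?_
  have h1 := hK.2 v hv0 _ hvw
  have h2 := hK.2 _ hvw0 w hw
  have h3 : K * sobolevNorm n v * sobolevNorm (n + 1) (v - w) ≤
      K * sobolevNorm (n + 1) v * sobolevNorm (n + 1) (v - w) := by
    have := sobolevNorm_nonneg (n + 1) (v - w)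
    have := (HSigma.summable hv).norm_mono hn0 (by linarith : n ≤ n + 1)
    gcongr
  have h4 : K * sobolevNorm n (v - w) * sobolevNorm (n + 1) w ≤
      K * sobolevNorm (n + 1) (v - w) * sobolevNorm (n + 1) w := by
    have := sobolevNorm_nonneg (n + 1) w
    have := (HSigma.summable hvw).norm_mono hn0 (by linarith : n ≤ n + 1)
    gcongr
  linarith

theorem isContinuousInto_field (hn : (d : ℝ) / 2 + 1 < n) (hK : IsBasicConstant d n K)
    (hu : IsContinuousInto (n + 2) T u) (hf : IsContinuousInto n T f) :
    IsContinuousInto n T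
      (fun t => ν • laplacian (u t) + eulerBilinear (u t) (u t) + f t) := by
  have hd : (0 : ℝ) ≤ d := Nat.cast_nonneg d
  have hn0 : 0 < n := by linarith
  have hu1 := hu.mono_order (m := n + 1) (by linarith) (by linarith)
  have hP : ∀ t ∈ timeDomain T, eulerBilinear (u t) (u t) ∈ HSigma d n := fun t ht =>
    eulerBilinear_mem hn le_rfl (HSigma.mono hn0 (by linarith) (hu.1 t ht)) (hu1.1 t ht)
  have hΔ : ∀ t ∈ timeDomain T, ν • laplacian (u t) ∈ HSigma d n := fun t ht =>
    HSigma.smul ν (HSigma.laplacian hn0 (hu.1 t ht))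
  refine ⟨fun t ht => HSigma.add (HSigma.add (hΔ t ht) (hP t ht)) (hf.1 t ht), fun t ht => ?_⟩
  have l1 : Tendsto (fun s => |ν| * sobolevNorm (n + 2) (u s - u t)) (𝓝[timeDomain T] t)
      (𝓝 (|ν| * 0)) := (hu.2 t ht).const_mul _
  have l2 : Tendsto (fun s => K * (sobolevNorm (n + 1) (u s) + sobolevNorm (n + 1) (u t)) *
      sobolevNorm (n + 1) (u s - u t)) (𝓝[timeDomain T] t)
      (𝓝 (K * (sobolevNorm (n + 1) (u t) + sobolevNorm (n + 1) (u t)) * 0)) :=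
    ((Tendsto.add (hu1.continuousOn_norm t ht) tendsto_const_nhds).const_mul K).mul (hu1.2 t ht)
  have l := (l1.add l2).add (hf.2 t ht)
  simp only [mul_zero, add_zero] at l
  refine squeeze_zero' (Eventually.of_forall fun _ => sobolevNorm_nonneg _ _) ?_ l
  filter_upwards [self_mem_nhdsWithin] with s hs
  have e : ν • laplacian (u s) + eulerBilinear (u s) (u s) + f s -
      (ν • laplacian (u t) + eulerBilinear (u t) (u t) + f t) =
      ν • laplacian (u s - u t) + (eulerBilinear (u s) (u s) - eulerBilinear (u t) (u t)) +
        (f s - f t) := by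
    rw [laplacian_sub, smul_sub]; abel
  have s1 := HSigma.summable (HSigma.smul ν (HSigma.laplacian hn0 (HSigma.sub (hu.1 s hs) (hu.1 t ht))))
  have s2 := HSigma.summable (HSigma.sub (hP s hs) (hP t ht))
  have s3 := HSigma.summable (HSigma.sub (hf.1 s hs) (hf.1 t ht))
  rw [e]
  refine ((s1.add s2).norm_add_le s3).trans (add_le_add ((s1.norm_add_le s2).trans
    (add_le_add ?_ (sobolevNorm_eulerBilinear_self_sub_le hn hK (hu1.1 s hs) (hu1.1 t ht)))) le_rfl)
  rw [sobolevNorm_smul, sobolevNorm_laplacian hn0]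

end field

/-! ### Local existence -/

section limit

variable {ι : Type*} {l : Filter ι} [l.NeBot] {V : ι → VField d} {v : VField d}

theorem sum_le_of_tendsto_apply (h : ∀ k, Tendsto (fun i => V i k) l (𝓝 (v k)))
    {S : Finset (Fin d → ℤ)} {w : (Fin d → ℤ) → ℝ} {A : ℝ}
    (hb : ∀ᶠ i in l, ∑ k ∈ S, w k * ‖V i k‖ ^ 2 ≤ A) : ∑ k ∈ S, w k * ‖v k‖ ^ 2 ≤ A :=
  le_of_tendsto (tendsto_finsetSum _ fun k _ => ((h k).norm.pow 2).const_mul (w k)) hb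

theorem mem_solenoidal_of_tendsto (h : ∀ k, Tendsto (fun i => V i k) l (𝓝 (v k)))
    (hV : ∀ i, V i ∈ solenoidal d) : v ∈ solenoidal d := by
  have hc : ∀ k r, Tendsto (fun i => V i k r) l (𝓝 (v k r)) := fun k r =>
    ((EuclideanSpace.proj (𝕜 := ℂ) r).continuous.tendsto (v k)).comp (h k)
  refine ⟨fun k r => ?_, ?_, fun k => ?_⟩
  · refine tendsto_nhds_unique (hc (-k) r) (Tendsto.congr (fun i => ((hV i).1 k r).symm) ?_)
    exact (Complex.continuous_conj.tendsto _).comp (hc k r)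
  · exact tendsto_nhds_unique (h 0) (tendsto_const_nhds.congr fun i => ((hV i).2.1).symm)
  · exact tendsto_nhds_unique (((continuous_freqDot k).tendsto _).comp (h k))
      (tendsto_const_nhds.congr fun i => ((hV i).2.2 k).symm)

theorem sobolevNorm_le_of_tendsto_apply {m A : ℝ} (hA : 0 ≤ A)
    (h : ∀ k, Tendsto (fun i => V i k) l (𝓝 (v k))) (hV : ∀ i, SobolevSummable m (V i))
    (hb : ∀ᶠ i in l, sobolevNorm m (V i) ≤ A) :
    SobolevSummable m v ∧ sobolevNorm m v ≤ A := by
  have hS : ∀ S : Finset (Fin d → ℤ), ∑ k ∈ S, freqNorm k ^ (2 * m) * ‖v k‖ ^ 2 ≤ A ^ 2 :=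
    fun S => sum_le_of_tendsto_apply h (hb.mono fun i hi =>
      ((hV i).sum_le S).trans (pow_le_pow_left₀ (sobolevNorm_nonneg _ _) hi 2))
  have hs := sobolevSummable_of_sum_le hS
  refine ⟨hs, le_of_sq_le_sq ?_ hA⟩
  rw [sobolevNorm_sq]
  exact hs.tsum_le_of_sum_le hS

end limit

section localExistence

variable {n K G ν T M : ℝ} {f : ℝ → VField d} {u₀ : VField d}

theorem exists_galerkin_limit (hn0 : 0 < n) {U : ℕ → ℝ → VField d} {C : ℝ} (hC : 0 ≤ C)
    (hU : ∀ N, IsGalerkin n ν f u₀ T M N (U N))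
    (hcauchy : ∀ N N', 1 ≤ N → N ≤ N' → ∀ t ∈ Set.Icc 0 T,
      N * sobolevNorm n (U N' t - U N t) ≤ C) :
    ∃ u : ℝ → VField d, ∀ t ∈ Set.Icc 0 T,
      (∀ k, Tendsto (fun N => U N t k) atTop (𝓝 (u t k))) ∧
      u t ∈ HSigma d n ∧ ∀ N : ℕ, 1 ≤ N → sobolevNorm n (u t - U N t) ≤ C / N := by
  have gU := fun N t ht => galerkin_mem_HSigma ((hU N).mem t ht)
  have hcs : ∀ t ∈ Set.Icc 0 T, ∀ k, ∃ c, Tendsto (fun N => U N t k) atTop (𝓝 c) := by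
    intro t ht k
    -- The rate `C / N` is meaningful only for `N ≥ 1`; the extra summand at `N = 0` bounds the
    -- distance from `U 0` by passing through `U 1`.
    refine cauchySeq_tendsto_of_complete (cauchySeq_of_le_tendsto_0' (fun N : ℕ => C / N + if N = 0 then
      ‖U 0 t k‖ + C + ‖U 1 t k‖ else 0) ?_ ?_)
    · intro N N' h
      have key : ∀ N N' : ℕ, 1 ≤ N → N ≤ N' → ‖U N t k - U N' t k‖ ≤ C / N := by
        intro N N' h1 h
        rw [norm_sub_rev, le_div_iff₀ (by exact_mod_cast h1), mul_comm]
        refine le_trans ?_ (hcauchy N N' h1 h t ht)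
        exact mul_le_mul_of_nonneg_left (HSigma.norm_apply_le hn0
          (HSigma.sub (gU N' t ht n) (gU N t ht n)) k) (Nat.cast_nonneg N)
      rw [dist_eq_norm]
      rcases Nat.eq_zero_or_pos N with rfl | h1
      · rw [if_pos rfl]
        rcases Nat.eq_zero_or_pos N' with rfl | h2
        · simp; positivity
        · have h3 := key 1 N' le_rfl h2
          have h4 : ‖U 0 t k - U N' t k‖ ≤ ‖U 0 t k‖ + ‖U 1 t k‖ + ‖U 1 t k - U N' t k‖ := by
            have e : U 0 t k - U N' t k = U 0 t k - U 1 t k + (U 1 t k - U N' t k) := by abel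
            rw [e]
            exact (norm_add_le _ _).trans (add_le_add (norm_sub_le _ _) le_rfl)
          simp at h3 ⊢
          linarith
      · rw [if_neg (by omega), add_zero]
        exact key N N' h1 h
    · refine (tendsto_const_div_atTop_nhds_zero_nat C).congr' ?_
      filter_upwards [eventually_ge_atTop 1] with N hN
      rw [if_neg (by omega), add_zero]
  choose! u hu using fun t => hcs t
  refine ⟨u, fun t ht => ?_⟩
  have hsub : ∀ N : ℕ, 1 ≤ N → SobolevSummable n (u t - U N t) ∧
      sobolevNorm n (u t - U N t) ≤ C / N := fun N hN => by
    refine sobolevNorm_le_of_tendsto_apply (l := atTop) (V := fun N' => U N' t - U N t)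
      (by positivity) (fun k => (hu t ht k).sub_const _)
      (fun N' => HSigma.summable (HSigma.sub (gU N' t ht n) (gU N t ht n))) ?_
    filter_upwards [eventually_ge_atTop N] with N' hN'
    rw [le_div_iff₀ (by exact_mod_cast hN), mul_comm]
    exact hcauchy N N' hN hN' t ht
  refine ⟨hu t ht, mem_HSigma_iff.2 ⟨?_, ?_⟩, fun N hN => (hsub N hN).2⟩
  · exact mem_solenoidal_of_tendsto (l := atTop) (hu t ht) fun N => ((hU N).mem t ht).1
  · have := (hsub 1 le_rfl).1.add (HSigma.summable (gU 1 t ht n))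
    rwa [sub_add_cancel] at this

theorem tendstoUniformlyOn_of_norm_le {E : Type*} [NormedAddCommGroup E] {F : ℕ → ℝ → E}
    {g : ℝ → E} {s : Set ℝ} {b : ℕ → ℝ} (hb : Tendsto b atTop (𝓝 0))
    (h : ∀ᶠ N in atTop, ∀ t ∈ s, ‖g t - F N t‖ ≤ b N) : TendstoUniformlyOn F g atTop s := by
  refine Metric.tendstoUniformlyOn_iff.2 fun ε hε => ?_
  filter_upwards [h, hb.eventually_lt_const hε] with N hN hN' t ht
  rw [dist_eq_norm]
  exact (hN t ht).trans_lt hN'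

/-- Local existence, on an interval which depends on the data only through bounds of order `n`. -/
theorem exists_isSolution_of_le (hn : (d : ℝ) / 2 + 1 < n)
    (hK : IsBasicConstant d n K) (hG : IsKatoConstant d n G) (hν : 0 ≤ ν)
    (hf : IsContinuousInto n ⊤ f) (hf' : IsLocallyIntegrableInto (n + 2) f)
    (hu₀ : u₀ ∈ HSigma d (n + 2)) {Φ : ℝ} (hM : 0 < M) (hT : 0 < T)
    (hΦ : ∀ t ∈ Set.Icc 0 T, sobolevNorm n (f t) ≤ Φ)
    (hMT : sobolevNorm n u₀ + (G * M ^ 2 + Φ) * T ≤ M) :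
    ∃ u, IsSolution n ν f u₀ (T : EReal) u := by
  have hd : (0 : ℝ) ≤ d := Nat.cast_nonneg d
  have hn0 : 0 < n := by linarith
  have hK0 := hK.1
  choose U hU using exists_isGalerkin hn hK hG hν hf (HSigma.mono hn0 (by linarith) hu₀) hM hT.le
    hΦ hMT
  obtain ⟨τ, hτ, hτ0, htail⟩ := exists_tail_bound hn hν hM.le hT.le hf hf' hu₀
  -- The index 0 corresponds to `L + 1 = 1`, where the weight is `|k|^{n+2}`: a uniform bound in
  -- order `n + 2`.
  set B := τ 0 with hB
  have gU := fun N t ht => galerkin_mem_HSigma ((hU N).mem t ht)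
  have sum_le_B : ∀ v : VField d, (∀ S : Finset (Fin d → ℤ),
      ∑ k ∈ S, tailWeight (n + 2) (((0 : ℕ) : ℝ) + 1) k ^ 2 * ‖v k‖ ^ 2 ≤ B ^ 2) →
      SobolevSummable (n + 2) v ∧ sobolevNorm (n + 2) v ≤ B := by
    intro v hv
    simp only [Nat.cast_zero, zero_add, tailWeight_one (show 0 < n + 2 by linarith),
      ← freqNorm_rpow_two_mul] at hv
    have hs := sobolevSummable_of_sum_le hv
    refine ⟨hs, le_of_sq_le_sq ?_ (hτ0 0)⟩
    rw [sobolevNorm_sq]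
    exact hs.tsum_le_of_sum_le hv
  have hUB : ∀ N, ∀ t ∈ Set.Icc 0 T, sobolevNorm (n + 2) (U N t) ≤ B := fun N t ht =>
    (sum_le_B _ fun S => htail N (U N) (hU N) 0 t ht S).2
  obtain ⟨C, hC0, hC⟩ : ∃ C, 0 ≤ C ∧ ∀ N N', 1 ≤ N → N ≤ N' → ∀ t ∈ Set.Icc 0 T,
      N * sobolevNorm n (U N' t - U N t) ≤ C := by
    refine ⟨_, ?_, fun N N' h h' => (hU N).mul_norm_sub_le (hU N') h h' hn hK hG hν hM.le hf hf' hu₀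
      (hτ0 0) (hUB N)⟩
    have h1 := sobolevNorm_nonneg (n + 1) u₀
    have h2 : 0 ≤ ∫ s in (0)..T, sobolevNorm (n + 2) (f s) :=
      intervalIntegral.integral_nonneg hT.le fun s _ => sobolevNorm_nonneg _ _
    have h3 := basicConst_nonneg d n (n + 1)
    positivity
  obtain ⟨u, hu⟩ := exists_galerkin_limit hn0 hC0 hU hC
  have hutail : ∀ L : ℕ, ∀ t ∈ Set.Icc 0 T, ∀ S : Finset (Fin d → ℤ),
      ∑ k ∈ S, tailWeight (n + 2) ((L : ℝ) + 1) k ^ 2 * ‖u t k‖ ^ 2 ≤ τ L ^ 2 := fun L t ht S =>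
    sum_le_of_tendsto_apply (l := atTop) (hu t ht).1
      (Eventually.of_forall fun N => htail N (U N) (hU N) L t ht S)
  have humem : ∀ t ∈ Set.Icc 0 T, u t ∈ HSigma d (n + 2) := fun t ht =>
    mem_HSigma_iff.2 ⟨(mem_HSigma_iff.1 (hu t ht).2.1).1, (sum_le_B _ (hutail 0 t ht)).1⟩
  have huB : ∀ t ∈ Set.Icc 0 T, sobolevNorm (n + 2) (u t) ≤ B := fun t ht =>
    (sum_le_B _ (hutail 0 t ht)).2
  -- Interpolation between the rate `C / N` in order `n` and the bound `2 B` in order `n + 2` gives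
  -- convergence in order `n + 1`, where `P(u,u)` is continuous with values in order `n`.
  set ρ : ℕ → ℝ := fun N => √(C / N * (2 * B)) with hρ
  have hρ0 : Tendsto ρ atTop (𝓝 0) := by
    have := ((tendsto_const_div_atTop_nhds_zero_nat C).mul_const (2 * B)).sqrt
    rwa [zero_mul, Real.sqrt_zero] at this
  have hρle : ∀ N : ℕ, 1 ≤ N → ∀ t ∈ Set.Icc 0 T, sobolevNorm (n + 1) (u t - U N t) ≤ ρ N := by
    intro N hN t ht
    refine Real.le_sqrt_of_sq_le ?_
    refine (HSigma.sobolevNorm_sq_le_mul hn0 (HSigma.sub (humem t ht) (gU N t ht _))).trans ?_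
    have h1 := (HSigma.summable (humem t ht)).norm_sub_le (HSigma.summable (gU N t ht _))
    have h2 := huB t ht
    have h3 := hUB N t ht
    exact mul_le_mul ((hu t ht).2.2 N hN) (by linarith) (sobolevNorm_nonneg _ _) (by positivity)
  have hcoeff : ∀ N : ℕ, 1 ≤ N → ∀ t ∈ Set.Icc 0 T, ∀ k, ‖u t k - U N t k‖ ≤ ρ N :=
    fun N hN t ht k => (HSigma.norm_apply_le (by linarith)
      (HSigma.sub (HSigma.mono (by linarith) (by linarith) (humem t ht)) (gU N t ht (n + 1))) k).trans
      (hρle N hN t ht)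
  have hsub : timeDomain (T : EReal) ⊆ Set.Icc 0 T := fun t ht =>
    ⟨ht.1, (EReal.coe_lt_coe_iff.1 ht.2).le⟩
  have hcont : ∀ k, ContinuousOn (fun t => u t k) (timeDomain (T : EReal)) := fun k => by
    refine ContinuousOn.mono ?_ hsub
    refine (tendstoUniformlyOn_of_norm_le hρ0 (F := fun N t => U N t k) ?_).continuousOn
      (Frequently.of_forall fun N t ht => ((hU N).deriv t ht k).continuousWithinAt)
    filter_upwards [eventually_ge_atTop 1] with N hN t ht using hcoeff N hN t ht k
  have hu2 : IsContinuousInto (n + 2) (T : EReal) u :=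
    isContinuousInto_of_tail hτ (fun t ht => humem t (hsub ht)) hcont
      fun L t ht => hutail L t (hsub ht)
  have hg := isContinuousInto_field (ν := ν) hn hK hu2 (hf.mono le_top)
  refine ⟨u, by exact_mod_cast hT, hu2, ⟨_, isC1Into_of_hasDerivAt_apply
    (fun t ht => HSigma.mono hn0 (by linarith) (humem t (hsub ht))) hg hcont ?_, fun _ _ => rfl⟩, ?_⟩
  · intro t ht ht0 k
    have htI : t ∈ Set.Ioo 0 T := ⟨ht0, EReal.coe_lt_coe_iff.1 ht.2⟩
    refine hasDerivAt_of_tendstoUniformlyOn (l := atTop) (f := fun N s => U N s k)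
      (f' := fun N s =>
        truncate N (ν • laplacian (U N s) + eulerBilinear (U N s) (U N s) + f s) k)
      (g' := fun s => (ν • laplacian (u s) + eulerBilinear (u s) (u s) + f s) k)
      isOpen_Ioo ?_ ?_ ?_ htI
    · have hb : Tendsto (fun N => (ν * freqNorm k ^ 2 + K * (B + B)) * ρ N) atTop (𝓝 0) := by
        simpa using hρ0.const_mul (ν * freqNorm k ^ 2 + K * (B + B))
      refine tendstoUniformlyOn_of_norm_le hb ?_
      -- Once `N ≥ |k|`, truncation is invisible at the mode `k`, and the right hand sides converge
      -- uniformly in time there.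
      filter_upwards [eventually_ge_atTop 1, eventually_ge_atTop ⌈freqNorm k⌉₊] with N hN hN' s hs
      have hsI : s ∈ Set.Icc 0 T := ⟨hs.1.le, hs.2.le⟩
      rw [truncate_apply_of_mem (mem_modes.2 (Nat.ceil_le.1 hN'))]
      have e : (ν • laplacian (u s) + eulerBilinear (u s) (u s) + f s) k -
          (ν • laplacian (U N s) + eulerBilinear (U N s) (U N s) + f s) k =
          (-(ν * freqNorm k ^ 2)) • (u s k - U N s k) +
          (eulerBilinear (u s) (u s) - eulerBilinear (U N s) (U N s)) k := by
        simp only [Pi.add_apply, Pi.sub_apply, Pi.smul_apply, laplacian, smul_smul, smul_sub,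
          mul_neg]
        abel
      have h1 := HSigma.mono (m := n + 1) (by linarith) (by linarith) (humem s hsI)
      have h2 := gU N s hsI (n + 1)
      have n1 := ((HSigma.summable (humem s hsI)).norm_mono (m := n + 1) (by linarith)
        (by linarith)).trans (huB s hsI)
      have n2 := ((HSigma.summable (gU N s hsI (n + 2))).norm_mono (m := n + 1) (by linarith)
        (by linarith)).trans (hUB N s hsI)
      have hP : ∀ v ∈ HSigma d (n + 1), eulerBilinear v v ∈ HSigma d n := fun v hv =>
        eulerBilinear_mem hn le_rfl (HSigma.mono hn0 (by linarith) hv) hv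
      rw [e, add_mul]
      refine (norm_add_le _ _).trans (add_le_add ?_ ?_)
      · rw [norm_smul, norm_neg, Real.norm_of_nonneg (by positivity)]
        exact mul_le_mul_of_nonneg_left (hcoeff N hN s hsI k) (by positivity)
      · refine (HSigma.norm_apply_le hn0 (HSigma.sub (hP _ h1) (hP _ h2)) k).trans
          ((sobolevNorm_eulerBilinear_self_sub_le hn hK h1 h2).trans ?_)
        refine mul_le_mul (mul_le_mul_of_nonneg_left (add_le_add n1 n2) hK0.le)
          (hρle N hN s hsI) (sobolevNorm_nonneg _ _) ?_
        have := hτ0 0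
        positivity
    · exact Eventually.of_forall fun N s hs => ((hU N).deriv s ⟨hs.1.le, hs.2.le⟩ k).hasDerivAt
        (Icc_mem_nhds hs.1 hs.2)
    · exact fun s hs => (hu s ⟨hs.1.le, hs.2.le⟩).1 k
  · funext k
    refine tendsto_nhds_unique ((hu 0 ⟨le_rfl, hT.le⟩).1 k) (tendsto_const_nhds.congr' ?_)
    filter_upwards [eventually_ge_atTop ⌈freqNorm k⌉₊] with N hN
    rw [(hU N).init, truncate_apply_of_mem (mem_modes.2 (Nat.ceil_le.1 hN))]

end localExistence

/-! ### Locality of the evolution equation -/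

section locality

variable {n K ν : ℝ} {f u w : ℝ → VField d} {u₀ : VField d} {I J : Set ℝ} {t : ℝ}

/-- The curve `u`, on the time interval `I`, is a solution of the evolution equation at the
time `t`. -/
structure IsSolutionAt (n ν : ℝ) (f : ℝ → VField d) (I : Set ℝ) (t : ℝ) (u : ℝ → VField d) :
    Prop where
  mem : u t ∈ HSigma d (n + 2)
  tendsto_norm : Tendsto (fun s => sobolevNorm (n + 2) (u s - u t)) (𝓝[I] t) (𝓝 0)
  tendsto_slope : Tendsto (fun s => sobolevNorm n ((s - t)⁻¹ • (u s - u t) -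
    (ν • laplacian (u t) + eulerBilinear (u t) (u t) + f t))) (𝓝[I \ {t}] t) (𝓝 0)

theorem IsSolutionAt.congr (h : IsSolutionAt n ν f J t u) (hIJ : 𝓝[I] t ≤ 𝓝[J] t) (ht : t ∈ I)
    (hw : w =ᶠ[𝓝[I] t] u) : IsSolutionAt n ν f I t w := by
  have hwt : w t = u t := hw.self_of_nhdsWithin ht
  have h1 : ∀ A : Set ℝ, 𝓝[A \ {t}] t = 𝓝[A] t ⊓ 𝓟 {t}ᶜ := fun A => by
    rw [Set.sdiff_eq, nhdsWithin_inter']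
  refine ⟨hwt ▸ h.mem, ?_, ?_⟩
  · refine (h.tendsto_norm.mono_left hIJ).congr' ?_
    filter_upwards [hw] with s hs
    rw [hs, hwt]
  · refine (h.tendsto_slope.mono_left ?_).congr' ?_
    · rw [h1, h1]
      exact inf_le_inf_right _ hIJ
    · filter_upwards [hw.filter_mono (nhdsWithin_mono t Set.sdiff_subset)] with s hs
      rw [hs, hwt]

theorem IsSolutionAt.comp_add (c : ℝ) (h : IsSolutionAt n ν f I (c + t) u) :
    IsSolutionAt n ν (fun s => f (c + s)) ((c + ·) ⁻¹' I) t (fun s => u (c + s)) := by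
  have hc : Continuous fun s : ℝ => c + s := continuous_const.add continuous_id
  have h1 : ∀ A : Set ℝ, Tendsto (fun s : ℝ => c + s) (𝓝[(c + ·) ⁻¹' A] t) (𝓝[A] (c + t)) :=
    fun A => hc.continuousWithinAt.tendsto_nhdsWithin (Set.mapsTo_preimage _ _)
  refine ⟨h.mem, h.tendsto_norm.comp (h1 I), ?_⟩
  have h2 : (c + ·) ⁻¹' I \ {t} = (c + ·) ⁻¹' (I \ {c + t}) := by
    ext s; simp
  rw [h2]
  refine (h.tendsto_slope.comp (h1 _)).congr fun s => ?_
  simp only [Function.comp_apply, add_sub_add_left_eq_sub]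

/-- The derivative is prescribed by the equation and its continuity is automatic, so being a
solution is a condition on germs at each time. Restriction, translation and gluing become statements
about neighbourhood filters. -/
theorem isSolution_iff {T : EReal} (hn : (d : ℝ) / 2 + 1 < n) (hK : IsBasicConstant d n K)
    (hf : IsContinuousInto n ⊤ f) : IsSolution n ν f u₀ T u ↔
      0 < T ∧ (∀ t ∈ timeDomain T, IsSolutionAt n ν f (timeDomain T) t u) ∧ u 0 = u₀ := by
  have hd : (0 : ℝ) ≤ d := Nat.cast_nonneg d
  constructor
  · rintro ⟨hT, hu, ⟨u', hu', h⟩, h0⟩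
    refine ⟨hT, fun t ht => ⟨hu.1 t ht, hu.2 t ht, ?_⟩, h0⟩
    rw [← h t ht]
    exact hu'.2.2 t ht
  · rintro ⟨hT, h, h0⟩
    have hu : IsContinuousInto (n + 2) T u :=
      ⟨fun t ht => (h t ht).mem, fun t ht => (h t ht).tendsto_norm⟩
    exact ⟨hT, hu, ⟨_, ⟨hu.mono_order (by linarith) (by linarith),
      isContinuousInto_field hn hK hu (hf.mono le_top), fun t ht => (h t ht).tendsto_slope⟩,
      fun _ _ => rfl⟩, h0⟩

theorem nhdsWithin_timeDomain_eq {T T' : EReal} (ht : t ∈ timeDomain T) (ht' : t ∈ timeDomain T') :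
    𝓝[timeDomain T] t = 𝓝[timeDomain T'] t := by
  have key : ∀ S : EReal, t ∈ timeDomain S → 𝓝[timeDomain S] t = 𝓝[Set.Ici 0] t := fun S hS => by
    rw [show timeDomain S = Set.Ici 0 ∩ {t : ℝ | (t : EReal) < S} from rfl]
    exact nhdsWithin_inter_of_mem' (mem_nhdsWithin_of_mem_nhds
      ((isOpen_setOf_coe_lt S).mem_nhds hS.2))
  rw [key T ht, key T' ht']

theorem nhdsWithin_timeDomain_of_pos {T : EReal} (ht : t ∈ timeDomain T) (h0 : 0 < t) :
    𝓝[timeDomain T] t = 𝓝 t := by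
  refine nhdsWithin_eq_nhds.2 ?_
  filter_upwards [Ioi_mem_nhds h0, (isOpen_setOf_coe_lt T).mem_nhds ht.2] with s hs hs'
  exact ⟨le_of_lt hs, hs'⟩

end locality

/-! ### Translations in time -/

section translation

variable {n K ν : ℝ} {f u : ℝ → VField d} {u₀ : VField d}

theorem IsContinuousInto.comp_add {m c : ℝ} (hf : IsContinuousInto m ⊤ f) (hc : 0 ≤ c) :
    IsContinuousInto m ⊤ fun s => f (c + s) := by
  have hmaps : Set.MapsTo (fun s : ℝ => c + s) (timeDomain ⊤) (timeDomain ⊤) :=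
    fun s hs => ⟨add_nonneg hc hs.1, EReal.coe_lt_top _⟩
  exact ⟨fun t ht => hf.1 _ (hmaps ht), fun t ht => (hf.2 _ (hmaps ht)).comp
    ((by fun_prop : Continuous fun s : ℝ => c + s).continuousWithinAt.tendsto_nhdsWithin hmaps)⟩

theorem IsLocallyIntegrableInto.comp_add {m c : ℝ} (hf : IsLocallyIntegrableInto m f)
    (hc : 0 ≤ c) : IsLocallyIntegrableInto m fun s => f (c + s) := by
  have hmp := measurePreserving_add_left (volume : Measure ℝ) c
  constructor
  · have h1 := (ae_restrict_iff' measurableSet_Ici).1 hf.1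
    refine (ae_restrict_iff' measurableSet_Ici).2 ?_
    filter_upwards [hmp.quasiMeasurePreserving.ae h1] with s hs hs'
    exact hs (add_nonneg hc hs')
  · rw [locallyIntegrableOn_iff isClosed_Ici.isLocallyClosed]
    intro k hk hkc
    have h1 := (locallyIntegrableOn_iff isClosed_Ici.isLocallyClosed).1 hf.2 ((c + ·) '' k)
      (by rintro _ ⟨s, hs, rfl⟩; exact add_nonneg hc (hk hs))
      (hkc.image (by fun_prop))
    exact (hmp.integrableOn_image (measurableEmbedding_addLeft c)).1 h1

theorem IsSolution.comp_add {T t₀ : ℝ} (hn : (d : ℝ) / 2 + 1 < n) (hK : IsBasicConstant d n K)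
    (hf : IsContinuousInto n ⊤ f) (hu : IsSolution n ν f u₀ (T : EReal) u) (h0 : 0 ≤ t₀)
    (hT : t₀ < T) : IsSolution n ν (fun s => f (t₀ + s)) (u t₀) ((T - t₀ : ℝ) : EReal)
      fun s => u (t₀ + s) := by
  obtain ⟨-, hu, -⟩ := (isSolution_iff hn hK hf).1 hu
  refine (isSolution_iff hn hK (hf.comp_add h0)).2 ⟨by exact_mod_cast sub_pos.2 hT, fun t ht => ?_,
    by simp⟩
  have hsub : timeDomain ((T - t₀ : ℝ) : EReal) ⊆ (t₀ + ·) ⁻¹' timeDomain (T : EReal) :=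
    fun s hs => ⟨add_nonneg h0 hs.1, EReal.coe_lt_coe_iff.2
      (by have := EReal.coe_lt_coe_iff.1 hs.2; linarith)⟩
  exact ((hu (t₀ + t) (hsub ht)).comp_add t₀).congr (nhdsWithin_mono _ hsub) ht EventuallyEq.rfl

end translation

/-! ### Extension of solutions and maximal solutions -/

section extension

variable {n K G ν : ℝ} {f u v : ℝ → VField d} {u₀ : VField d}

/-- The restart at `t₀ < T` agrees with `u` on the overlap by uniqueness. Near `T` the glued curve
is therefore the restarted solution, and no derivatives need matching. -/
theorem IsSolution.extend {T T₁ t₀ : ℝ} (hn : (d : ℝ) / 2 + 1 < n) (hK : IsBasicConstant d n K)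
    (hG : IsKatoConstant d n G) (hν : 0 ≤ ν) (hf : IsContinuousInto n ⊤ f)
    (hu : IsSolution n ν f u₀ (T : EReal) u) (h0 : 0 ≤ t₀) (hT : t₀ < T)
    (hv : IsSolution n ν (fun s => f (t₀ + s)) (u t₀) (T₁ : EReal) v) (hT₁ : T < t₀ + T₁) :
    ∃ w, IsSolution n ν f u₀ ((t₀ + T₁ : ℝ) : EReal) w ∧
      ∀ t ∈ timeDomain (T : EReal), w t = u t := by
  have huniq := (hu.comp_add hn hK hf h0 hT).eq_of_isSolution hn hK hG hν hv
  have hagree : ∀ s, t₀ ≤ s → s < T → u s = v (s - t₀) := fun s hs hs' => by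
    have := huniq (s - t₀) ⟨sub_nonneg.2 hs, lt_min
      (EReal.coe_lt_coe_iff.2 (by linarith)) (EReal.coe_lt_coe_iff.2 (by linarith))⟩
    rwa [add_sub_cancel] at this
  obtain ⟨hTpos, hu', hu0⟩ := (isSolution_iff hn hK hf).1 hu
  obtain ⟨-, hv', -⟩ := (isSolution_iff hn hK (hf.comp_add h0)).1 hv
  have hT0 : 0 < T := by exact_mod_cast hTpos
  set w : ℝ → VField d := fun s => if s < T then u s else v (s - t₀) with hw
  have hwu : ∀ s < T, w s = u s := fun s hs => if_pos hs
  have hwv : ∀ s, t₀ ≤ s → w s = v (s - t₀) := fun s hs => by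
    by_cases h : s < T
    · rw [hwu s h, hagree s hs h]
    · exact if_neg h
  refine ⟨w, (isSolution_iff hn hK hf).2 ⟨by exact_mod_cast hT0.trans hT₁, fun t ht => ?_, ?_⟩,
    fun t ht => hwu t (EReal.coe_lt_coe_iff.1 ht.2)⟩
  · rcases lt_or_ge t T with h | h
    · have htT : t ∈ timeDomain (T : EReal) := ⟨ht.1, EReal.coe_lt_coe_iff.2 h⟩
      refine (hu' t htT).congr (nhdsWithin_timeDomain_eq ht htT).le ht ?_
      filter_upwards [mem_nhdsWithin_of_mem_nhds (Iio_mem_nhds h)] with s hs using hwu s hs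
    · have h1 : -t₀ + t ∈ timeDomain (T₁ : EReal) :=
        ⟨by linarith, EReal.coe_lt_coe_iff.2 (by have := EReal.coe_lt_coe_iff.1 ht.2; linarith)⟩
      have h2 := (hv' _ h1).comp_add (-t₀)
      simp only [add_neg_cancel_left] at h2
      refine h2.congr ?_ ht ?_
      -- Such a `t` is an interior time for both curves, so both filters are full neighbourhoods.
      · rw [nhdsWithin_timeDomain_of_pos ht (hT0.trans_le h)]
        refine (nhdsWithin_eq_nhds.2 ?_).ge
        refine (by fun_prop : Continuous fun s : ℝ => -t₀ + s).continuousAt.preimage_mem_nhds ?_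
        rw [← nhdsWithin_timeDomain_of_pos h1 (by linarith)]
        exact self_mem_nhdsWithin
      · filter_upwards [mem_nhdsWithin_of_mem_nhds (Ioi_mem_nhds (hT.trans_le h))] with s hs
        rw [hwv s (le_of_lt hs)]
        congr 1
        ring
  · rw [hwu 0 hT0, hu0]

theorem exists_bound_on_Icc {m : ℝ} (hf : IsContinuousInto m ⊤ f) (T : ℝ) :
    ∃ Φ, 0 ≤ Φ ∧ ∀ t ∈ Set.Icc 0 T, sobolevNorm m (f t) ≤ Φ := by
  have hsub : Set.Icc 0 T ⊆ timeDomain ⊤ := fun t ht => ⟨ht.1, EReal.coe_lt_top t⟩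
  obtain ⟨Φ, hΦ⟩ := (isCompact_Icc.image_of_continuousOn (hf.continuousOn_norm.mono hsub)).bddAbove
  exact ⟨max Φ 0, le_max_right _ _, fun t ht =>
    (hΦ (Set.mem_image_of_mem _ ht)).trans (le_max_left _ _)⟩

/-- Local existence, with a uniform existence time for data which are bounded in order `n`. -/
theorem exists_time_isSolution (hn : (d : ℝ) / 2 + 1 < n)
    (hK : IsBasicConstant d n K) (hG : IsKatoConstant d n G) (hν : 0 ≤ ν) {ρ Φ : ℝ} (hρ : 0 ≤ ρ)
    (hΦ : 0 ≤ Φ) : ∃ T : ℝ, 0 < T ∧ ∀ (f : ℝ → VField d) (u₀ : VField d),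
      IsContinuousInto n ⊤ f → IsLocallyIntegrableInto (n + 2) f → u₀ ∈ HSigma d (n + 2) →
      sobolevNorm n u₀ ≤ ρ → (∀ t ∈ Set.Icc 0 1, sobolevNorm n (f t) ≤ Φ) →
      ∃ u, IsSolution n ν f u₀ (T : EReal) u := by
  have hG0 := hG.1
  -- The growth rate in the ball of radius `ρ + 1`. The time `1 / (A + 1)` costs less than the spare
  -- unit of radius, and is at most 1, where `f` is controlled.
  set A := G * (ρ + 1) ^ 2 + Φ with hA
  have hA0 : 0 ≤ A := by positivity
  have hT1 : 1 / (A + 1) ≤ 1 := by rw [div_le_one (by positivity)]; linarith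
  refine ⟨1 / (A + 1), by positivity, fun f u₀ hf hf' hu₀ hu₀ρ hfΦ => ?_⟩
  refine exists_isSolution_of_le hn hK hG hν hf hf' hu₀ (M := ρ + 1) (Φ := Φ) (by positivity)
    (by positivity) (fun t ht => hfΦ t ⟨ht.1, ht.2.trans hT1⟩) ?_
  have : A * (1 / (A + 1)) ≤ 1 := by
    rw [mul_one_div, div_le_one (by positivity)]; linarith
  linarith

/-- The maximal solution is the union of all solutions, up to the supremum of their existence times;
uniqueness makes the union coherent. -/
theorem exists_isMaximalSolution (hn : (d : ℝ) / 2 + 1 < n)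
    (hK : IsBasicConstant d n K) (hG : IsKatoConstant d n G) (hν : 0 ≤ ν)
    (hf : IsContinuousInto n ⊤ f) (hf' : IsLocallyIntegrableInto (n + 2) f)
    (hu₀ : u₀ ∈ HSigma d (n + 2)) :
    ∃ (T : EReal) (u : ℝ → VField d), IsMaximalSolution n ν f u₀ T u := by
  obtain ⟨Φ, hΦ0, hΦ⟩ := exists_bound_on_Icc hf 1
  obtain ⟨T₀, hT₀, hex⟩ := exists_time_isSolution hn hK hG hν (sobolevNorm_nonneg n u₀) hΦ0
  obtain ⟨v₀, hv₀⟩ := hex f u₀ hf hf' hu₀ le_rfl hΦ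
  set E : Set EReal := {T | ∃ v, IsSolution n ν f u₀ T v} with hE
  have hcover : ∀ t ∈ timeDomain (sSup E), ∃ T v, IsSolution n ν f u₀ T v ∧ t ∈ timeDomain T := by
    intro t ht
    obtain ⟨T, ⟨v, hv⟩, hT⟩ := lt_sSup_iff.1 ht.2
    exact ⟨T, v, hv, ht.1, hT⟩
  choose! 𝒯 V hV using hcover
  have hVeq : ∀ t ∈ timeDomain (sSup E), ∀ s ∈ timeDomain (𝒯 t), V s s = V t s := by
    intro t ht s hs
    have hs' : s ∈ timeDomain (sSup E) :=
      timeDomain_mono (le_sSup (show 𝒯 t ∈ E from ⟨_, (hV t ht).1⟩)) hs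
    exact (hV s hs').1.eq_of_isSolution hn hK hG hν (hV t ht).1 s
      ⟨hs.1, lt_min hs.2 (hV s hs').2.2⟩
  have hpos : 0 < sSup E := lt_of_lt_of_le hv₀.1 (le_sSup ⟨v₀, hv₀⟩)
  refine ⟨sSup E, fun t => V t t, (isSolution_iff hn hK hf).2 ⟨hpos, fun t ht => ?_, ?_⟩,
    fun T' w hT' hw _ => (le_sSup (show T' ∈ E from ⟨w, hw⟩)).not_gt hT'⟩
  · obtain ⟨hsol, htT⟩ := hV t ht
    refine (((isSolution_iff hn hK hf).1 hsol).2.1 t htT).congr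
      (nhdsWithin_timeDomain_eq ht htT).le ht ?_
    rw [nhdsWithin_timeDomain_eq ht htT]
    filter_upwards [self_mem_nhdsWithin] with s hs using hVeq t ht s hs
  · exact (hV 0 ⟨le_rfl, by exact_mod_cast hpos⟩).1.2.2.2

/-- A maximal solution cannot stay bounded in order `n` up to a finite end time. -/
theorem IsMaximalSolution.not_bounded {T ρ : ℝ} (hn : (d : ℝ) / 2 + 1 < n)
    (hK : IsBasicConstant d n K) (hG : IsKatoConstant d n G) (hν : 0 ≤ ν)
    (hf : IsContinuousInto n ⊤ f) (hf' : IsLocallyIntegrableInto (n + 2) f)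
    (hu : IsMaximalSolution n ν f u₀ (T : EReal) u) :
    ¬ ∀ t ∈ timeDomain (T : EReal), sobolevNorm n (u t) ≤ ρ := by
  intro hρ
  have hT : 0 < T := by exact_mod_cast hu.1.1
  have hρ0 : 0 ≤ ρ := (sobolevNorm_nonneg _ _).trans (hρ 0 ⟨le_rfl, hu.1.1⟩)
  -- The restart times lie below `T`, and the local theory looks at the force for one further unit
  -- of time.
  obtain ⟨Φ, hΦ0, hΦ⟩ := exists_bound_on_Icc hf (T + 1)
  obtain ⟨T₀, hT₀, hex⟩ := exists_time_isSolution hn hK hG hν hρ0 hΦ0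
  -- A restart within half the uniform existence time before `T` lives beyond `T`, contradicting
  -- maximality.
  set t₀ := max 0 (T - T₀ / 2) with ht₀
  have h0 : 0 ≤ t₀ := le_max_left _ _
  have h1 : t₀ < T := max_lt hT (by linarith)
  have h2 : T < t₀ + T₀ := by have := le_max_right 0 (T - T₀ / 2); linarith
  have hmem : t₀ ∈ timeDomain (T : EReal) := ⟨h0, EReal.coe_lt_coe_iff.2 h1⟩
  obtain ⟨v, hv⟩ := hex (fun s => f (t₀ + s)) (u t₀) (hf.comp_add h0) (hf'.comp_add h0)
    (hu.1.2.1.1 t₀ hmem) (hρ t₀ hmem)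
    fun t ht => hΦ _ ⟨add_nonneg h0 ht.1, by have := ht.2; linarith⟩
  obtain ⟨w, hw, hwu⟩ := hu.1.extend hn hK hG hν hf h0 h1 hv h2
  exact hu.2 _ w (EReal.coe_lt_coe_iff.2 h2) hw hwu

/-- If `T < T_c`, then `R + D` is continuous on the compact interval `[0, T]` and bounds `‖u‖_n`
there, which `IsMaximalSolution.not_bounded` excludes. -/
theorem IsMaximalSolution.le_of_control {T Ta Tc : EReal} (hn : (d : ℝ) / 2 + 1 < n)
    (hK : IsBasicConstant d n K) (hG : IsKatoConstant d n G) (hν : 0 ≤ ν)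
    (hf : IsContinuousInto n ⊤ f) (hf' : IsLocallyIntegrableInto (n + 2) f)
    (hu : IsMaximalSolution n ν f u₀ T u) {ua ua' : ℝ → VField d}
    (hua : IsApproxSolution n Ta ua ua') {D R : ℝ → ℝ} (hD : IsEstimator n Ta ua D)
    (hTc : Tc ≤ Ta) (hR : ContinuousOn R (timeDomain Tc))
    (hbound : ∀ t ∈ timeDomain (min Tc T), sobolevNorm n (u t - ua t) ≤ R t) : Tc ≤ T := by
  have hd : (0 : ℝ) ≤ d := Nat.cast_nonneg d
  by_contra! hlt
  have hT0 := hu.1.1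
  lift T to ℝ using ⟨(hlt.trans_le le_top).ne, ((EReal.bot_lt_zero).trans hT0).ne'⟩
  have hT : 0 < T := by exact_mod_cast hT0
  have hTmem : T ∈ timeDomain Tc := ⟨hT.le, hlt⟩
  have hI := Icc_subset_timeDomain hTmem
  have hIa := hI.trans (timeDomain_mono hTc)
  obtain ⟨ρ, hρ⟩ := (isCompact_Icc.image_of_continuousOn
    ((hR.mono hI).add (hD.1.mono hIa))).bddAbove
  refine hu.not_bounded (ρ := ρ) hn hK hG hν hf hf' fun t ht => ?_
  have htI : t ∈ Set.Icc 0 T := ⟨ht.1, (EReal.coe_lt_coe_iff.1 ht.2).le⟩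
  have h1 := hρ (Set.mem_image_of_mem _ htI)
  have h2 := hbound t ⟨ht.1, lt_min (ht.2.trans hlt) ht.2⟩
  have h3 := (hD.2 t (hIa htI)).2
  have m1 := HSigma.mono (m := n) (by linarith) (by linarith) (hu.1.2.1.1 t ht)
  have m2 := HSigma.mono (m := n) (by linarith) (by linarith) (hua.2.1.1 t (hIa htI))
  have h4 := (HSigma.summable (HSigma.sub m1 m2)).norm_add_le (HSigma.summable m2)
  rw [sub_add_cancel] at h4
  simp only [Pi.add_apply] at h1
  linarith

end extension

end EulerNS

end

/-! ### The main theorem -/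

theorem mainTheorem1
    (d : ℕ) (hd : 2 ≤ d) (n : ℝ) (hn : (d : ℝ) / 2 + 1 < n)
    (K G : ℝ) (hK : EulerNS.IsBasicConstant d n K) (hG : EulerNS.IsKatoConstant d n G)
    (ν : ℝ) (hν : 0 ≤ ν)
    (f : ℝ → EulerNS.VField d) (hf : EulerNS.IsContinuousInto n ⊤ f)
    (u₀ : EulerNS.VField d) (hu₀ : u₀ ∈ EulerNS.HSigma d (n + 2))
    (Ta : EReal) (ua ua' : ℝ → EulerNS.VField d) (hua : EulerNS.IsApproxSolution n Ta ua ua')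
    (ε : ℝ → ℝ) (hε : EulerNS.IsEstimator n Ta (EulerNS.differentialError ν f ua ua') ε)
    (δ : ℝ) (hδ₀ : 0 ≤ δ) (hδ : EulerNS.sobolevNorm n (ua 0 - u₀) ≤ δ)
    (D D₁ : ℝ → ℝ) (hD : EulerNS.IsEstimator n Ta ua D)
    (hD₁ : EulerNS.IsEstimator (n + 1) Ta ua D₁)
    (Tc : EReal) (hTc₀ : 0 < Tc) (hTc : Tc ≤ Ta)
    (R : ℝ → ℝ) (hR : EulerNS.ControlInequalities ν K G ε δ D D₁ Tc R) :
    -- the bound, as long as both sides are defined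
    (∀ (T : EReal) (u : ℝ → EulerNS.VField d), EulerNS.IsMaximalSolution n ν f u₀ T u →
      ∀ t ∈ EulerNS.timeDomain (min Tc T), EulerNS.sobolevNorm n (u t - ua t) ≤ R t) ∧
    -- the maximal solution, its existence time, and the bound on all of `[0, Tc)`
    (EulerNS.IsLocallyIntegrableInto (n + 2) f →
      (∃ (T : EReal) (u : ℝ → EulerNS.VField d), EulerNS.IsMaximalSolution n ν f u₀ T u) ∧
      ∀ (T : EReal) (u : ℝ → EulerNS.VField d), EulerNS.IsMaximalSolution n ν f u₀ T u →
        Tc ≤ T ∧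
        ∀ t ∈ EulerNS.timeDomain Tc, EulerNS.sobolevNorm n (u t - ua t) ≤ R t) := by
  refine ⟨fun T u hu => EulerNS.sobolevNorm_sub_le_of_control hn hK hG hν hu.1 hua hε hδ hD hD₁ hTc
    hR, fun hf' => ⟨EulerNS.exists_isMaximalSolution hn hK hG hν hf hf' hu₀, fun T u hu => ?_⟩⟩
  have hbound := EulerNS.sobolevNorm_sub_le_of_control hn hK hG hν hu.1 hua hε hδ hD hD₁ hTc hR
  have hle : Tc ≤ T := hu.le_of_control hn hK hG hν hf hf' hua hD hTc hR.1 hbound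
  rw [min_eq_left hle] at hbound
  exact ⟨hle, hbound⟩
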